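/- \textbf{Theorem (bipartite maximum matching).} Let $G=(A,B,E)$ be a bipartite graph with vertex set $V=A\cup B$, $n=|V|\ge 1$ vertices and $m=|E|$ edges, viewed as a directed graph with both arcs $(u,v),(v,u)$ for every edge $uv$. For $U\subseteq V$, the \emph{bipartite out-switch} of a digraph $D$ on $V$ at $U$ is the digraph on $V$ in which each $v\in V\setminus U$ keeps its out-neighbours, and each $v\in U$ has as out-neighbours exactly those vertices outside the partition class of $v$ that are not out-neighbours of $v$ in $D$. The bipartite out-switching class of $G$ consists of all digraphs isomorphic to a bipartite out-switch of $G$ at some $U\subseteq V$, and $\widetilde m$ denotes the minimum number of arcs of a digraph in this class. A maximum matching of $G$ can be computed in $O(n^{1.5}+\sqrt n\,\widetilde m+m)$ time. Precisely: there are a single program for the unit-cost word RAM (whose word operations are memory access, addition, truncated subtraction and comparison) and constants $C,\kappa$ such that for every such $G$ with $V=\{0,\dots,n-1\}$, given by $n$, the partition class of each vertex and the adjacency lists (each in arbitrary order, stored consecutively in an array together with the positions at which they begin and end), and for every word capacity $W\ge\kappa(n+m+1)$ (all words being integers in $[0,W)$), the program halts after at most $$C\left(n^{3/2}+\sqrt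 n\,\widetilde m+m\right)$$ steps and outputs a matching of $G$ with the largest possible number of edges, as an array that gives for each vertex its partner, if any. -/

import Mathlib

/-! ### Out-switching classes of bipartite graphs -/

namespace Switching

variable {V : Type*}

/-- An undirected graph, seen as a directed graph with both arcs for every edge. -/
def ofGraph (G : SimpleGraph V) : Digraph V where
  Adj v w := G.Adj v w

/-- The number of arcs of a directed graph. -/
noncomputable def numArcs (D : Digraph V) : ℕ :=
  {p : V × V | D.Adj p.1 p.2}.ncard

/-- The bipartite out-switch of the vertices in `U`, where the function `side` tells the two
partition classes apart: for a switched vertex `v`, its out-neighbours become non-out-neighbours,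
and its non-out-neighbours that lie outside the partition class of `v` become out-neighbours. -/
def outSwitch (side : V → Bool) (U : Set V) (D : Digraph V) : Digraph V where
  Adj v w := (v ∈ U ∧ side v ≠ side w ∧ ¬ D.Adj v w) ∨ (v ∉ U ∧ D.Adj v w)

/-- The bipartite out-switching class of `D`: all digraphs that are isomorphic to a digraph
obtained from `D` by a bipartite out-switch of some set of vertices. -/
def switchingClass (side : V → Bool) (D : Digraph V) : Set (Digraph V) :=
  {H | ∃ U : Set V, Nonempty ((outSwitch side U D).Adj ≃r H.Adj)}

/-- The number of arcs of a minimum representative of the bipartite out-switching class of the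
bipartite graph `G` with partition classes given by the two-colouring `c`. -/
noncomputable def minArcs (G : SimpleGraph V) (c : G.Coloring Bool) : ℕ :=
  sInf (numArcs '' switchingClass c (ofGraph G))

end Switching

/-! ### Maximum matchings -/

/-- `M` is a matching of `G` with the largest possible number of edges. -/
def IsMaximumMatching {V : Type*} {G : SimpleGraph V} (M : G.Subgraph) : Prop :=
  M.IsMatching ∧ ∀ M' : G.Subgraph, M'.IsMatching → M'.edgeSet.ncard ≤ M.edgeSet.ncard

/-! ### A unit-cost word RAM

Programs are structured (assignment, sequencing, branching, loops). They work on variables and on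
zero-based arrays; a program mentions only finitely many of each. Every variable and every array
cell holds a word, which is a natural number below the capacity `W`; so arrays have `W` cells.
There are no operations on words but addition, truncated subtraction and comparison, and each of
them costs one step, just as each memory access does. A program whose computation produces a
number that does not fit into a word has no run. -/

namespace WordRAM

/-- The memory: the contents of the variables and of the arrays. -/
structure State where
  var : ℕ → ℕ
  arr : ℕ → ℕ → ℕ

/-- Expressions: constants, variables, array entries, sums and truncated differences. -/
inductive Expr where
  | lit (k : ℕ)
  | var (x : ℕ)
  | get (a : ℕ) (i : Expr)
  | add (e f : Expr)
  | sub (e f : Expr)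

/-- The value of an expression. -/
def Expr.val (s : State) : Expr → ℕ
  | .lit k => k
  | .var x => s.var x
  | .get a i => s.arr a (i.val s)
  | .add e f => e.val s + f.val s
  | .sub e f => e.val s - f.val s

/-- The values of the expression and of all its subexpressions fit into words. -/
def Expr.Fits (W : ℕ) (s : State) : Expr → Prop
  | .lit k => k < W
  | .var x => s.var x < W
  | .get a i => i.Fits W s ∧ s.arr a (i.val s) < W
  | .add e f => e.Fits W s ∧ f.Fits W s ∧ e.val s + f.val s < W
  | .sub e f => e.Fits W s ∧ f.Fits W s

/-- The number of steps needed to evaluate an expression: one for each of its nodes. -/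
def Expr.cost : Expr → ℕ
  | .lit _ => 1
  | .var _ => 1
  | .get _ i => i.cost + 1
  | .add e f => e.cost + f.cost + 1
  | .sub e f => e.cost + f.cost + 1

/-- Tests: comparisons and their Boolean combinations. -/
inductive Test where
  | lt (e f : Expr)
  | eq (e f : Expr)
  | not (b : Test)
  | and (b c : Test)

/-- The truth of a test. -/
def Test.Holds (s : State) : Test → Prop
  | .lt e f => e.val s < f.val s
  | .eq e f => e.val s = f.val s
  | .not b => ¬ b.Holds s
  | .and b c => b.Holds s ∧ c.Holds s

/-- All values occurring in a test fit into words. -/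
def Test.Fits (W : ℕ) (s : State) : Test → Prop
  | .lt e f => e.Fits W s ∧ f.Fits W s
  | .eq e f => e.Fits W s ∧ f.Fits W s
  | .not b => b.Fits W s
  | .and b c => b.Fits W s ∧ c.Fits W s

/-- The number of steps needed to evaluate a test: one for each of its nodes. -/
def Test.cost : Test → ℕ
  | .lt e f => e.cost + f.cost + 1
  | .eq e f => e.cost + f.cost + 1
  | .not b => b.cost + 1
  | .and b c => b.cost + c.cost + 1

/-- Programs. `assign x e` is `x := e`, and `put a i e` is `a[i] := e`. -/
inductive Cmd where
  | skip
  | assign (x : ℕ) (e : Expr)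
  | put (a : ℕ) (i e : Expr)
  | seq (p q : Cmd)
  | ite (b : Test) (p q : Cmd)
  | loop (b : Test) (p : Cmd)

/-- The memory after storing `k` in the variable `x`. -/
def State.setVar (s : State) (x k : ℕ) : State :=
  { s with var := Function.update s.var x k }

/-- The memory after storing `k` in the cell `i` of the array `a`. -/
def State.setArr (s : State) (a i k : ℕ) : State :=
  { s with arr := Function.update s.arr a (Function.update (s.arr a) i k) }

/-- `Exec W p s t s'`: with words below `W`, the program `p` started on the memory `s` halts
after exactly `t` steps with the memory `s'`. -/
inductive Exec (W : ℕ) : Cmd → State → ℕ → State → Prop where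
  | skip (s : State) : Exec W .skip s 1 s
  | assign (s : State) (x : ℕ) (e : Expr) (he : e.Fits W s) :
      Exec W (.assign x e) s (e.cost + 1) (s.setVar x (e.val s))
  | put (s : State) (a : ℕ) (i e : Expr) (hi : i.Fits W s) (he : e.Fits W s) :
      Exec W (.put a i e) s (i.cost + e.cost + 1) (s.setArr a (i.val s) (e.val s))
  | seq {p q : Cmd} {s s' s'' : State} {t t' : ℕ}
      (hp : Exec W p s t s') (hq : Exec W q s' t' s'') :
      Exec W (.seq p q) s (t + t') s''
  | ite_true {b : Test} {p q : Cmd} {s s' : State} {t : ℕ} (hf : b.Fits W s)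
      (hb : b.Holds s) (hp : Exec W p s t s') :
      Exec W (.ite b p q) s (b.cost + t) s'
  | ite_false {b : Test} {p q : Cmd} {s s' : State} {t : ℕ} (hf : b.Fits W s)
      (hb : ¬ b.Holds s) (hq : Exec W q s t s') :
      Exec W (.ite b p q) s (b.cost + t) s'
  | loop_done {b : Test} {p : Cmd} {s : State} (hf : b.Fits W s) (hb : ¬ b.Holds s) :
      Exec W (.loop b p) s b.cost s
  | loop_step {b : Test} {p : Cmd} {s s' s'' : State} {t t' : ℕ} (hf : b.Fits W s)
      (hb : b.Holds s) (hp : Exec W p s t s') (hl : Exec W (.loop b p) s' t' s'') :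
      Exec W (.loop b p) s (b.cost + t + t') s''

end WordRAM

/-! ### Input and output -/

namespace MatchingProblem

/-- `adj` is an adjacency list representation of `G`: the list `adj v` contains every neighbour
of `v` exactly once, in any order, and nothing else. -/
def IsAdjacencyList {n : ℕ} (G : SimpleGraph (Fin n)) (adj : Fin n → List (Fin n)) : Prop :=
  ∀ v, (adj v).Nodup ∧ ∀ w, w ∈ adj v ↔ G.Adj v w

/-- The initial memory for a graph on the vertices `0, …, n - 1` with partition classes `side`
and adjacency lists `adj`. Variable `0` holds `n`. Array `0` holds the partition class of each
vertex. Array `2` holds the adjacency lists one after the other, and the entries `0, …, n` of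
array `1` tell where they begin and end: the list of `v` occupies the cells of array `2` from
position `arr 1 v` up to, but not including, position `arr 1 (v + 1)`. The rest is zero. -/
def input {n : ℕ} (side : Fin n → Bool) (adj : Fin n → List (Fin n)) : WordRAM.State where
  var x := if x = 0 then n else 0
  arr a i :=
    match a with
    | 0 => if h : i < n then (side ⟨i, h⟩).toNat else 0
    | 1 => if i ≤ n then (((List.ofFn adj).map List.length).take i).sum else 0
    | 2 => ((List.ofFn adj).flatten.map Fin.val).getD i 0
    | _ => 0

/-- The array `out` describes `M`: its entry at `v` is `u + 1` if `v` is matched to `u`, and `0`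
if `v` is unmatched. -/
def Describes {n : ℕ} {G : SimpleGraph (Fin n)} (out : ℕ → ℕ) (M : G.Subgraph) : Prop :=
  ∀ v : Fin n, (∀ u : Fin n, M.Adj v u → out v = u + 1) ∧ ((∀ u, ¬ M.Adj v u) → out v = 0)

end MatchingProblem

namespace WordRAM

/-! ### Straight-line code -/

section Rules

/-! Replace the adjacency list of every left vertex by the shorter of two lists: its neighbours, or
its right non-neighbours. A minimum representative is, up to isomorphism, an out-switch at some `U`.
There a left vertex has at least `codeg` out-neighbours if it lies in `U` and at least `deg`
otherwise. Hence the lists have total length `size ≤ minArcs` (`sum_le_minArcs`). They are prepared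
in time `O(n + m)` (`prepare_runs`), and it remains to find a maximum matching in `O(√n)` passes
over the lists, each of cost `O(size + n)`.

The passes rest on integer prices of the right vertices (`Net.Prices`). Unmatched right vertices
have price `0`. If `u` is matched to `x`, then `p x ≤ p w + 1` for all neighbours `w` of `u`. After
`r` phases no price exceeds `r`, and all neighbours of unmatched left vertices have price at least
`r`. A phase searches depth-first from each unmatched left vertex, starting on level `r`. On level
`k` only unvisited neighbours of price `k` are used, and the partner of such a neighbour continues
on level `k - 1`. The matching is changed along the way and restored on backtracking, so that
reaching an unmatched right vertex, on level `0`, completes an augmentation. Raising the prices of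
all visited vertices by one then gives the invariants for `r + 1` (`Net.Core.prices`).

Once `r² ≥ n`, some price `j` between `1` and `r` belongs to at most `r` right vertices. Together
with at most one end of each matching edge these form a vertex cover (`Net.Prices.exists_cover`), so
at most `r` augmentations are missing. Each of them is found by one breadth-first search
(`round_runs`). A search that fails yields a cover no larger than the matching
(`Net.Bfs.exists_cover`), which proves maximality by weak duality (`matching_ncard_le_cover`).

The delicate point is to scan the neighbours of a vertex that is given by its non-neighbours
(`scan_runs`). The right vertices are kept in linked lists, one for each price, in decreasing order.
The scan first marks the listed non-neighbours of the current price, then walks along the linked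
list. Visited elements are deleted for good, marked ones are skipped at the expense of a list entry,
and any other element is an unvisited neighbour. Unfinished scans on the search path have different
prices, so they share the marks and the linked lists without disturbing each other. The potential
`Net.pot` amortises all scans of a pass. -/

@[simp] theorem State.setVar_var (s : State) (x k y : ℕ) :
    (s.setVar x k).var y = if y = x then k else s.var y := by
  simp [State.setVar, Function.update_apply]

@[simp] theorem State.setVar_arr (s : State) (x k : ℕ) : (s.setVar x k).arr = s.arr := rfl

@[simp] theorem State.setArr_var (s : State) (a i k : ℕ) : (s.setArr a i k).var = s.var := rfl

@[simp] theorem State.setArr_arr (s : State) (a i k b : ℕ) :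
    (s.setArr a i k).arr b = if b = a then Function.update (s.arr a) i k else s.arr b := by
  by_cases h : b = a
  · subst h; simp [State.setArr]
  · simp [State.setArr, h]

/-- All words of the memory are below `N`. -/
structure Bdd (N : ℕ) (s : State) : Prop where
  two_le : 2 ≤ N
  var : ∀ x, s.var x < N
  arr : ∀ a i, s.arr a i < N

/-- The number of words whose sum bounds the value of an expression. -/
def Expr.weight : Expr → ℕ
  | .lit _ => 1
  | .var _ => 1
  | .get _ _ => 1
  | .add e f => e.weight + f.weight
  | .sub e _ => e.weight

/-- Constants are at most `1`, and at most four words are added up. -/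
def Expr.ok : Expr → Bool
  | .lit k => k ≤ 1
  | .var _ => true
  | .get _ i => i.ok
  | .add e f => e.ok && f.ok && (e.weight + f.weight ≤ 4)
  | .sub e f => e.ok && f.ok

def Test.ok : Test → Bool
  | .lt e f => e.ok && f.ok
  | .eq e f => e.ok && f.ok
  | .not b => b.ok
  | .and b c => b.ok && c.ok

def Cmd.ok : Cmd → Bool
  | .skip => true
  | .assign _ e => e.ok
  | .put _ i e => i.ok && e.ok
  | .seq p q => p.ok && q.ok
  | .ite b p q => b.ok && p.ok && q.ok
  | .loop b p => b.ok && p.ok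

/-- What has to be shown in order to know that the value of the expression is below `N`. -/
def Expr.Small (N : ℕ) (s : State) : Expr → Prop
  | .add e f => e.val s + f.val s < N
  | .sub e f => e.val s - f.val s < N
  | _ => True

variable {N W : ℕ} {s : State}

theorem Expr.weight_le : ∀ {e : Expr}, e.ok = true → e.weight ≤ 4
  | .lit _, _ => by simp [Expr.weight]
  | .var _, _ => by simp [Expr.weight]
  | .get _ _, _ => by simp [Expr.weight]
  | .add e f, h => by
      simp only [Expr.ok, Bool.and_eq_true, decide_eq_true_eq] at h
      exact h.2
  | .sub e f, h => by
      simp only [Expr.ok, Bool.and_eq_true] at h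
      exact Expr.weight_le (e := e) h.1

theorem Expr.val_lt (hs : Bdd N s) : ∀ {e : Expr}, e.ok = true → e.val s < e.weight * N
  | .lit k, h => by
      have := hs.two_le
      simp only [Expr.ok, decide_eq_true_eq] at h
      simp only [Expr.val, Expr.weight]; omega
  | .var x, _ => by simpa [Expr.val, Expr.weight] using hs.var x
  | .get a i, _ => by simpa [Expr.val, Expr.weight] using hs.arr a _
  | .add e f, h => by
      simp only [Expr.ok, Bool.and_eq_true] at h
      have h1 := Expr.val_lt hs (e := e) h.1.1
      have h2 := Expr.val_lt hs (e := f) h.1.2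
      simp only [Expr.val, Expr.weight, add_mul]; omega
  | .sub e f, h => by
      simp only [Expr.ok, Bool.and_eq_true] at h
      have h1 := Expr.val_lt hs (e := e) h.1
      simp only [Expr.val, Expr.weight]; omega

theorem Expr.val_lt_of_ok (hs : Bdd N s) (hW : 4 * N ≤ W) {e : Expr} (h : e.ok = true) :
    e.val s < W :=
  (Expr.val_lt hs h).trans_le ((Nat.mul_le_mul_right _ (Expr.weight_le h)).trans hW)

theorem Expr.fits (hs : Bdd N s) (hW : 4 * N ≤ W) : ∀ {e : Expr}, e.ok = true → e.Fits W s
  | .lit k, h => Expr.val_lt_of_ok (e := .lit k) hs hW h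
  | .var x, h => Expr.val_lt_of_ok (e := .var x) hs hW h
  | .get a i, h => ⟨Expr.fits hs hW (e := i) h, Expr.val_lt_of_ok (e := .get a i) hs hW h⟩
  | .add e f, h => by
      have h' := h
      simp only [Expr.ok, Bool.and_eq_true] at h'
      exact ⟨Expr.fits hs hW h'.1.1, Expr.fits hs hW h'.1.2,
        Expr.val_lt_of_ok (e := .add e f) hs hW h⟩
  | .sub e f, h => by
      simp only [Expr.ok, Bool.and_eq_true] at h
      exact ⟨Expr.fits hs hW h.1, Expr.fits hs hW h.2⟩

theorem Test.fits (hs : Bdd N s) (hW : 4 * N ≤ W) : ∀ {b : Test}, b.ok = true → b.Fits W s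
  | .lt e f, h => by
      simp only [Test.ok, Bool.and_eq_true] at h
      exact ⟨Expr.fits hs hW h.1, Expr.fits hs hW h.2⟩
  | .eq e f, h => by
      simp only [Test.ok, Bool.and_eq_true] at h
      exact ⟨Expr.fits hs hW h.1, Expr.fits hs hW h.2⟩
  | .not b, h => Test.fits (b := b) hs hW h
  | .and b c, h => by
      simp only [Test.ok, Bool.and_eq_true] at h
      exact ⟨Test.fits hs hW h.1, Test.fits hs hW h.2⟩

theorem Expr.val_lt_of_small (hs : Bdd N s) {e : Expr} (h : e.ok = true) (he : e.Small N s) :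
    e.val s < N := by
  cases e with
  | lit k => simpa [Expr.weight] using Expr.val_lt hs h
  | var x => exact hs.var x
  | get a i => exact hs.arr a _
  | add e f => exact he
  | sub e f => exact he

theorem Expr.small_of_val_lt {e : Expr} (h : e.val s < N) : e.Small N s := by
  cases e with
  | lit k => trivial
  | var x => trivial
  | get a i => trivial
  | add e f => exact h
  | sub e f => exact h

theorem Bdd.setVar (hs : Bdd N s) {x k : ℕ} (hk : k < N) : Bdd N (s.setVar x k) where
  two_le := hs.two_le
  var y := by rw [State.setVar_var]; split_ifs <;> [exact hk; exact hs.var y]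
  arr := hs.arr

theorem Bdd.setArr (hs : Bdd N s) {a i k : ℕ} (hk : k < N) : Bdd N (s.setArr a i k) where
  two_le := hs.two_le
  var := hs.var
  arr b j := by
    rw [State.setArr_arr]
    split_ifs with h
    · rw [Function.update_apply]; split_ifs <;> [exact hk; exact hs.arr a j]
    · exact hs.arr b j

/-! ### Total correctness with running times -/

/-- The weakest precondition of loop-free code. -/
def wp (N : ℕ) : Cmd → (State → Prop) → State → Prop
  | .skip, Q, s => Q s
  | .assign x e, Q, s => e.Small N s ∧ Q (s.setVar x (e.val s))
  | .put a i e, Q, s => e.Small N s ∧ Q (s.setArr a (i.val s) (e.val s))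
  | .seq p q, Q, s => wp N p (wp N q Q) s
  | .ite b p q, Q, s => (b.Holds s → wp N p Q s) ∧ (¬ b.Holds s → wp N q Q s)
  | .loop _ _, _, _ => False

/-- A bound for the running time of loop-free code. -/
def Cmd.time : Cmd → ℕ
  | .skip => 1
  | .assign _ e => e.cost + 1
  | .put _ i e => i.cost + e.cost + 1
  | .seq p q => p.time + q.time
  | .ite b p q => b.cost + (p.time + q.time)
  | .loop _ _ => 0

/-- Started on `s`, the program halts within `T` steps, with small words, in a memory that
satisfies `Q`. -/
def Runs (N : ℕ) (p : Cmd) (T : ℕ) (s : State) (Q : State → Prop) : Prop :=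
  ∀ W, 4 * N ≤ W → ∃ t s', Exec W p s t s' ∧ t ≤ T ∧ Bdd N s' ∧ Q s'

/-- The bound for a branching counts both branches, so it depends on the code alone and can be
evaluated by `decide` or `simp`. -/
theorem Runs.of_wp : ∀ {p : Cmd} {s : State} {Q : State → Prop}, Bdd N s → p.ok = true →
    wp N p Q s → Runs N p p.time s Q
  | .skip, s, Q, hs, _, h => fun W _ => ⟨1, s, .skip s, le_rfl, hs, h⟩
  | .assign x e, s, Q, hs, hp, h => fun W hW =>
      ⟨_, _, .assign s x e (Expr.fits hs hW hp), le_rfl,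
        hs.setVar (Expr.val_lt_of_small hs hp h.1), h.2⟩
  | .put a i e, s, Q, hs, hp, h => fun W hW => by
      simp only [Cmd.ok, Bool.and_eq_true] at hp
      exact ⟨_, _, .put s a i e (Expr.fits hs hW hp.1) (Expr.fits hs hW hp.2), le_rfl,
        hs.setArr (Expr.val_lt_of_small hs hp.2 h.1), h.2⟩
  | .seq p q, s, Q, hs, hp, h => fun W hW => by
      simp only [Cmd.ok, Bool.and_eq_true] at hp
      obtain ⟨t, s', h1, h2, h3, h4⟩ := Runs.of_wp hs hp.1 h W hW
      obtain ⟨t', s'', h1', h2', h3', h4'⟩ := Runs.of_wp h3 hp.2 h4 W hW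
      exact ⟨_, _, .seq h1 h1', add_le_add h2 h2', h3', h4'⟩
  | .ite b p q, s, Q, hs, hp, h => fun W hW => by
      simp only [Cmd.ok, Bool.and_eq_true] at hp
      have hf := Test.fits hs hW hp.1.1
      by_cases hb : b.Holds s
      · obtain ⟨t, s', h1, h2, h3, h4⟩ := Runs.of_wp hs hp.1.2 (h.1 hb) W hW
        exact ⟨_, _, .ite_true hf hb h1, by simp only [Cmd.time]; omega, h3, h4⟩
      · obtain ⟨t, s', h1, h2, h3, h4⟩ := Runs.of_wp hs hp.2 (h.2 hb) W hW
        exact ⟨_, _, .ite_false hf hb h1, by simp only [Cmd.time]; omega, h3, h4⟩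
  | .loop b p, s, Q, hs, hp, h => h.elim

theorem Runs.mono {p : Cmd} {T T' : ℕ} {Q Q' : State → Prop} (h : Runs N p T s Q)
    (hT : T ≤ T') (hQ : ∀ s', Bdd N s' → Q s' → Q' s') : Runs N p T' s Q' := fun W hW => by
  obtain ⟨t, s', h1, h2, h3, h4⟩ := h W hW
  exact ⟨t, s', h1, h2.trans hT, h3, hQ s' h3 h4⟩

theorem Runs.seq {p q : Cmd} {T T' : ℕ} {Q Q' : State → Prop} (hp : Runs N p T s Q)
    (hq : ∀ s', Bdd N s' → Q s' → Runs N q T' s' Q') : Runs N (.seq p q) (T + T') s Q' :=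
  fun W hW => by
  obtain ⟨t, s', h1, h2, h3, h4⟩ := hp W hW
  obtain ⟨t', s'', h1', h2', h3', h4'⟩ := hq s' h3 h4 W hW
  exact ⟨_, _, .seq h1 h1', add_le_add h2 h2', h3', h4'⟩

theorem Runs.ite {b : Test} {p q : Cmd} {T : ℕ} {Q : State → Prop} (hs : Bdd N s)
    (hb : b.ok = true) (hp : b.Holds s → Runs N p T s Q) (hq : ¬ b.Holds s → Runs N q T s Q) :
    Runs N (.ite b p q) (b.cost + T) s Q := fun W hW => by
  have hf := Test.fits hs hW hb
  by_cases h : b.Holds s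
  · obtain ⟨t, s', h1, h2, h3, h4⟩ := hp h W hW
    exact ⟨_, _, .ite_true hf h h1, by omega, h3, h4⟩
  · obtain ⟨t, s', h1, h2, h3, h4⟩ := hq h W hW
    exact ⟨_, _, .ite_false hf h h1, by omega, h3, h4⟩

/-- A loop whose invariant `I k` entitles to `k` more steps. -/
theorem Runs.loop {b : Test} {p : Cmd} (I : ℕ → State → Prop) (hb : b.ok = true)
    (step : ∀ k s, Bdd N s → I k s → b.Holds s →
      ∃ T, Runs N p T s fun s' => ∃ k', I k' s' ∧ k' + T + b.cost ≤ k)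
    {k : ℕ} (hs : Bdd N s) (h : I k s) :
    Runs N (.loop b p) (k + b.cost) s fun s' => (∃ k', I k' s') ∧ ¬ b.Holds s' := fun W hW => by
  -- Every test costs at least one step, so the budget strictly decreases and strong induction on it
  -- applies.
  have hcost : 0 < b.cost := by cases b <;> simp [Test.cost]
  induction k using Nat.strong_induction_on generalizing s with
  | _ k ih =>
    have hf := Test.fits hs hW hb
    by_cases hh : b.Holds s
    · obtain ⟨T, hT⟩ := step k s hs h hh
      obtain ⟨t, s', h1, h2, h3, k', h4, h5⟩ := hT W hW
      obtain ⟨t', s'', h1', h2', h3', h4'⟩ := ih k' (by omega) h3 h4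
      exact ⟨_, _, .loop_step hf hh h1 h1', by omega, h3', h4'⟩
    · exact ⟨_, _, .loop_done hf hh, by omega, hs, ⟨k, h⟩, hh⟩

/-- A loop whose body takes at most `c` steps and whose invariant `I k` entitles to `k` more
rounds. -/
theorem Runs.loop_const {b : Test} {p : Cmd} (I : ℕ → State → Prop) (c : ℕ) (hb : b.ok = true)
    (step : ∀ k s, Bdd N s → I k s → b.Holds s →
      Runs N p c s fun s' => ∃ k', I k' s' ∧ k' < k)
    {k : ℕ} (hs : Bdd N s) (h : I k s) :
    Runs N (.loop b p) (k * (c + b.cost) + b.cost) s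
      fun s' => (∃ k', I k' s') ∧ ¬ b.Holds s' := by
  refine (Runs.loop (fun K s => ∃ k, I k s ∧ K = k * (c + b.cost)) hb ?_ hs ⟨k, h, rfl⟩).mono
    le_rfl ?_
  · rintro _ s hs ⟨k, hk, rfl⟩ hh
    refine ⟨c, (step k s hs hk hh).mono le_rfl ?_⟩
    rintro s' - ⟨k', hk', hlt⟩
    refine ⟨_, ⟨k', hk', rfl⟩, ?_⟩
    calc k' * (c + b.cost) + c + b.cost = (k' + 1) * (c + b.cost) := by ring
      _ ≤ k * (c + b.cost) := Nat.mul_le_mul_right _ hlt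
  · rintro s' - ⟨⟨_, k, hk, -⟩, hh⟩
    exact ⟨⟨k, hk⟩, hh⟩

end Rules

end WordRAM

infixr:60 " ;; " => WordRAM.Cmd.seq

namespace BipartiteMatching

open WordRAM

/-! ### Scanning the neighbours of a left vertex -/

/-- A bipartite graph on `0, …, n - 1`, together with a list for each left vertex `u`: of its
neighbours if `dense u = 0`, and of the right vertices that are not its neighbours otherwise. -/
structure Net where
  n : ℕ
  side : ℕ → ℕ
  adj : ℕ → ℕ
  ext : ℕ → ℕ
  base : ℕ → ℕ
  len : ℕ → ℕ
  dense : ℕ → ℕ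
  E : ℕ → ℕ → Prop

namespace Net

variable (D : Net)

def L (u : ℕ) : Prop := u < D.n ∧ D.side u = 0

def R (w : ℕ) : Prop := w < D.n ∧ D.side w = 1

def item (u i : ℕ) : ℕ := if D.dense u = 0 then D.adj (D.base u + i) else D.ext (D.base u + i)

/-- Repetitions in the lists are allowed. For a dense vertex both inclusions matter: one makes marks
trustworthy, the other shows that an unmarked vertex is a neighbour. -/
structure Valid : Prop where
  left : ∀ {u w}, D.E u w → D.L u
  right : ∀ {u w}, D.E u w → D.R w
  sparse : ∀ {u}, D.L u → D.dense u = 0 → ∀ w, D.E u w ↔ ∃ i < D.len u, D.item u i = w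
  dense_right : ∀ {u}, D.L u → D.dense u ≠ 0 → ∀ i < D.len u, D.R (D.item u i)
  dense_not : ∀ {u}, D.L u → D.dense u ≠ 0 → ∀ i < D.len u, ¬ D.E u (D.item u i)
  dense_cover : ∀ {u}, D.L u → D.dense u ≠ 0 → ∀ w, D.R w → ¬ D.E u w →
    ∃ i < D.len u, D.item u i = w

/-- The memory holds the graph. -/
structure Stored (s : State) : Prop where
  n : s.var 0 = D.n
  side : s.arr 0 = D.side
  adj : s.arr 2 = D.adj
  ext : s.arr 4 = D.ext
  base : s.arr 5 = D.base
  len : s.arr 6 = D.len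
  dense : s.arr 7 = D.dense

variable {D}

theorem L.not_R {u : ℕ} (h : D.L u) : ¬ D.R u := fun h' => by
  have h1 := h.2
  have h2 := h'.2
  omega

theorem L.ne_R {u w : ℕ} (h : D.L u) (h' : D.R w) : u ≠ w := fun e => h.not_R (e ▸ h')

theorem Valid.item_right (hD : D.Valid) {u i : ℕ} (hu : D.L u) (hi : i < D.len u) :
    D.R (D.item u i) := by
  by_cases h : D.dense u = 0
  · exact hD.right ((hD.sparse hu h _).2 ⟨i, hi, rfl⟩)
  · exact hD.dense_right hu h i hi

variable (D)

/-- `a` is an element of the list of the right vertices of price `l`, or its head. -/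
def Node (p : ℕ → ℕ) (S : Finset ℕ) (l a : ℕ) : Prop := a = D.n + l ∨ a ∈ S ∧ p a = l

/-- `S` is the set of the right vertices in the lists, which are sorted decreasingly; all
unvisited right vertices are in the lists. Marks tell non-neighbours. -/
structure Lists (p vis nxt mark : ℕ → ℕ) (S : Finset ℕ) : Prop where
  right : ∀ c ∈ S, D.R c
  unvisited : ∀ w, D.R w → vis w = 0 → w ∈ S
  nxt_zero : ∀ l ≤ D.n, ∀ a, D.Node p S l a → nxt a = 0 → ∀ c ∈ S, p c = l → a ≤ c
  nxt_succ : ∀ l ≤ D.n, ∀ a, D.Node p S l a → ∀ b, nxt a = b + 1 → b ∈ S ∧ p b = l ∧ b < a ∧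
    ∀ c ∈ S, p c = l → c < a → c ≤ b
  mark : ∀ x u, D.L u → mark x = u + 1 → ¬ D.E u x

/-- The state of a scan for unvisited neighbours of `u` of price `l`. -/
structure Scanning (p vis mark ptr prv : ℕ → ℕ) (S : Finset ℕ) (u l : ℕ) : Prop where
  sparse : D.dense u = 0 → ∀ i < ptr u, p (D.item u i) = l → vis (D.item u i) ≠ 0
  dense : D.dense u ≠ 0 → ∀ i < ptr u, p (D.item u i) = l → mark (D.item u i) = u + 1
  node : D.Node p S l (prv u)
  passed : ∀ c ∈ S, p c = l → prv u ≤ c → ¬ D.E u c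
  ptr_le : ptr u ≤ D.len u

/-- A bound for the number of steps left in the scan at `u`. -/
def todo (ptr prv : ℕ → ℕ) (u : ℕ) : ℕ :=
  (D.len u - ptr u) + ((Finset.range (D.len u)).filter fun i => D.item u i < prv u).card

/-- A scan step that neither finds a vertex nor ends the scan reads a list entry, skips a
non-neighbour, or deletes an element of `S` for good; each of these lowers the potential. -/
def pot (ptr prv : ℕ → ℕ) (S : Finset ℕ) : ℕ :=
  ∑ u ∈ Finset.range D.n, D.todo ptr prv u + S.card

variable {D}

theorem pot_lt {ptr prv ptr' prv' : ℕ → ℕ} {S S' : Finset ℕ} {u : ℕ} (hu : u < D.n)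
    (hptr : ∀ v, v ≠ u → ptr' v = ptr v) (hprv : ∀ v, v ≠ u → prv' v = prv v)
    (h : D.todo ptr' prv' u < D.todo ptr prv u) (hS : S'.card ≤ S.card) :
    D.pot ptr' prv' S' < D.pot ptr prv S := by
  refine add_lt_add_of_lt_of_le (Finset.sum_lt_sum (fun v _ => ?_) ⟨u, by simpa using hu, h⟩) hS
  rcases eq_or_ne v u with rfl | hv
  · exact h.le
  · simp [todo, hptr v hv, hprv v hv]

theorem pot_le {ptr prv ptr' prv' : ℕ → ℕ} {S : Finset ℕ}
    (h : ∀ u < D.n, D.todo ptr' prv' u ≤ D.todo ptr prv u) :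
    D.pot ptr' prv' S ≤ D.pot ptr prv S :=
  Nat.add_le_add_right (Finset.sum_le_sum fun u hu => h u (by simpa using hu)) _

/-- Visited vertices may stay in the lists; they are deleted only when a scan meets them. -/
theorem Lists.visit {p vis nxt mark : ℕ → ℕ} {S : Finset ℕ} (h : D.Lists p vis nxt mark S)
    (x : ℕ) : D.Lists p (Function.update vis x 1) nxt mark S where
  right := h.right
  unvisited w hw hv := h.unvisited w hw (by
    rw [Function.update_apply] at hv; split_ifs at hv; exact hv)
  nxt_zero := h.nxt_zero
  nxt_succ := h.nxt_succ
  mark := h.mark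

theorem Scanning.visit {p vis mark ptr prv : ℕ → ℕ} {S : Finset ℕ} {u l : ℕ}
    (h : D.Scanning p vis mark ptr prv S u l) (x : ℕ) :
    D.Scanning p (Function.update vis x 1) mark ptr prv S u l where
  sparse hd i hi hp := by
    rw [Function.update_apply]
    split_ifs
    · exact one_ne_zero
    · exact h.sparse hd i hi hp
  dense := h.dense
  node := h.node
  passed := h.passed
  ptr_le := h.ptr_le

/-- The heads are numbered from `D.n` on, above all elements, so a scan that stands at a head has
passed nothing. -/
theorem Scanning.start {p vis mark ptr prv : ℕ → ℕ} {S : Finset ℕ} {u l : ℕ}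
    (hS : ∀ c ∈ S, c < D.n) (h : ptr u = 0) (h' : prv u = D.n + l) :
    D.Scanning p vis mark ptr prv S u l where
  sparse _ i hi := by omega
  dense _ i hi := by omega
  node := .inl h'
  passed c hc _ hle := by
    have := hS c hc
    omega
  ptr_le := by omega

theorem Scanning.congr {p vis mark ptr prv ptr' prv' : ℕ → ℕ} {S : Finset ℕ} {u l : ℕ}
    (h : D.Scanning p vis mark ptr prv S u l) (h1 : ptr' u = ptr u) (h2 : prv' u = prv u) :
    D.Scanning p vis mark ptr' prv' S u l where
  sparse := by rw [h1]; exact h.sparse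
  dense := by rw [h1]; exact h.dense
  node := by rw [h2]; exact h.node
  passed := by rw [h2]; exact h.passed
  ptr_le := by rw [h1]; exact h.ptr_le

/-- A visited element of a list can be bypassed. -/
theorem Lists.remove {p vis nxt mark : ℕ → ℕ} {S : Finset ℕ} (h : D.Lists p vis nxt mark S)
    {l a x : ℕ} (hl : l ≤ D.n) (ha : D.Node p S l a) (hx : nxt a = x + 1) (hv : vis x ≠ 0) :
    D.Lists p vis (Function.update nxt a (nxt x)) mark (S.erase x) := by
  obtain ⟨hxS, hxl, hxa, hmax⟩ := h.nxt_succ l hl a ha x hx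
  have hlt : ∀ c ∈ S, c < D.n := fun c hc => (h.right c hc).1
  have hxN := hlt x hxS
  have node : ∀ k b, D.Node p (S.erase x) k b → D.Node p S k b := fun k b hb =>
    hb.imp_right fun h' => ⟨Finset.mem_of_mem_erase h'.1, h'.2⟩
  have level : ∀ k ≤ D.n, D.Node p S k a → k = l := fun k hk hb => by
    rcases ha with ha | ha <;> rcases hb with hb | hb
    · omega
    · have := hlt a hb.1
      omega
    · have := hlt a ha.1
      omega
    · exact hb.2.symm.trans ha.2
  have hnx : D.Node p S l x := .inr ⟨hxS, hxl⟩
  refine ⟨fun c hc => h.right c (Finset.mem_of_mem_erase hc), fun w hw hw' =>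
    Finset.mem_erase.2 ⟨by rintro rfl; exact hv hw', h.unvisited w hw hw'⟩, ?_, ?_, h.mark⟩
  · intro k hk b hb h0 c hc hck
    have hcS := Finset.mem_of_mem_erase hc
    have hcx := Finset.ne_of_mem_erase hc
    rw [Function.update_apply] at h0
    split_ifs at h0 with hba
    · subst hba
      obtain rfl := level k hk (node k b hb)
      have := h.nxt_zero k hk x hnx h0 c hcS hck
      by_contra hlt'
      have := hmax c hcS hck (by omega)
      omega
    · exact h.nxt_zero k hk b (node k b hb) h0 c hcS hck
  · intro k hk b hb y hy
    rw [Function.update_apply] at hy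
    split_ifs at hy with hba
    · subst hba
      obtain rfl := level k hk (node k b hb)
      obtain ⟨h1, h2, h3, h4⟩ := h.nxt_succ k hk x hnx y hy
      refine ⟨Finset.mem_erase.2 ⟨by omega, h1⟩, h2, by omega, fun c hc hck hcb => ?_⟩
      have hcS := Finset.mem_of_mem_erase hc
      have hcx := Finset.ne_of_mem_erase hc
      have := hmax c hcS hck hcb
      exact h4 c hcS hck (by omega)
    · obtain ⟨h1, h2, h3, h4⟩ := h.nxt_succ k hk b (node k b hb) y hy
      refine ⟨Finset.mem_erase.2 ⟨?_, h1⟩, h2, h3, fun c hc hck hcb =>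
        h4 c (Finset.mem_of_mem_erase hc) hck hcb⟩
      -- Two different nodes `a` and `b` cannot both precede `x`: `x` would be the largest element
      -- below each of them, yet the smaller of the two is an element between `x` and the other.
      rintro rfl
      obtain rfl : k = l := h2.symm.trans hxl
      rcases lt_or_gt_of_ne hba with hba | hba
      · have hbS : b ∈ S := by
          rcases ha with ha | ha <;> rcases hb with hb | hb
          · omega
          · exact Finset.mem_of_mem_erase hb.1
          · have := hlt a ha.1
            omega
          · exact Finset.mem_of_mem_erase hb.1
        have hbk : p b = k := by
          rcases hb with hb | hb
          · have := hlt b hbS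
            omega
          · exact hb.2
        have := hmax b hbS hbk hba
        omega
      · have haS : a ∈ S := by
          rcases ha with ha | ha
          · rcases hb with hb | hb
            · omega
            · have := hlt b (Finset.mem_of_mem_erase hb.1)
              omega
          · exact ha.1
        have hak : p a = k := by
          rcases ha with ha | ha
          · have := hlt a haS
            omega
          · exact ha.2
        have := h4 a haS hak hba
        omega

end Net

/-! ### One step of a scan and its effect -/

/-- One step of the scan of the neighbours of the left vertex `var 1` for an unvisited one of
price `var 2`: `var 4` becomes the successor of a vertex that is found, `var 5` becomes `1` if
there is none. -/
def scan : Cmd :=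
  .assign 4 (.lit 0) ;; .assign 5 (.lit 0) ;;
  .ite (.lt (.get 8 (.var 1)) (.get 6 (.var 1)))
    (.ite (.eq (.get 7 (.var 1)) (.lit 0))
      (.assign 3 (.get 2 (.add (.get 5 (.var 1)) (.get 8 (.var 1)))) ;;
        .put 8 (.var 1) (.add (.get 8 (.var 1)) (.lit 1)) ;;
        .ite (.and (.eq (.get 10 (.var 3)) (.var 2)) (.eq (.get 11 (.var 3)) (.lit 0)))
          (.assign 4 (.add (.var 3) (.lit 1))) .skip)
      (.assign 3 (.get 4 (.add (.get 5 (.var 1)) (.get 8 (.var 1)))) ;;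
        .put 8 (.var 1) (.add (.get 8 (.var 1)) (.lit 1)) ;;
        .ite (.eq (.get 10 (.var 3)) (.var 2))
          (.put 13 (.var 3) (.add (.var 1) (.lit 1))) .skip))
    (.ite (.eq (.get 7 (.var 1)) (.lit 0)) (.assign 5 (.lit 1))
      (.assign 13 (.get 9 (.var 1)) ;;
        .ite (.eq (.get 12 (.var 13)) (.lit 0)) (.assign 5 (.lit 1))
          (.assign 3 (.sub (.get 12 (.var 13)) (.lit 1)) ;;
            .ite (.eq (.get 11 (.var 3)) (.lit 0))
              (.ite (.eq (.get 13 (.var 3)) (.add (.var 1) (.lit 1)))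
                (.put 9 (.var 1) (.var 3))
                (.assign 4 (.add (.var 3) (.lit 1))))
              (.put 12 (.var 13) (.get 12 (.var 3))))))

namespace Net

variable {D : Net} {p vis nxt mark ptr prv : ℕ → ℕ} {S : Finset ℕ} {u l : ℕ}

theorem Scanning.advance_sparse (h : D.Scanning p vis mark ptr prv S u l) (hd : D.dense u = 0)
    (hlt : ptr u < D.len u) (hv : p (D.item u (ptr u)) = l → vis (D.item u (ptr u)) ≠ 0) :
    D.Scanning p vis mark (Function.update ptr u (ptr u + 1)) prv S u l where
  sparse _ i hi hp := by
    rw [Function.update_self] at hi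
    rcases (Nat.lt_succ_iff_lt_or_eq.1 hi) with hi | rfl
    · exact h.sparse hd i hi hp
    · exact hv hp
  dense h' := absurd hd h'
  node := h.node
  passed := h.passed
  ptr_le := by rw [Function.update_self]; omega

theorem Scanning.advance_dense (h : D.Scanning p vis mark ptr prv S u l) (hd : D.dense u ≠ 0)
    (hlt : ptr u < D.len u) (hv : p (D.item u (ptr u)) = l → mark (D.item u (ptr u)) = u + 1) :
    D.Scanning p vis mark (Function.update ptr u (ptr u + 1)) prv S u l where
  sparse h' := absurd h' hd
  dense _ i hi hp := by
    rw [Function.update_self] at hi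
    rcases (Nat.lt_succ_iff_lt_or_eq.1 hi) with hi | rfl
    · exact h.dense hd i hi hp
    · exact hv hp
  node := h.node
  passed := h.passed
  ptr_le := by rw [Function.update_self]; omega

/-- Marks set at other prices do not concern this scan; a mark set at price `l` has to be its own.
-/
theorem Scanning.mark_update (h : D.Scanning p vis mark ptr prv S u l) {x k : ℕ}
    (hx : p x = l → k = u + 1) :
    D.Scanning p vis (Function.update mark x k) ptr prv S u l where
  sparse := h.sparse
  dense hd i hi hp := by
    rw [Function.update_apply]
    split_ifs with hix
    · exact hx (hix ▸ hp)
    · exact h.dense hd i hi hp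
  node := h.node
  passed := h.passed
  ptr_le := h.ptr_le

/-- The scan loses nothing as long as the element at which it stands survives. -/
theorem Scanning.erase (h : D.Scanning p vis mark ptr prv S u l) {x : ℕ}
    (hx : p x = l → prv u ≠ x) : D.Scanning p vis mark ptr prv (S.erase x) u l where
  sparse := h.sparse
  dense := h.dense
  node := h.node.imp_right fun ⟨h1, h2⟩ =>
    ⟨Finset.mem_erase.2 ⟨fun e => hx (e ▸ h2) e, h1⟩, h2⟩
  passed c hc := h.passed c (Finset.mem_of_mem_erase hc)
  ptr_le := h.ptr_le

/-- No element of price `l` lies strictly between `x` and the old position, so moving on adds only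
the non-neighbour `x` to the passed elements. -/
theorem Scanning.skip (h : D.Scanning p vis mark ptr prv S u l)
    (hL : D.Lists p vis nxt mark S) (hl : l ≤ D.n) {x : ℕ} (hx : nxt (prv u) = x + 1)
    (hn : ¬ D.E u x) :
    D.Scanning p vis mark ptr (Function.update prv u x) S u l := by
  obtain ⟨h1, h2, h3, h4⟩ := hL.nxt_succ l hl _ h.node x hx
  refine ⟨h.sparse, h.dense, ?_, ?_, h.ptr_le⟩
  · rw [Function.update_self]
    exact .inr ⟨h1, h2⟩
  · intro c hc hcl hle
    rw [Function.update_self] at hle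
    by_cases hlt : c < prv u
    · have := h4 c hc hcl hlt
      obtain rfl : c = x := by omega
      exact hn
    · exact h.passed c hc hcl (by omega)

theorem Lists.mark_update (hL : D.Lists p vis nxt mark S) {x : ℕ} (h : ¬ D.E u x) :
    D.Lists p vis nxt (Function.update mark x (u + 1)) S where
  right := hL.right
  unvisited := hL.unvisited
  nxt_zero := hL.nxt_zero
  nxt_succ := hL.nxt_succ
  mark y v hv hy := by
    rw [Function.update_apply] at hy
    split_ifs at hy with hyx
    · obtain rfl : u = v := by omega
      exact hyx ▸ h
    · exact hL.mark y v hv hy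

theorem todo_advance (hlt : ptr u < D.len u) :
    D.todo (Function.update ptr u (ptr u + 1)) prv u < D.todo ptr prv u := by
  simp only [todo, Function.update_self]
  omega

/-- The skip is paid for by the list entry naming `x`: it is no longer below the position and leaves
the set counted by `todo`. -/
theorem todo_skip {x i : ℕ} (hi : i < D.len u) (hx : D.item u i = x) (hlt : x < prv u) :
    D.todo ptr (Function.update prv u x) u < D.todo ptr prv u := by
  simp only [todo, Function.update_self]
  refine Nat.add_lt_add_left (Finset.card_lt_card ?_) _
  refine Finset.ssubset_iff_of_subset (fun j hj => ?_) |>.2 ⟨i, ?_, ?_⟩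
  · simp only [Finset.mem_filter] at hj ⊢
    exact ⟨hj.1, hj.2.trans hlt⟩
  · simp only [Finset.mem_filter, Finset.mem_range]
    exact ⟨hi, hx ▸ hlt⟩
  · simp [hx]

end Net

/-- The effect of `scan`. -/
structure ScanPost (D : Net) (S : Finset ℕ) (s s' : State) (S' : Finset ℕ) : Prop where
  var : ∀ x, x ≠ 3 → x ≠ 4 → x ≠ 5 → x ≠ 13 → s'.var x = s.var x
  arr : ∀ a, a ≠ 8 → a ≠ 9 → a ≠ 12 → a ≠ 13 → s'.arr a = s.arr a
  lists : D.Lists (s.arr 10) (s.arr 11) (s'.arr 12) (s'.arr 13) S'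
  others : ∀ u l, u ≠ s.var 1 → l ≠ s.var 2 →
    D.Scanning (s.arr 10) (s.arr 11) (s.arr 13) (s.arr 8) (s.arr 9) S u l →
    D.Scanning (s.arr 10) (s.arr 11) (s'.arr 13) (s'.arr 8) (s'.arr 9) S' u l
  ptr : ∀ u, u ≠ s.var 1 → s'.arr 8 u = s.arr 8 u
  prv : ∀ u, u ≠ s.var 1 → s'.arr 9 u = s.arr 9 u
  outcome :
    s'.var 4 = 0 ∧ s'.var 5 = 0 ∧
      D.pot (s'.arr 8) (s'.arr 9) S' < D.pot (s.arr 8) (s.arr 9) S ∧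
      D.Scanning (s.arr 10) (s.arr 11) (s'.arr 13) (s'.arr 8) (s'.arr 9) S' (s.var 1)
        (s.var 2) ∨
    (∃ x, s'.var 4 = x + 1 ∧ D.E (s.var 1) x ∧ s.arr 10 x = s.var 2 ∧ s.arr 11 x = 0 ∧
      D.pot (s'.arr 8) (s'.arr 9) S' ≤ D.pot (s.arr 8) (s.arr 9) S ∧
      D.Scanning (s.arr 10) (Function.update (s.arr 11) x 1) (s'.arr 13) (s'.arr 8) (s'.arr 9)
        S' (s.var 1) (s.var 2)) ∨
    s'.var 4 = 0 ∧ s'.var 5 ≠ 0 ∧ D.pot (s'.arr 8) (s'.arr 9) S' ≤ D.pot (s.arr 8) (s.arr 9) S ∧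
      ∀ w, D.E (s.var 1) w → s.arr 10 w = s.var 2 → s.arr 11 w ≠ 0

/-- Apart from the pointers of the scanned vertex, a step changes only marks of vertices of the
current price and links and elements of the list of that price. This is why scans suspended at other
prices stay intact. -/
theorem scan_runs {D : Net} (hD : D.Valid) {N : ℕ} {s : State} {S : Finset ℕ} (hs : Bdd N s)
    (hN : D.n + 1 < N) (hst : D.Stored s) (hu : D.L (s.var 1)) (hl : s.var 2 ≤ D.n)
    (hL : D.Lists (s.arr 10) (s.arr 11) (s.arr 12) (s.arr 13) S)
    (hO : D.Scanning (s.arr 10) (s.arr 11) (s.arr 13) (s.arr 8) (s.arr 9) S (s.var 1)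
      (s.var 2)) :
    Runs N scan scan.time s fun s' => ∃ S', ScanPost D S s s' S' := by
  have hun := hu.1
  have hlen := hs.arr 6 (s.var 1)
  rw [hst.len] at hlen
  have hS : ∀ c ∈ S, c < D.n := fun c hc => (hL.right c hc).1
  refine Runs.of_wp hs (by decide) ?_
  simp [scan, wp, Expr.Small, Expr.val, Test.Holds, hst.adj, hst.ext, hst.base, hst.len,
    hst.dense]
  generalize hue : s.var 1 = u at *
  generalize hle : s.var 2 = l at *
  have advance : s.arr 8 u < D.len u →
      D.pot (Function.update (s.arr 8) u (s.arr 8 u + 1)) (s.arr 9) S <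
        D.pot (s.arr 8) (s.arr 9) S := fun hlt =>
    Net.pot_lt hun (fun v hv => Function.update_of_ne hv _ _) (fun _ _ => rfl)
      (Net.todo_advance hlt) le_rfl
  refine ⟨fun hlt => ⟨fun hd => ?_, fun hd => ?_⟩,
    fun hge => ⟨fun hd => ?_, fun hd => ⟨fun h0 => ?_, fun h0 => ?_⟩⟩⟩
  · have hx := hD.item_right hu hlt
    have hE : D.E u (D.item u (s.arr 8 u)) := (hD.sparse hu hd _).2 ⟨_, hlt, rfl⟩
    have hit : D.adj (D.base u + s.arr 8 u) = D.item u (s.arr 8 u) := by simp [Net.item, hd]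
    rw [hit]
    have hxn := hx.1
    refine ⟨by omega, fun hp hv => ⟨by omega, S, ?_⟩, fun hv => ⟨S, ?_⟩⟩
    · refine ⟨fun y h3 h4 h5 h13 => by simp [h3, h4, h5], fun a h8 h9 h12 h13 => by simp [h8],
        by simpa using hL, fun v k hv hk h => ?_, fun v hv => by simp [hue ▸ hv],
        fun v hv => by simp, .inr (.inl ⟨_, by simp, hue ▸ hE, by rw [hp, hle], hv, ?_, ?_⟩)⟩
      · simpa using h.congr (Function.update_of_ne (hue ▸ hv) _ _) rfl
      · simpa using (advance hlt).le
      · simpa [hue, hle] using (hO.visit _).advance_sparse hd hlt (by simp)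
    · refine ⟨fun y h3 h4 h5 h13 => by simp [h3, h4, h5], fun a h8 h9 h12 h13 => by simp [h8],
        by simpa using hL, fun v k hv hk h => ?_, fun v hv => by simp [hue ▸ hv],
        fun v hv => by simp, .inl ⟨by simp, by simp, ?_, ?_⟩⟩
      · simpa using h.congr (Function.update_of_ne (hue ▸ hv) _ _) rfl
      · simpa using advance hlt
      · simpa [hue, hle] using hO.advance_sparse hd hlt hv
  · have hx := hD.item_right hu hlt
    have hE := hD.dense_not hu hd _ hlt
    have hit : D.ext (D.base u + s.arr 8 u) = D.item u (s.arr 8 u) := by simp [Net.item, hd]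
    rw [hit]
    have hxn := hx.1
    refine ⟨by omega, fun hp => ⟨by omega, S, ?_⟩, fun hv => ⟨S, ?_⟩⟩
    · refine ⟨fun y h3 h4 h5 h13 => by simp [h3, h4, h5],
        fun a h8 h9 h12 h13 => by simp [h8, h13],
        by simpa using hL.mark_update hE, fun v k hv hk h => ?_,
        fun v hv => by simp [hue ▸ hv],
        fun v hv => by simp, .inl ⟨by simp, by simp, ?_, ?_⟩⟩
      · simpa using (h.mark_update fun h' => absurd (h'.symm.trans hp) (hle ▸ hk)).congr
          (Function.update_of_ne (hue ▸ hv) _ _) rfl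
      · simpa using advance hlt
      · simpa [hue, hle] using (hO.mark_update (x := D.item u (s.arr 8 u)) fun _ =>
          rfl).advance_dense hd hlt (by simp)
    · refine ⟨fun y h3 h4 h5 h13 => by simp [h3, h4, h5], fun a h8 h9 h12 h13 => by simp [h8],
        by simpa using hL, fun v k hv hk h => ?_, fun v hv => by simp [hue ▸ hv],
        fun v hv => by simp, .inl ⟨by simp, by simp, ?_, ?_⟩⟩
      · simpa using h.congr (Function.update_of_ne (hue ▸ hv) _ _) rfl
      · simpa using advance hlt
      · simpa [hue, hle] using hO.advance_dense hd hlt (fun h => absurd h hv)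
  · refine ⟨S, fun y h3 h4 h5 h13 => by simp [h4, h5], fun a h8 h9 h12 h13 => by simp,
      by simpa using hL, fun v k hv hk h => by simpa using h, fun v hv => by simp,
      fun v hv => by simp, .inr (.inr ⟨by simp, by simp, by simp, fun w hw hp => ?_⟩)⟩
    rw [hue] at hw
    obtain ⟨i, hi, rfl⟩ := (hD.sparse hu hd w).1 hw
    exact hO.sparse hd i (by omega) (hp.trans hle)
  · refine ⟨S, fun y h3 h4 h5 h13 => by simp [h4, h5, h13], fun a h8 h9 h12 h13 => by simp,
      by simpa using hL, fun v k hv hk h => by simpa using h, fun v hv => by simp,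
      fun v hv => by simp, .inr (.inr ⟨by simp, by simp, by simp, fun w hw hp hv => ?_⟩)⟩
    -- At the end of a decreasing list all elements of this price are at least the position, hence
    -- passed, hence non-neighbours.
    have hwS := hL.unvisited w (hD.right hw) hv
    have hpl := hp.trans hle
    exact hO.passed w hwS hpl (hL.nxt_zero l hl _ hO.node h0 w hwS hpl) (hue ▸ hw)
  · obtain ⟨x, hx⟩ : ∃ x, s.arr 12 (s.arr 9 u) = x + 1 := Nat.exists_eq_succ_of_ne_zero h0
    obtain ⟨hxS, hxl, hxa, -⟩ := hL.nxt_succ l hl _ hO.node x hx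
    have hxR := hL.right x hxS
    have hxn := hxR.1
    rw [hx, Nat.add_sub_cancel]
    refine ⟨by omega, fun hv => ⟨fun hm => ?_, fun hm => ⟨by omega, ?_⟩⟩, fun hv => ?_⟩
    -- A marked element is a non-neighbour, so it occurs in the list of `u` and that entry pays for
    -- skipping it.
    · have hE := hL.mark x u hu hm
      obtain ⟨i, hi, hix⟩ := hD.dense_cover hu hd x hxR hE
      refine ⟨S, fun y h3 h4 h5 h13 => by simp [h3, h4, h5, h13],
        fun a h8 h9 h12 h13 => by simp [h9], by simpa using hL, fun v k hv hk h => ?_,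
        fun v hv => by simp, fun v hv => by simp [hue ▸ hv],
        .inl ⟨by simp, by simp, ?_, ?_⟩⟩
      · simpa using h.congr rfl (Function.update_of_ne (hue ▸ hv) _ _)
      · simpa using Net.pot_lt hun (fun _ _ => rfl) (fun v hv => Function.update_of_ne hv _ _)
          (Net.todo_skip hi hix hxa) le_rfl
      · simpa [hue, hle] using hO.skip hL hl hx hE
    -- The list of `u` is used up, so all non-neighbours of price `l` are marked and an unmarked
    -- element is a neighbour.
    · have hE : D.E u x := by
        by_contra hE
        obtain ⟨i, hi, rfl⟩ := hD.dense_cover hu hd x hxR hE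
        exact hm (hO.dense hd i (by omega) hxl)
      refine ⟨S, fun y h3 h4 h5 h13 => by simp [h3, h4, h5, h13],
        fun a h8 h9 h12 h13 => by simp, by simpa using hL, fun v k hv hk h => by simpa using h,
        fun v hv => by simp, fun v hv => by simp,
        .inr (.inl ⟨x, by simp, hue ▸ hE, by rw [hxl, hle], hv, by simp, ?_⟩)⟩
      simpa [hue, hle] using hO.visit x
    · have he : D.pot (s.arr 8) (s.arr 9) (S.erase x) < D.pot (s.arr 8) (s.arr 9) S :=
        Nat.add_lt_add_left (Finset.card_erase_lt_of_mem hxS) _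
      refine ⟨S.erase x, fun y h3 h4 h5 h13 => by simp [h3, h4, h5, h13],
        fun a h8 h9 h12 h13 => by simp [h12], ?_, fun v k hv' hk h => ?_,
        fun v hv => by simp, fun v hv => by simp,
        .inl ⟨by simp, by simp, by simpa using he, ?_⟩⟩
      · simpa using hL.remove hl hO.node hx hv
      · simpa using h.erase fun h' => absurd (h'.symm.trans hxl) (hle ▸ hk)
      · simpa [hue, hle] using hO.erase (x := x) fun _ => by omega

end BipartiteMatching

/-! ### Matchings with one exempt vertex, and the search path of a phase -/

namespace BipartiteMatching

open WordRAM

namespace Net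

variable {D : Net} {m p vis nxt mark ptr prv ptr' prv' stk : ℕ → ℕ} {S : Finset ℕ}
  {e e' u l r t t' x : ℕ}

variable (D) in
/-- `m` gives the successor of the partner of each vertex in a matching; the entry of the left
vertex `e` is ignored, and `e` counts as unmatched. -/
structure Matched (m : ℕ → ℕ) (e : ℕ) : Prop where
  left : ∀ {u w}, D.L u → u ≠ e → m u = w + 1 → D.E u w ∧ m w = u + 1
  right : ∀ {u w}, D.R w → m w = u + 1 → u ≠ e ∧ D.E u w ∧ m u = w + 1

/-- The matching in which `u` and `x` become partners. -/
def join (m : ℕ → ℕ) (u x : ℕ) : ℕ → ℕ :=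
  Function.update (Function.update m x (u + 1)) u (x + 1)

theorem join_self : join m u x u = x + 1 := by simp [join]

theorem join_right (h : u ≠ x) : join m u x x = u + 1 := by simp [join, h.symm]

theorem join_of_ne {v : ℕ} (h : v ≠ u) (h' : v ≠ x) : join m u x v = m v := by
  simp [join, h, h']

/-- The vertex `e` takes `x` from its partner. -/
theorem Matched.join (hD : D.Valid) (h : D.Matched m e) (hE : D.E e x)
    (he' : m x = 0 ∧ ¬ D.L e' ∨ m x = e' + 1) : D.Matched (join m e x) e' := by
  have he := hD.left hE
  have hx := hD.right hE
  have hex := he.ne_R hx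
  constructor
  · intro u w hu hue' hm
    by_cases hue : u = e
    · subst hue
      rw [join_self] at hm
      obtain rfl : x = w := by omega
      exact ⟨hE, join_right hex⟩
    · rw [join_of_ne hue (hu.ne_R hx)] at hm
      obtain ⟨h1, h2⟩ := h.left hu hue hm
      have hw := hD.right h1
      have hwx : w ≠ x := by
        rintro rfl
        rcases he' with he' | he' <;> omega
      exact ⟨h1, by rw [join_of_ne (he.ne_R hw).symm hwx, h2]⟩
  · intro u w hw hm
    by_cases hwx : w = x
    · subst hwx
      rw [join_right hex] at hm
      obtain rfl : e = u := by omega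
      refine ⟨?_, hE, join_self⟩
      rintro rfl
      rcases he' with he' | he'
      · exact he'.2 he
      · exact (h.right hx he').1 rfl
    · rw [join_of_ne (he.ne_R hw).symm hwx] at hm
      obtain ⟨h1, h2, h3⟩ := h.right hw hm
      have hu := hD.left h2
      refine ⟨?_, h2, by rw [join_of_ne h1 (hu.ne_R hx), h3]⟩
      rintro rfl
      rcases he' with he' | he'
      · exact he'.2 hu
      · have := (h.right hx he').2.2
        omega

variable (D) in
/-- Between two searches of the phase `r`: `p` are the prices at its beginning, `vis` tells which
right vertices have been visited, `e` is unmatched, and the roots below `t` have been treated. -/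
structure Core (m p vis ptr prv : ℕ → ℕ) (r e t : ℕ) : Prop where
  matched : D.Matched m e
  free_right : ∀ w, D.R w → m w = 0 → p w = 0 ∧ vis w = 0
  matched_right : ∀ w, D.R w → m w ≠ 0 → vis w = 0 → 1 ≤ p w
  vis_le : ∀ w, vis w ≤ 1
  price_le : ∀ w, D.R w → p w ≤ r
  tight : ∀ u x, D.L u → u ≠ e → m u = x + 1 → ∀ w, D.E u w → p x + vis x ≤ p w + vis w + 1
  tight_start : ∀ u x, D.L u → u ≠ e → m u = x + 1 → vis x = 0 → ∀ w, D.E u w → p x ≤ p w + 1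
  free : ∀ u, D.L u → u ≠ e → m u = 0 → ∀ w, D.E u w → r ≤ p w
  failed : ∀ u, D.L u → u ≠ e → m u = 0 → u < t → ∀ w, D.E u w → r + 1 ≤ p w + vis w
  fresh_root : ∀ u, D.L u → u ≠ e → m u = 0 → t ≤ u → ptr u = 0 ∧ D.n ≤ prv u
  fresh_mate : ∀ w u, D.R w → vis w = 0 → m w = u + 1 → ptr u = 0 ∧ D.n ≤ prv u

theorem Core.congr (h : D.Core m p vis ptr prv r e t) (h1 : ∀ u, u ≠ e → ptr' u = ptr u)
    (h2 : ∀ u, u ≠ e → prv' u = prv u) : D.Core m p vis ptr' prv' r e t :=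
  { h with
    fresh_root := fun u hu hue => by rw [h1 u hue, h2 u hue]; exact h.fresh_root u hu hue
    fresh_mate := fun w u hw hv hm => by
      have hue := (h.matched.right hw hm).1
      rw [h1 u hue, h2 u hue]
      exact h.fresh_mate w u hw hv hm }

/-- Visiting more vertices only raises the right-hand sides of the inequalities for the old pairs;
the new pair is covered by `ht`. The lemma serves augmenting, descending and also backtracking,
where `x` has been visited before. -/
theorem Core.join (hD : D.Valid) (h : D.Core m p vis ptr prv r e t) (hE : D.E e x)
    (he' : m x = 0 ∧ ¬ D.L e' ∨ m x = e' + 1)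
    (ht : ∀ w, D.E e w → p x ≤ p w + vis w) :
    D.Core (join m e x) p (Function.update vis x 1) ptr prv r e' t := by
  have he := hD.left hE
  have hx := hD.right hE
  have hex := he.ne_R hx
  have hle : ∀ w, vis w ≤ Function.update vis x 1 w := fun w => by
    rw [Function.update_apply]
    split_ifs with hw
    · exact h.vis_le w
    · exact le_rfl
  have heq : ∀ w, Function.update vis x 1 w = 0 → w ≠ x ∧ vis w = 0 := fun w hw => by
    have := hle w
    refine ⟨?_, by omega⟩
    rintro rfl
    simp at hw
  have hL : ∀ u, D.L u → u ≠ e → Net.join m e x u = m u := fun u hu hue =>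
    join_of_ne hue (hu.ne_R hx)
  have hLx : ∀ u y, D.L u → u ≠ e → u ≠ e' → m u = y + 1 → y ≠ x := by
    rintro u y hu hue hue' hm rfl
    have := (h.matched.left hu hue hm).2
    omega
  have hR : ∀ w, D.R w → w ≠ x → Net.join m e x w = m w := fun w hw hwx =>
    join_of_ne (he.ne_R hw).symm hwx
  have hl0 : ∀ u, D.L u → Net.join m e x u = 0 → u ≠ e ∧ m u = 0 := fun u hu h0 => by
    by_cases hue : u = e
    · rw [hue, join_self] at h0
      omega
    · rw [hL u hu hue] at h0
      exact ⟨hue, h0⟩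
  refine ⟨h.matched.join hD hE he', ?_, ?_, ?_, h.price_le, ?_, ?_, ?_, ?_, ?_, ?_⟩
  · intro w hw h0
    by_cases hwx : w = x
    · rw [hwx, join_right hex] at h0
      omega
    · rw [hR w hw hwx] at h0
      rw [Function.update_of_ne hwx]
      exact h.free_right w hw h0
  · intro w hw hm hv
    obtain ⟨hwx, hv⟩ := heq w hv
    rw [hR w hw hwx] at hm
    exact h.matched_right w hw hm hv
  · intro w
    rw [Function.update_apply]
    split_ifs
    · exact le_rfl
    · exact h.vis_le w
  · intro u y hu hue' hm w hw
    have hlew := hle w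
    by_cases hue : u = e
    · subst hue
      rw [join_self] at hm
      obtain rfl : x = y := by omega
      have := ht w hw
      rw [Function.update_self]
      omega
    · rw [hL u hu hue] at hm
      rw [Function.update_of_ne (hLx u y hu hue hue' hm)]
      have := h.tight u y hu hue hm w hw
      omega
  · intro u y hu _ hm hv w hw
    obtain ⟨hyx, hv⟩ := heq y hv
    by_cases hue : u = e
    · subst hue
      rw [join_self] at hm
      omega
    · rw [hL u hu hue] at hm
      exact h.tight_start u y hu hue hm hv w hw
  · intro u hu _ hm
    obtain ⟨h1, h2⟩ := hl0 u hu hm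
    exact h.free u hu h1 h2
  · intro u hu _ hm hut w hw
    obtain ⟨h1, h2⟩ := hl0 u hu hm
    have := h.failed u hu h1 h2 hut w hw
    have := hle w
    omega
  · intro u hu _ hm
    obtain ⟨h1, h2⟩ := hl0 u hu hm
    exact h.fresh_root u hu h1 h2
  · intro w u hw hv hm
    obtain ⟨hwx, hv⟩ := heq w hv
    rw [hR w hw hwx] at hm
    exact h.fresh_mate w u hw hv hm

/-- The root `e` remains unmatched. -/
theorem Core.fail (hD : D.Valid) (h : D.Core m p vis ptr prv r e t) (he : D.L e) (het : e < t)
    (hp : ∀ w, D.E e w → r + 1 ≤ p w + vis w) (hp' : ∀ w, D.E e w → r ≤ p w) (he' : ¬ D.L e') :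
    D.Core (Function.update m e 0) p vis ptr prv r e' t := by
  have hR : ∀ w, D.R w → Function.update m e 0 w = m w := fun w hw =>
    Function.update_of_ne (he.ne_R hw).symm _ _
  have hL : ∀ u, u ≠ e → Function.update m e 0 u = m u := fun u hu =>
    Function.update_of_ne hu _ _
  have hsucc : ∀ u y, Function.update m e 0 u = y + 1 → u ≠ e ∧ m u = y + 1 := fun u y hm => by
    have hue : u ≠ e := by
      rintro rfl
      simp at hm
    rw [hL u hue] at hm
    exact ⟨hue, hm⟩
  refine ⟨⟨?_, ?_⟩, ?_, ?_, h.vis_le, h.price_le, ?_, ?_, ?_, ?_, ?_, ?_⟩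
  · intro u w hu _ hm
    obtain ⟨hue, hm⟩ := hsucc u w hm
    obtain ⟨h1, h2⟩ := h.matched.left hu hue hm
    exact ⟨h1, by rw [hR w (hD.right h1), h2]⟩
  · intro u w hw hm
    rw [hR w hw] at hm
    obtain ⟨h1, h2, h3⟩ := h.matched.right hw hm
    exact ⟨fun hu => he' (hu ▸ hD.left h2), h2, by rw [hL u h1, h3]⟩
  · intro w hw hm
    exact h.free_right w hw (by rwa [hR w hw] at hm)
  · intro w hw hm
    exact h.matched_right w hw (by rwa [hR w hw] at hm)
  · intro u y hu _ hm
    obtain ⟨hue, hm⟩ := hsucc u y hm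
    exact h.tight u y hu hue hm
  · intro u y hu _ hm
    obtain ⟨hue, hm⟩ := hsucc u y hm
    exact h.tight_start u y hu hue hm
  · intro u hu _ hm
    by_cases hue : u = e
    · exact hue ▸ hp'
    · exact h.free u hu hue (by rwa [hL u hue] at hm)
  · intro u hu _ hm hut
    by_cases hue : u = e
    · exact hue ▸ hp
    · exact h.failed u hu hue (by rwa [hL u hue] at hm) hut
  · intro u hu _ hm hut
    have hue : u ≠ e := by omega
    exact h.fresh_root u hu hue (by rwa [hL u hue] at hm) hut
  · intro w u hw hv hm
    exact h.fresh_mate w u hw hv (by rwa [hR w hw] at hm)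

/-- The unmatched vertex `t` becomes a root. -/
theorem Core.open (h : D.Core m p vis ptr prv r e t) (he : ¬ D.L e)
    (hm : m t = 0) : D.Core m p vis ptr prv r t (t + 1) := by
  have hne : ∀ u, D.L u → u ≠ e := fun u hu hue => he (hue ▸ hu)
  refine ⟨⟨fun hu _ => h.matched.left hu (hne _ hu), ?_⟩, h.free_right, h.matched_right, h.vis_le,
    h.price_le, fun u y hu _ => h.tight u y hu (hne u hu),
    fun u y hu _ => h.tight_start u y hu (hne u hu), fun u hu _ => h.free u hu (hne u hu),
    fun u hu hut hm' hlt => h.failed u hu (hne u hu) hm' (by omega),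
    fun u hu _ hm' hlt => h.fresh_root u hu (hne u hu) hm' (by omega), h.fresh_mate⟩
  intro u w hw hm'
  obtain ⟨-, h2, h3⟩ := h.matched.right hw hm'
  refine ⟨?_, h2, h3⟩
  rintro rfl
  omega

theorem Core.skip (h : D.Core m p vis ptr prv r e t) (ht : ¬ (D.L t ∧ m t = 0)) :
    D.Core m p vis ptr prv r e (t + 1) :=
  { h with
    failed := fun u hu hue hm hut => h.failed u hu hue hm (by
      have : u ≠ t := fun hu' => ht (hu' ▸ ⟨hu, hm⟩)
      omega)
    fresh_root := fun u hu hue hm hut => h.fresh_root u hu hue hm (by omega) }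

variable (D) in
/-- The search path: `stk k` is the vertex on the level `k`, and `stk l` is the current one. -/
structure Stack (m p vis mark ptr prv stk : ℕ → ℕ) (S : Finset ℕ) (r l t : ℕ) : Prop where
  le : l ≤ r
  left : ∀ k, l ≤ k → k ≤ r → D.L (stk k)
  scanning : ∀ k, l < k → k ≤ r → D.Scanning p vis mark ptr prv S (stk k) k
  price : ∀ k, l ≤ k → k ≤ r → ∀ w, D.E (stk k) w → k ≤ p w
  root : stk r = t
  link : ∀ k, l < k → k ≤ r → ∃ x, m (stk k) = x + 1 ∧ m x = stk k + 1 ∧ vis x ≠ 0 ∧ p x = k ∧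
    D.E (stk k) x ∧ D.E (stk (k - 1)) x

/-- The vertices on higher levels have partners, whereas the current one counts as unmatched. -/
theorem Stack.ne (hD : D.Valid) (h : D.Stack m p vis mark ptr prv stk S r l t)
    (hm : D.Matched m (stk l)) {k : ℕ} (h1 : l < k) (h2 : k ≤ r) : stk k ≠ stk l := by
  obtain ⟨x, -, h3, -, -, h4, -⟩ := h.link k h1 h2
  exact (hm.right (hD.right h4) h3).1

/-- The current vertex takes `x` from `u`, which becomes the current vertex. -/
theorem Stack.push (hD : D.Valid) (h : D.Stack m p vis mark ptr prv stk S r (l + 1) t)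
    (hc : D.Core m p vis ptr prv r (stk (l + 1)) t')
    (hE : D.E (stk (l + 1)) x) (hx : m x = u + 1) (hp : p x = l + 1) (hv : vis x = 0)
    (hs : D.Scanning p (Function.update vis x 1) mark ptr prv S (stk (l + 1)) (l + 1)) :
    D.Stack (join m (stk (l + 1)) x) p (Function.update vis x 1) mark ptr
      (Function.update prv u (D.n + l)) (Function.update stk l u) S r l t := by
  have hxR := hD.right hE
  have he := hD.left hE
  obtain ⟨hue, hux, hmu⟩ := hc.matched.right hxR hx
  have hu := hD.left hux
  have hle := h.le
  have hstk : ∀ k, l + 1 ≤ k → Function.update stk l u k = stk k := fun k hk =>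
    Function.update_of_ne (by omega) _ _
  -- The vertex on level `l + 1` is the unmatched one. On a level `k` above it the partner has price
  -- `k`, whereas the partner `x` of `u` has price `l + 1`.
  have hne : ∀ k, l + 1 ≤ k → k ≤ r → stk k ≠ u := fun k h1 h2 hk => by
    rcases Nat.eq_or_lt_of_le h1 with rfl | h1
    · exact hue hk.symm
    · obtain ⟨y, h3, -, -, h4, -⟩ := h.link k h1 h2
      rw [hk, hmu] at h3
      obtain rfl : x = y := by omega
      omega
  refine ⟨by omega, ?_, ?_, ?_, ?_, ?_⟩
  · intro k h1 h2
    rcases Nat.eq_or_lt_of_le h1 with rfl | h1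
    · rw [Function.update_self]
      exact hu
    · rw [hstk k h1]
      exact h.left k h1 h2
  · intro k h1 h2
    rw [hstk k h1]
    refine Scanning.congr (ptr := ptr) (prv := prv) ?_ rfl
      (Function.update_of_ne (hne k h1 h2) _ _)
    rcases Nat.eq_or_lt_of_le (Nat.succ_le_of_lt h1) with h1' | h1'
    · exact h1' ▸ hs
    · exact (h.scanning k h1' h2).visit x
  · intro k h1 h2 w hw
    rcases Nat.eq_or_lt_of_le h1 with rfl | h1
    · rw [Function.update_self] at hw
      -- Since `p x = l + 1`, tightness puts all neighbours of `u` at price `l` or more; so the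
      -- search goes down by exactly one level.
      have := hc.tight_start u x hu hue hmu hv w hw
      omega
    · rw [hstk k h1] at hw
      exact h.price k h1 h2 w hw
  · rw [hstk r hle, h.root]
  · intro k h1 h2
    rw [hstk k h1]
    rcases Nat.eq_or_lt_of_le (Nat.succ_le_of_lt h1) with hk | h1'
    · obtain rfl : l + 1 = k := hk
      refine ⟨x, join_self, join_right (he.ne_R hxR), by simp, hp, hE, ?_⟩
      simpa using hux
    · obtain ⟨y, h3, h4, h5, h6, h7, h8⟩ := h.link k h1' h2
      have hyR := hD.right h7
      have hyx : y ≠ x := by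
        rintro rfl
        omega
      refine ⟨y, ?_, ?_, ?_, h6, h7, ?_⟩
      · rw [join_of_ne (h.ne hD hc.matched h1' h2) ((hD.left h7).ne_R hxR), h3]
      · rw [join_of_ne (he.ne_R hyR).symm hyx, h4]
      · rwa [Function.update_of_ne hyx]
      · rwa [hstk (k - 1) (by omega)]

/-- The current vertex gets back the vertex that was taken from it. -/
theorem Stack.pop (hD : D.Valid) (h : D.Stack m p vis mark ptr prv stk S r l t) (hl : l < r)
    (hm : D.Matched m (stk l)) (hx : m (stk (l + 1)) = x + 1) :
    D.Stack (join m (stk l) x) p vis mark ptr prv stk S r (l + 1) t := by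
  obtain ⟨y, h1, h2, h3, h4, h5, h6⟩ := h.link (l + 1) (by omega) hl
  obtain rfl : x = y := by omega
  refine ⟨hl, fun k hk => h.left k (by omega), fun k hk => h.scanning k (by omega),
    fun k hk => h.price k (by omega), h.root, fun k hk1 hk2 => ?_⟩
  obtain ⟨y, g1, g2, g3, g4, g5, g6⟩ := h.link k (by omega) hk2
  have hyx : y ≠ x := by
    rintro rfl
    omega
  have he := h.left l le_rfl h.le
  refine ⟨y, ?_, ?_, g3, g4, g5, g6⟩
  · rw [join_of_ne (h.ne hD hm (by omega) hk2) ((hD.left g5).ne_R (hD.right h5)), g1]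
  · rw [join_of_ne (he.ne_R (hD.right g5)).symm hyx, g2]

end Net
end BipartiteMatching

/-! ### The depth-first search of a phase -/

namespace BipartiteMatching

open WordRAM

namespace Net

variable {D : Net} {m p vis nxt mark ptr prv ptr' prv' stk : ℕ → ℕ} {S : Finset ℕ}
  {e e' u l r t t' x : ℕ}

variable (D) in
/-- The number of vertices that have not been visited. -/
def unvisited (vis : ℕ → ℕ) : ℕ := ((Finset.range D.n).filter fun w => vis w = 0).card

theorem unvisited_visit (hx : x < D.n) (hv : vis x = 0) :
    D.unvisited (Function.update vis x 1) < D.unvisited vis := by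
  refine Finset.card_lt_card (Finset.ssubset_iff_of_subset (fun w hw => ?_) |>.2 ⟨x, ?_, ?_⟩)
  · simp only [Finset.mem_filter, Function.update_apply] at hw ⊢
    refine ⟨hw.1, ?_⟩
    have := hw.2
    split_ifs at this
    exact this
  · simp [hx, hv]
  · simp

/-- A position that is at least `D.n` already exceeds every list entry, so moving it to a head
cannot raise the potential. -/
theorem pot_start (hD : D.Valid) (hu : D.L u) (h : D.n ≤ prv u) :
    D.pot ptr (Function.update prv u (D.n + l)) S ≤ D.pot ptr prv S := by
  refine pot_le fun v _ => Nat.add_le_add_left (Finset.card_le_card fun i hi => ?_) _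
  simp only [Finset.mem_filter, Finset.mem_range] at hi ⊢
  refine ⟨hi.1, ?_⟩
  by_cases hv : v = u
  · subst hv
    exact (hD.item_right hu hi.1).1.trans_le h
  · simpa [hv] using hi.2

end Net

/-- One step of the search for disjoint augmenting paths. -/
def afterScan : Cmd :=
  .ite (.not (.eq (.var 4) (.lit 0)))
    (.assign 3 (.sub (.var 4) (.lit 1)) ;; .put 11 (.var 3) (.lit 1) ;;
      .assign 13 (.get 3 (.var 3)) ;; .put 3 (.var 3) (.add (.var 1) (.lit 1)) ;;
      .put 3 (.var 1) (.add (.var 3) (.lit 1)) ;;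
      .ite (.eq (.var 13) (.lit 0))
        (.assign 7 (.lit 0) ;; .assign 8 (.add (.var 8) (.lit 1)))
        (.assign 2 (.sub (.var 2) (.lit 1)) ;; .assign 1 (.sub (.var 13) (.lit 1)) ;;
          .put 14 (.var 2) (.var 1) ;; .put 9 (.var 1) (.add (.var 0) (.var 2))))
    (.ite (.eq (.var 5) (.lit 0)) .skip
      (.ite (.eq (.var 2) (.var 6))
        (.put 3 (.var 1) (.lit 0) ;; .assign 7 (.lit 0) ;; .assign 8 (.add (.var 8) (.lit 1)))
        (.assign 13 (.var 1) ;; .assign 2 (.add (.var 2) (.lit 1)) ;;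
          .assign 1 (.get 14 (.var 2)) ;; .assign 3 (.sub (.get 3 (.var 1)) (.lit 1)) ;;
          .put 3 (.var 3) (.add (.var 13) (.lit 1)) ;;
          .put 3 (.var 13) (.add (.var 3) (.lit 1)))))

/-- Make the vertex `var 8` a root if it is unmatched, and turn to the next one otherwise. -/
def nextRoot : Cmd :=
  .ite (.and (.eq (.get 0 (.var 8)) (.lit 0)) (.eq (.get 3 (.var 8)) (.lit 0)))
    (.assign 7 (.lit 1) ;; .assign 2 (.var 6) ;; .assign 1 (.var 8) ;;
      .put 14 (.var 2) (.var 1) ;; .put 9 (.var 1) (.add (.var 0) (.var 2)))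
    (.assign 8 (.add (.var 8) (.lit 1)))

/-- Search for disjoint augmenting paths from all unmatched left vertices. -/
def searchPaths : Cmd :=
  .loop (.lt (.var 8) (.var 0)) (.ite (.eq (.var 7) (.lit 0)) nextRoot (scan ;; afterScan))

/-- The invariant of `searchPaths`, with a bound `k` for the number of steps left. -/
structure Phase (D : Net) (r q : ℕ) (S : Finset ℕ) (k : ℕ) (s : State) : Prop where
  stored : D.Stored s
  phase : s.var 6 = r
  square : s.var 16 = q
  le : r ≤ D.n
  lists : D.Lists (s.arr 10) (s.arr 11) (s.arr 12) (s.arr 13) S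
  mode :
    (s.var 7 = 0 ∧ s.var 8 ≤ D.n ∧
      D.Core (s.arr 3) (s.arr 10) (s.arr 11) (s.arr 8) (s.arr 9) r D.n (s.var 8) ∧
      D.pot (s.arr 8) (s.arr 9) S + 2 * D.unvisited (s.arr 11) + 2 * (D.n - s.var 8) ≤ k) ∨
    (s.var 7 = 1 ∧ s.var 8 < D.n ∧
      D.Core (s.arr 3) (s.arr 10) (s.arr 11) (s.arr 8) (s.arr 9) r (s.var 1) (s.var 8 + 1) ∧
      s.arr 14 (s.var 2) = s.var 1 ∧
      D.Stack (s.arr 3) (s.arr 10) (s.arr 11) (s.arr 13) (s.arr 8) (s.arr 9) (s.arr 14) S r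
        (s.var 2) (s.var 8) ∧
      D.Scanning (s.arr 10) (s.arr 11) (s.arr 13) (s.arr 8) (s.arr 9) S (s.var 1) (s.var 2) ∧
      D.pot (s.arr 8) (s.arr 9) S + 2 * D.unvisited (s.arr 11) + (r - s.var 2) +
        2 * (D.n - s.var 8) ≤ k + 1)

/-- Lets `D.n` play the exempt vertex when no vertex is exempt. -/
theorem not_L_n {D : Net} : ¬ D.L D.n := fun h => lt_irrefl _ h.1

theorem nextRoot_runs {D : Net} (hD : D.Valid) {N r q k : ℕ} {s : State} {S : Finset ℕ}
    (hs : Bdd N s) (hN : 2 * D.n + 2 < N) (h : Phase D r q S k s) (h7 : s.var 7 = 0)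
    (h8 : s.var 8 < D.n) :
    Runs N nextRoot nextRoot.time s fun s' => ∃ k', (∃ S, Phase D r q S k' s') ∧ k' < k := by
  obtain ⟨-, -, hc, hk⟩ := h.mode.resolve_right fun h' => by omega
  have hle := h.le
  have hS : ∀ c ∈ S, c < D.n := fun c hc => (h.lists.right c hc).1
  refine Runs.of_wp hs (by decide) ?_
  simp only [nextRoot, wp, Expr.Small, Expr.val, Test.Holds, h.stored.side, h.stored.n, h.phase,
    State.setVar_var, State.setArr_var]
  simp
  refine ⟨fun h1 h2 => ?_, fun h1 => ?_⟩
  · have hL : D.L (s.var 8) := ⟨h8, h1⟩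
    obtain ⟨hf1, hf2⟩ := hc.fresh_root _ hL h8.ne h2 le_rfl
    refine ⟨by omega, k - 1, ⟨S, ?_⟩, by omega⟩
    have hpot := Net.pot_start (ptr := s.arr 8) (S := S) (l := r) hD hL hf2
    refine ⟨⟨?_, ?_, ?_, ?_, ?_, ?_, ?_⟩, ?_, ?_, h.le, ?_, .inr ⟨?_, ?_, ?_, ?_, ?_, ?_, ?_⟩⟩ <;>
      simp [h.stored.n, h.stored.side, h.stored.adj, h.stored.ext, h.stored.base, h.stored.len,
        h.stored.dense, h.phase, h.square, h8]
    · exact h.lists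
    · exact (hc.open not_L_n h2).congr (fun _ _ => rfl) fun u hu => Function.update_of_ne hu _ _
    · refine ⟨le_rfl, ?_, ?_, ?_, ?_, ?_⟩
      · intro k h1 h2
        obtain rfl : r = k := by omega
        simpa using hL
      · intro k h1 h2
        omega
      · intro k h1 h3
        obtain rfl : r = k := by omega
        simpa using hc.free _ hL h8.ne h2
      · simp
      · intro k h1 h2
        omega
    · exact Net.Scanning.start hS hf1 (by simp)
    · omega
  · refine ⟨by omega, k - 1, ⟨S, ?_⟩, by omega⟩
    refine ⟨⟨?_, ?_, ?_, ?_, ?_, ?_, ?_⟩, ?_, ?_, h.le, ?_, .inl ⟨?_, ?_, ?_, ?_⟩⟩ <;>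
      simp [h.stored.n, h.stored.side, h.stored.adj, h.stored.ext, h.stored.base, h.stored.len,
        h.stored.dense, h.phase, h.square, h7]
    · exact h.lists
    · omega
    · exact hc.skip fun h' => h1 h'.1.2 h'.2
    · omega

/-- In the budget an unvisited vertex weighs two units: one pays for the step that visits it, the
other for the level by which `r - l` grows, which is regained on backtracking. A treated root also
frees two units, one for the closing step and one for the step that opened it. -/
theorem step_runs {D : Net} (hD : D.Valid) {N r q k : ℕ} {s : State} {S : Finset ℕ}
    (hs : Bdd N s) (hN : 2 * D.n + 2 < N) (h : Phase D r q S k s) (h7 : s.var 7 ≠ 0) :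
    Runs N (scan ;; afterScan) (scan.time + afterScan.time) s
      fun s' => ∃ k', (∃ S, Phase D r q S k' s') ∧ k' < k := by
  obtain ⟨h7, h8, hc, hstk, hst, hscan, hk⟩ := h.mode.resolve_left fun h' => h7 h'.1
  have hle := h.le
  have hlr := hst.le
  have hcur : D.L (s.var 1) := hstk ▸ hst.left _ le_rfl hlr
  have hcn := hcur.1
  refine (scan_runs hD hs (by omega) h.stored hcur (by omega) h.lists hscan).seq ?_
  rintro s' hs' ⟨S', hp⟩
  have a0 : s'.arr 0 = D.side := (hp.arr 0 (by decide) (by decide) (by decide) (by decide)).trans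
    h.stored.side
  have a2 : s'.arr 2 = D.adj := (hp.arr 2 (by decide) (by decide) (by decide) (by decide)).trans
    h.stored.adj
  have a4 : s'.arr 4 = D.ext := (hp.arr 4 (by decide) (by decide) (by decide) (by decide)).trans
    h.stored.ext
  have a5 : s'.arr 5 = D.base := (hp.arr 5 (by decide) (by decide) (by decide) (by decide)).trans
    h.stored.base
  have a6 : s'.arr 6 = D.len := (hp.arr 6 (by decide) (by decide) (by decide) (by decide)).trans
    h.stored.len
  have a7 : s'.arr 7 = D.dense := (hp.arr 7 (by decide) (by decide) (by decide)
    (by decide)).trans h.stored.dense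
  have a3 := hp.arr 3 (by decide) (by decide) (by decide) (by decide)
  have a10 := hp.arr 10 (by decide) (by decide) (by decide) (by decide)
  have a11 := hp.arr 11 (by decide) (by decide) (by decide) (by decide)
  have a14 := hp.arr 14 (by decide) (by decide) (by decide) (by decide)
  have v0 := (hp.var 0 (by decide) (by decide) (by decide) (by decide)).trans h.stored.n
  have v1 := hp.var 1 (by decide) (by decide) (by decide) (by decide)
  have v2 := hp.var 2 (by decide) (by decide) (by decide) (by decide)
  have v6 := (hp.var 6 (by decide) (by decide) (by decide) (by decide)).trans h.phase
  have v7 := (hp.var 7 (by decide) (by decide) (by decide) (by decide)).trans h7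
  have v8 := hp.var 8 (by decide) (by decide) (by decide) (by decide)
  have v16 := (hp.var 16 (by decide) (by decide) (by decide) (by decide)).trans h.square
  have hS' : ∀ c ∈ S', c < D.n := fun c hc => (hp.lists.right c hc).1
  have hout := hp.outcome
  generalize hcu : s.var 1 = c at *
  generalize hll : s.var 2 = l at *
  generalize htt : s.var 8 = t at *
  have hc' : D.Core (s.arr 3) (s.arr 10) (s.arr 11) (s'.arr 8) (s'.arr 9) r c (t + 1) :=
    hc.congr (hcu ▸ hp.ptr) (hcu ▸ hp.prv)
  have hst' : D.Stack (s.arr 3) (s.arr 10) (s.arr 11) (s'.arr 13) (s'.arr 8) (s'.arr 9)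
      (s.arr 14) S' r l t := by
    refine ⟨hst.le, hst.left, fun k h1 h2 => ?_, hst.price, hst.root, hst.link⟩
    have hne := hst.ne hD (hstk.symm ▸ hc.matched) h1 h2
    exact hp.others _ _ (by rw [hcu, ← hstk]; exact hne) (by rw [hll]; exact h1.ne')
      (hst.scanning k h1 h2)
  refine Runs.of_wp hs' (by decide) ?_
  rcases hout with ⟨c4, c5, hpot, hsc⟩ | ⟨x, c4, hE, hpx, hvx, hpot, hsc⟩ | ⟨c4, c5, hpot, hex⟩
  · simp [afterScan, wp, Test.Holds, Expr.val, c4, c5]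
    exact ⟨k - 1, ⟨S', ⟨⟨v0, a0, a2, a4, a5, a6, a7⟩, v6, v16, h.le, by rw [a10, a11]; exact hp.lists,
      .inr ⟨v7, by omega, by rw [a3, a10, a11, v1, v8]; exact hc', by rw [a14, v2, v1, hstk],
        by rw [a3, a10, a11, a14, v2, v8]; exact hst',
        by rw [a10, a11, v1, v2]; exact hsc, by rw [a11, v2, v8]; omega⟩⟩⟩, by omega⟩
  · have hxR := hD.right hE
    have hcx := hcur.ne_R hxR
    have hxn := hxR.1
    have hunv := Net.unvisited_visit hxn hvx
    -- The level bounds the prices of the neighbours from below, so `x` is a cheapest one.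
    have htight : ∀ w, D.E c w → s.arr 10 x ≤ s.arr 10 w + s.arr 11 w := fun w hw => by
      have := hst.price l le_rfl hlr w (hstk.symm ▸ hw)
      omega
    simp [afterScan, wp, Expr.Small, Expr.val, Test.Holds, a3, v0, v1, v2, v8, c4]
    refine ⟨by omega, by omega, by omega, fun hm => ⟨by omega, k - 1, ⟨S', ?_⟩, by omega⟩,
      fun hm => ⟨by omega, by have := hs'.arr 3 x; rw [a3] at this; omega, by omega, k - 1,
        ⟨S', ?_⟩, by omega⟩⟩
    · have hj := hc'.join (e' := D.n) hD hE (.inl ⟨hm, not_L_n⟩) htight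
      refine ⟨⟨?_, ?_, ?_, ?_, ?_, ?_, ?_⟩, ?_, ?_, h.le, ?_, .inl ⟨?_, ?_, ?_, ?_⟩⟩ <;>
        simp [v0, a0, a2, a4, a5, a6, a7, v6, v16, a10, a11, a3]
      · exact hp.lists.visit x
      · exact h8
      · exact hj
      · omega
    · obtain ⟨u, hu⟩ := Nat.exists_eq_succ_of_ne_zero hm
      replace hu : s.arr 3 x = u + 1 := hu
      -- An unvisited matched vertex has a positive price, so the search never descends from level
      -- `0`.
      obtain ⟨l, rfl⟩ : ∃ l', l = l' + 1 := Nat.exists_eq_succ_of_ne_zero (by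
        have := hc.matched_right x hxR hm hvx
        omega)
      subst hstk
      have hux := hc.matched.right hxR hu
      have hul := hD.left hux.2.1
      have hfresh := (hc'.fresh_mate x u hxR hvx hu).2
      have hj := hc'.join (e' := u) hD hE (.inr hu) htight
      have hpush := hst'.push hD hc' hE hu hpx hvx hsc
      have hpot' := Net.pot_start (l := l) (ptr := s'.arr 8) (S := S') hD hul hfresh
      refine ⟨⟨?_, ?_, ?_, ?_, ?_, ?_, ?_⟩, ?_, ?_, h.le, ?_, .inr ⟨?_, ?_, ?_, ?_, ?_, ?_, ?_⟩⟩ <;>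
        simp [v0, a0, a2, a4, a5, a6, a7, v6, v7, v8, v16, a10, a11, a3, a14, hu]
      · exact hp.lists.visit x
      · exact h8
      · exact hj.congr (fun _ _ => rfl) fun v hv => Function.update_of_ne hv _ _
      · exact hpush
      · exact Net.Scanning.start hS' (hc'.fresh_mate x u hxR hvx hu).1 (by simp)
      · omega
  · simp [afterScan, wp, Expr.Small, Expr.val, Test.Holds, a3, a14, v0, v1, v2, v6, v8, c4, c5]
    refine ⟨fun hlr' => ⟨by omega, k - 1, ⟨S', ?_⟩, by omega⟩, fun hlr' => ?_⟩
    · subst hlr'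
      -- On level `r` the current vertex is the root. Its neighbours of price `r` have all been
      -- visited, so price plus visit is at least `r + 1` for each neighbour.
      have hct : c = t := hstk.symm.trans hst.root
      have hprice := hstk ▸ hst.price l le_rfl le_rfl
      have hf := hc'.fail (e' := D.n) hD hcur (by omega) (fun w hw => by
        have := hprice w hw
        have := hex w hw
        omega) hprice not_L_n
      refine ⟨⟨?_, ?_, ?_, ?_, ?_, ?_, ?_⟩, ?_, ?_, h.le, ?_, .inl ⟨?_, ?_, ?_, ?_⟩⟩ <;>
        simp [v0, a0, a2, a4, a5, a6, a7, v6, v16, a10, a11, a3]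
      · exact hp.lists
      · exact h8
      · exact hf
      · omega
    · obtain ⟨x, h1, h2, h3, h4, h5, h6⟩ := hst.link (l + 1) (by omega) (by omega)
      have hxR := hD.right h5
      have hxn := hxR.1
      rw [Nat.add_sub_cancel, hstk] at h6
      have hvx : s.arr 11 x = 1 := by
        have := hc.vis_le x
        omega
      have hprice := hstk ▸ hst.price l le_rfl hlr
      -- The neighbours of `c` of price `l` have all been visited, so price plus visit is at least
      -- `l + 1 = p x` everywhere and `c` may take `x` back.
      have hj := hc'.join (e' := s.arr 14 (l + 1)) hD h6 (.inr h2) (fun w hw => by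
        have := hprice w hw
        have := hex w hw
        omega)
      -- `x` was visited when it was taken away, so no new visit is recorded.
      rw [show Function.update (s.arr 11) x 1 = s.arr 11 from hvx ▸ Function.update_eq_self x _] at hj
      have hpop := hst'.pop hD (by omega) (hstk.symm ▸ hc.matched) h1
      have hsc := hst'.scanning (l + 1) (by omega) (by omega)
      rw [hstk] at hpop
      rw [h1]
      refine ⟨by omega, by omega, by omega, by omega, k - 1, ⟨S', ?_⟩, by omega⟩
      refine ⟨⟨?_, ?_, ?_, ?_, ?_, ?_, ?_⟩, ?_, ?_, h.le, ?_, .inr ⟨?_, ?_, ?_, ?_, ?_, ?_, ?_⟩⟩ <;>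
        simp [v0, a0, a2, a4, a5, a6, a7, v6, v7, v8, v16, a10, a11, a3, a14]
      · exact hp.lists
      · exact h8
      · exact hj
      · exact hpop
      · exact hsc
      · omega

theorem searchPaths_runs {D : Net} (hD : D.Valid) {N r q k : ℕ} {s : State} {S : Finset ℕ}
    (hs : Bdd N s) (hN : 2 * D.n + 2 < N) (h : Phase D r q S k s) :
    Runs N searchPaths ((k + 1) * 200) s fun s' => ∃ S k', Phase D r q S k' s' ∧
      s'.var 8 = D.n ∧
      D.Core (s'.arr 3) (s'.arr 10) (s'.arr 11) (s'.arr 8) (s'.arr 9) r D.n D.n := by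
  have hloop := Runs.loop_const (N := N) (b := .lt (.var 8) (.var 0))
    (p := .ite (.eq (.var 7) (.lit 0)) nextRoot (scan ;; afterScan))
    (fun k s => ∃ S, Phase D r q S k s) 196 (by decide) (k := k) (s := s) ?_ hs ⟨S, h⟩
  · refine hloop.mono ?_ ?_
    · simp [Test.cost, Expr.cost]
      omega
    · rintro s' - ⟨⟨k', S, h⟩, h8⟩
      simp only [Test.Holds, Expr.val, h.stored.n] at h8
      obtain ⟨-, h1, h2, -⟩ := h.mode.resolve_right fun h' => h8 h'.2.1
      obtain he : s'.var 8 = D.n := by omega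
      exact ⟨S, k', h, he, he ▸ h2⟩
  · rintro k s hs ⟨S, h⟩ h8
    simp only [Test.Holds, Expr.val, h.stored.n] at h8
    refine (Runs.ite (T := scan.time + afterScan.time) hs (by decide) (fun h7 => ?_)
      (fun h7 => ?_)).mono (by decide)
      fun _ _ => id
    · exact (nextRoot_runs hD hs hN h h7 h8).mono (by decide) fun _ _ => id
    · exact step_runs hD hs hN h h7

end BipartiteMatching

namespace BipartiteMatching

open WordRAM

/-! ### Sorting the right vertices into lists -/

namespace Net

variable {D : Net} {m p p' vis vis' nxt mark ptr prv : ℕ → ℕ} {S : Finset ℕ} {r l x : ℕ}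

/-- Vertices are inserted in increasing order directly after the head, which keeps the lists
decreasing. -/
theorem Lists.pushFront (h : D.Lists p vis nxt mark S) (hx : D.R x) (hS : ∀ c ∈ S, c < x)
    (hp : p x ≤ D.n) (hv : ∀ w, vis' w = 0 → w = x ∨ vis w = 0) :
    D.Lists p vis' (Function.update (Function.update nxt x (nxt (D.n + p x))) (D.n + p x) (x + 1))
      mark (insert x S) := by
  have hxn := hx.1
  have hnx : ∀ y, Function.update (Function.update nxt x (nxt (D.n + p x))) (D.n + p x) (x + 1) y =
      if y = D.n + p x then x + 1 else if y = x then nxt (D.n + p x) else nxt y := fun y => by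
    simp only [Function.update_apply]
  have hnode : ∀ k a, D.Node p (insert x S) k a → a = x ∧ p x = k ∨ a ≠ x ∧ D.Node p S k a :=
    fun k a ha => by
      by_cases hax : a = x
      · subst hax
        refine .inl ⟨rfl, ?_⟩
        rcases ha with ha | ha
        · omega
        · exact ha.2
      · exact .inr ⟨hax, ha.imp_right fun h' => ⟨(Finset.mem_insert.1 h'.1).resolve_left hax, h'.2⟩⟩
  refine ⟨?_, ?_, ?_, ?_, h.mark⟩
  · intro c hc
    rcases Finset.mem_insert.1 hc with rfl | hc
    · exact hx
    · exact h.right c hc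
  · intro w hw hw'
    rcases hv w hw' with rfl | hw'
    · exact Finset.mem_insert_self _ _
    · exact Finset.mem_insert_of_mem (h.unvisited w hw hw')
  · intro k hk a ha h0 c hc hck
    rw [hnx] at h0
    rcases Finset.mem_insert.1 hc with rfl | hcS
    · rcases hnode k a ha with ⟨rfl, -⟩ | ⟨hax, ha'⟩
      · exact le_rfl
      · rcases ha' with rfl | ha'
        · rw [if_pos (by omega)] at h0
          omega
        · exact (hS a ha'.1).le
    · rcases hnode k a ha with ⟨rfl, hak⟩ | ⟨hax, ha'⟩
      · rw [if_neg (by omega), if_pos rfl, hak] at h0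
        have h1 := h.nxt_zero k hk _ (.inl rfl) h0 c hcS hck
        have h2 := hS c hcS
        omega
      · split_ifs at h0
        exact h.nxt_zero k hk a ha' h0 c hcS hck
  · intro k hk a ha b hb
    rw [hnx] at hb
    rcases hnode k a ha with ⟨rfl, hak⟩ | ⟨hax, ha'⟩
    · rw [if_neg (by omega), if_pos rfl, hak] at hb
      obtain ⟨h1, h2, h3, h4⟩ := h.nxt_succ k hk _ (.inl rfl) b hb
      refine ⟨Finset.mem_insert_of_mem h1, h2, hS b h1, fun c hc hck hca => ?_⟩
      rcases Finset.mem_insert.1 hc with rfl | hc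
      · omega
      · exact h4 c hc hck (by omega)
    · split_ifs at hb with h1
      · obtain rfl : x = b := by omega
        subst h1
        have hkx : p x = k := by
          rcases ha' with ha' | ha'
          · omega
          · have := (h.right _ ha'.1).1
            omega
        refine ⟨Finset.mem_insert_self _ _, hkx, by omega, fun c hc _ _ => ?_⟩
        rcases Finset.mem_insert.1 hc with rfl | hc
        · exact le_rfl
        · exact (hS c hc).le
      · obtain ⟨g1, g2, g3, g4⟩ := h.nxt_succ k hk a ha' b hb
        refine ⟨Finset.mem_insert_of_mem g1, g2, g3, fun c hc hck hca => ?_⟩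
        rcases Finset.mem_insert.1 hc with rfl | hc
        · rcases ha' with ha' | ha'
          · exact absurd (hck ▸ ha') h1
          · have := hS a ha'.1
            omega
        · exact g4 c hc hck hca

theorem Lists.congr (h : D.Lists p vis nxt mark S) (hp : ∀ c ∈ S, p' c = p c)
    (hv : ∀ w, D.R w → vis' w = 0 → vis w = 0) : D.Lists p' vis' nxt mark S := by
  have hnode : ∀ k a, D.Node p' S k a → D.Node p S k a := fun k a ha => by
    rcases ha with ha | ha
    · exact .inl ha
    · exact .inr ⟨ha.1, (hp a ha.1).symm.trans ha.2⟩
  refine ⟨h.right, fun w hw hw' => h.unvisited w hw (hv w hw hw'), ?_, ?_, h.mark⟩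
  · intro k hk a ha h0 c hc hck
    exact h.nxt_zero k hk a (hnode k a ha) h0 c hc (hp c hc ▸ hck)
  · intro k hk a ha b hb
    obtain ⟨h1, h2, h3, h4⟩ := h.nxt_succ k hk a (hnode k a ha) b hb
    exact ⟨h1, (hp b h1).trans h2, h3, fun c hc hck => h4 c hc (hp c hc ▸ hck)⟩

open Classical in
variable (D) in
/-- The right vertices below `i`. -/
noncomputable def rightBelow (i : ℕ) : Finset ℕ := (Finset.range i).filter D.R

theorem mem_rightBelow {i w : ℕ} : w ∈ D.rightBelow i ↔ w < i ∧ D.R w := by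
  simp [rightBelow]

theorem rightBelow_succ {i : ℕ} (h : D.R i) :
    D.rightBelow (i + 1) = insert i (D.rightBelow i) := by
  ext w
  simp only [mem_rightBelow, Finset.mem_insert]
  constructor
  · rintro ⟨h1, h2⟩
    by_cases hw : w = i
    · exact .inl hw
    · exact .inr ⟨by omega, h2⟩
  · rintro (rfl | h')
    · exact ⟨by omega, h⟩
    · exact ⟨by omega, h'.2⟩

theorem rightBelow_succ_of_not {i : ℕ} (h : ¬ D.R i) : D.rightBelow (i + 1) = D.rightBelow i := by
  ext w
  simp only [mem_rightBelow]
  constructor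
  · rintro ⟨h1, h2⟩
    have : w ≠ i := by
      rintro rfl
      exact h h2
    exact ⟨by omega, h2⟩
  · rintro ⟨h1, h2⟩
    exact ⟨by omega, h2⟩

end Net

/-- Set the price of each right vertex `i = var 12` to the value of `e`, sort the right vertices
into lists by their prices, and reset all scans. -/
def build (e : Expr) : Cmd :=
  .assign 12 (.lit 0) ;;
  .loop (.lt (.var 12) (.add (.var 0) (.lit 1)))
    (.put 12 (.add (.var 0) (.var 12)) (.lit 0) ;; .assign 12 (.add (.var 12) (.lit 1))) ;;
  .assign 12 (.lit 0) ;;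
  .loop (.lt (.var 12) (.var 0))
    (.put 8 (.var 12) (.lit 0) ;; .put 9 (.var 12) (.var 0) ;;
      .ite (.eq (.get 0 (.var 12)) (.lit 1))
        (.put 10 (.var 12) e ;; .put 11 (.var 12) (.lit 0) ;;
          .put 12 (.var 12) (.get 12 (.add (.var 0) (.get 10 (.var 12)))) ;;
          .put 12 (.add (.var 0) (.get 10 (.var 12))) (.add (.var 12) (.lit 1)))
        .skip ;;
      .assign 12 (.add (.var 12) (.lit 1)))

/-- The effect of `build`. -/
structure BuildPost (D : Net) (p : ℕ → ℕ) (s s' : State) : Prop where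
  stored : D.Stored s'
  var : ∀ x, x ≠ 12 → s'.var x = s.var x
  arr : ∀ a, a < 8 ∨ 12 < a → s'.arr a = s.arr a
  ptr : ∀ u < D.n, s'.arr 8 u = 0
  prv : ∀ u < D.n, s'.arr 9 u = D.n
  price : ∀ w, D.R w → s'.arr 10 w = p w
  vis : ∀ w, D.R w → s'.arr 11 w = 0
  vis_of_not : ∀ w, ¬ D.R w → s'.arr 11 w = s.arr 11 w
  lists : D.Lists (s'.arr 10) (s'.arr 11) (s'.arr 12) (s'.arr 13) (D.rightBelow D.n)

/-- The invariant of the second loop of `build`. -/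
structure Building (D : Net) (p : ℕ → ℕ) (s : State) (i : ℕ) (s' : State) : Prop where
  stored : D.Stored s'
  index : s'.var 12 = i
  le : i ≤ D.n
  var : ∀ x, x ≠ 12 → s'.var x = s.var x
  arr : ∀ a, a < 8 ∨ 12 < a → s'.arr a = s.arr a
  ptr : ∀ u < i, s'.arr 8 u = 0
  prv : ∀ u < i, s'.arr 9 u = D.n
  price : ∀ w < i, D.R w → s'.arr 10 w = p w
  vis : ∀ w < i, D.R w → s'.arr 11 w = 0
  price_of_le : ∀ w, i ≤ w → s'.arr 10 w = s.arr 10 w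
  vis_of_le : ∀ w, i ≤ w ∨ ¬ D.R w → s'.arr 11 w = s.arr 11 w
  lists : D.Lists p (fun w => if w < i then 0 else 1) (s'.arr 12) (s'.arr 13) (D.rightBelow i)

/-- By `hval` the new price may depend on the old price and the old visit of the vertex at hand;
both cells are still intact when `e` is evaluated. -/
theorem building_step {D : Net} {N : ℕ} {s s' : State} {e : Expr} {p : ℕ → ℕ} {i : ℕ}
    (he : e.ok = true) (hs : Bdd N s') (hN : 2 * D.n + 2 < N) (hp : ∀ w, D.R w → p w ≤ D.n)
    (hval : ∀ s' : State, s'.arr 10 (s'.var 12) = s.arr 10 (s'.var 12) →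
      s'.arr 11 (s'.var 12) = s.arr 11 (s'.var 12) → D.R (s'.var 12) →
      e.val s' = p (s'.var 12))
    (h : Building D p s i s') (hi : i < D.n) (c : ℕ) (hc : e.cost + 60 ≤ c) :
    Runs N (.put 8 (.var 12) (.lit 0) ;; .put 9 (.var 12) (.var 0) ;;
      .ite (.eq (.get 0 (.var 12)) (.lit 1))
        (.put 10 (.var 12) e ;; .put 11 (.var 12) (.lit 0) ;;
          .put 12 (.var 12) (.get 12 (.add (.var 0) (.get 10 (.var 12)))) ;;
          .put 12 (.add (.var 0) (.get 10 (.var 12))) (.add (.var 12) (.lit 1)))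
        .skip ;;
      .assign 12 (.add (.var 12) (.lit 1))) c s' (Building D p s (i + 1)) := by
  refine (Runs.of_wp hs (by simp [Cmd.ok, Expr.ok, Test.ok, he, Expr.weight]) ?_).mono
    (T := _) (by simp [Cmd.time, Expr.cost, Test.cost]; omega) fun _ _ => id
  simp only [wp, Expr.Small, Expr.val, Test.Holds, State.setArr_var, State.setArr_arr,
    h.stored.n, h.stored.side, h.index]
  simp
  refine ⟨fun hR => ?_, fun hR => ?_⟩
  · replace hR : D.R i := ⟨hi, hR⟩
    have hv := hval ((s'.setArr 8 i 0).setArr 9 i D.n) (by simp [h.index, h.price_of_le])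
      (by simp [h.index, h.vis_of_le]) (by simpa [h.index] using hR)
    have hpi := hp i hR
    simp only [State.setArr_var, h.index] at hv
    refine ⟨Expr.small_of_val_lt (s := (s'.setArr 8 i 0).setArr 9 i D.n) (by omega), by omega, ?_⟩
    rw [hv]
    refine ⟨⟨?_, ?_, ?_, ?_, ?_, ?_, ?_⟩, by simp, hi, fun x hx => by simp [hx, h.var],
      fun a ha => ?_, fun u hu => ?_, fun u hu => ?_, fun w hw hw' => ?_, fun w hw hw' => ?_,
      fun w hw => ?_, fun w hw => ?_, ?_⟩
    · simp [h.stored.n]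
    · simp [h.stored.side]
    · simp [h.stored.adj]
    · simp [h.stored.ext]
    · simp [h.stored.base]
    · simp [h.stored.len]
    · simp [h.stored.dense]
    · have : a ≠ 8 ∧ a ≠ 9 ∧ a ≠ 10 ∧ a ≠ 11 ∧ a ≠ 12 := by omega
      simp [this, h.arr a ha]
    · simp [Function.update_apply]
      exact fun h' => h.ptr u (by omega)
    · simp [Function.update_apply]
      exact fun h' => h.prv u (by omega)
    · simp [Function.update_apply]
      split_ifs with h'
      · rw [h']
      · exact h.price w (by omega) hw'
    · simp [Function.update_apply]
      exact fun h' => h.vis w (by omega) hw'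
    · rw [← h.price_of_le w (by omega)]
      simp [show w ≠ i by omega]
    · have : w ≠ i := by
        rintro rfl
        exact hw.elim (by omega) fun h' => h' hR
      rw [← h.vis_of_le w (hw.imp_left fun h' => by omega)]
      simp [this]
    · rw [Net.rightBelow_succ hR]
      -- Vertices that have not been reached are treated as visited, so the lists need not contain
      -- them yet.
      have := h.lists.pushFront (vis' := fun w => if w < i + 1 then 0 else 1) hR
        (fun c hc => (Net.mem_rightBelow.1 hc).1) hpi (fun w hw => by
          simp at hw ⊢
          omega)
      simpa using this
  · have hR' : ¬ D.R i := fun h' => hR h'.2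
    refine ⟨by omega, ?_⟩
    refine ⟨⟨?_, ?_, ?_, ?_, ?_, ?_, ?_⟩, by simp, hi, fun x hx => by simp [hx, h.var],
      fun a ha => ?_, fun u hu => ?_, fun u hu => ?_, fun w hw hw' => ?_, fun w hw hw' => ?_,
      fun w hw => ?_, fun w hw => ?_, ?_⟩
    · simp [h.stored.n]
    · simp [h.stored.side]
    · simp [h.stored.adj]
    · simp [h.stored.ext]
    · simp [h.stored.base]
    · simp [h.stored.len]
    · simp [h.stored.dense]
    · have : a ≠ 8 ∧ a ≠ 9 := by omega
      simp [this, h.arr a ha]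
    · simp [Function.update_apply]
      exact fun h' => h.ptr u (by omega)
    · simp [Function.update_apply]
      exact fun h' => h.prv u (by omega)
    · have : w ≠ i := by
        rintro rfl
        exact hR' hw'
      simpa using h.price w (by omega) hw'
    · have : w ≠ i := by
        rintro rfl
        exact hR' hw'
      simpa using h.vis w (by omega) hw'
    · simpa using h.price_of_le w (by omega)
    · simpa using h.vis_of_le w (hw.imp_left fun h' => by omega)
    · rw [Net.rightBelow_succ_of_not hR']
      have := h.lists.congr (p' := p) (vis' := fun w => if w < i + 1 then 0 else 1)
        (fun _ _ => rfl) (fun w hw hw' => by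
          have : w ≠ i := by
            rintro rfl
            exact hR' hw
          simp at hw' ⊢
          omega)
      simpa using this

theorem build_runs {D : Net} {N : ℕ} {s : State} {e : Expr} {p : ℕ → ℕ}
    (he : e.ok = true) (hs : Bdd N s) (hN : 2 * D.n + 2 < N) (hst : D.Stored s)
    (hp : ∀ w, D.R w → p w ≤ D.n) (hmark : ∀ x u, D.L u → s.arr 13 x = u + 1 → ¬ D.E u x)
    (hval : ∀ s' : State, s'.arr 10 (s'.var 12) = s.arr 10 (s'.var 12) →
      s'.arr 11 (s'.var 12) = s.arr 11 (s'.var 12) → D.R (s'.var 12) →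
      e.val s' = p (s'.var 12)) :
    Runs N (build e) ((D.n + 1) * (e.cost + 120)) s (BuildPost D p s) := by
  have h1 : Runs N (.assign 12 (.lit 0)) 2 s fun s' => s' = s.setVar 12 0 :=
    (Runs.of_wp hs (by decide) (by simp [wp, Expr.Small, Expr.val])).mono (by decide) fun _ _ => id
  refine (h1.seq (T' := (D.n + 1) * 20 + 10 + (2 + ((D.n + 1) * (e.cost + 70)))) ?_).mono
    ?_ fun _ _ => id
  swap
  · ring_nf
    omega
  rintro s1 hs1 rfl
  refine Runs.seq (T := (D.n + 1) * 20 + 10) (T' := 2 + ((D.n + 1) * (e.cost + 70)))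
    (Q := fun s' => (∀ x, x ≠ 12 → s'.var x = s.var x) ∧ (∀ a, a ≠ 12 → s'.arr a = s.arr a) ∧
      ∀ l ≤ D.n, s'.arr 12 (D.n + l) = 0) ?_ ?_
  · refine (Runs.loop_const (fun k s' => s'.var 12 ≤ D.n + 1 ∧ k = D.n + 1 - s'.var 12 ∧
      (∀ x, x ≠ 12 → s'.var x = s.var x) ∧ (∀ a, a ≠ 12 → s'.arr a = s.arr a) ∧
      ∀ l < s'.var 12, s'.arr 12 (D.n + l) = 0) 9 (by decide) ?_ hs1 (k := D.n + 1)
        ⟨by simp, by simp, ?_⟩).mono ?_ ?_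
    · rintro k s' hs' ⟨h1, rfl, h2, h3, h4⟩ hb
      have h0 := (h2 0 (by decide)).trans hst.n
      simp only [Test.Holds, Expr.val, h0] at hb
      refine (Runs.of_wp hs' (by decide) ?_).mono (by decide) fun _ _ => id
      simp [wp, Expr.Small, Expr.val, h0]
      refine ⟨by omega, ⟨by omega, ?_, ?_, ?_⟩, by omega⟩
      · intro x hx
        simp [hx, h2]
      · intro a ha
        simp [ha, h3]
      · intro l hl
        rw [Function.update_apply]
        split_ifs with h
        · rfl
        · exact h4 l (by omega)
    · exact ⟨fun x hx => by simp [hx], fun a ha => by simp, by simp⟩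
    · simp [Test.cost, Expr.cost]
      omega
    · rintro s' - ⟨⟨k, h1, -, h2, h3, h4⟩, hb⟩
      have h0 := (h2 0 (by decide)).trans hst.n
      simp only [Test.Holds, Expr.val, h0] at hb
      exact ⟨h2, h3, fun l hl => h4 l (by omega)⟩
  rintro s2 hs2 ⟨h2, h3, h4⟩
  have h1 : Runs N (.assign 12 (.lit 0)) 2 s2 fun s' => s' = s2.setVar 12 0 :=
    (Runs.of_wp hs2 (by decide) (by simp [wp, Expr.Small, Expr.val])).mono (by decide) fun _ _ => id
  refine h1.seq ?_
  rintro s3 hs3 rfl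
  refine (Runs.loop_const (fun k s' => Building D p s (s'.var 12) s' ∧ k = D.n - s'.var 12)
    (e.cost + 60) (by decide) ?_ hs3 (k := D.n) ⟨?_, by simp⟩).mono ?_ ?_
  · rintro k s' hs' ⟨h, rfl⟩ hb
    simp only [Test.Holds, Expr.val, h.stored.n] at hb
    refine (building_step he hs' hN hp hval h hb _ le_rfl).mono le_rfl fun s'' _ h'' => ?_
    have := h''.index
    exact ⟨D.n - s''.var 12, ⟨this.symm ▸ h'', rfl⟩, by omega⟩
  · refine ⟨⟨?_, ?_, ?_, ?_, ?_, ?_, ?_⟩, rfl, by simp, fun x hx => by simp [hx, h2],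
      fun a ha => by simpa using h3 a (by omega), by simp, by simp, by simp, by simp,
      fun w _ => by simp [h3], fun w _ => by simp [h3], ?_⟩
    · simp [h2, hst.n]
    · simp [h3, hst.side]
    · simp [h3, hst.adj]
    · simp [h3, hst.ext]
    · simp [h3, hst.base]
    · simp [h3, hst.len]
    · simp [h3, hst.dense]
    · have hempty : D.rightBelow 0 = ∅ := by
        ext
        simp [Net.mem_rightBelow]
      simp only [State.setVar_arr, State.setVar_var, if_true, hempty]
      refine ⟨by simp, by simp, by simp, fun l hl a ha b hb => ?_, by simpa [h3] using hmark⟩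
      rcases ha with rfl | ha
      · rw [h4 l hl] at hb
        omega
      · simp at ha
  · simp [Test.cost, Expr.cost]
    ring_nf
    omega
  · rintro s' - ⟨⟨k, h, -⟩, hb⟩
    simp only [Test.Holds, Expr.val, h.stored.n] at hb
    have hle := h.le
    have hi : s'.var 12 = D.n := by omega
    rw [hi] at h
    refine ⟨h.stored, h.var, h.arr, h.ptr, h.prv, fun w hw => h.price w hw.1 hw,
      fun w hw => h.vis w hw.1 hw, fun w hw => h.vis_of_le w (.inr hw), ?_⟩
    refine h.lists.congr (fun c hc => ?_) (fun w hw _ => ?_)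
    · obtain ⟨h1, h2⟩ := Net.mem_rightBelow.1 hc
      exact h.price c h1 h2
    · simp [hw.1]

end BipartiteMatching

namespace BipartiteMatching

open WordRAM

/-! ### The phases -/

namespace Net

variable {D : Net} {m p p' vis ptr prv : ℕ → ℕ} {S : Finset ℕ} {r l x : ℕ}

variable (D) in
/-- The prices `p` of the right vertices fit to the matching `m`, and the neighbours of unmatched
left vertices have prices at least `r`. -/
structure Prices (m p : ℕ → ℕ) (r : ℕ) : Prop where
  matched : D.Matched m D.n
  free_right : ∀ w, D.R w → m w = 0 → p w = 0
  matched_right : ∀ w, D.R w → m w ≠ 0 → 1 ≤ p w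
  price_le : ∀ w, D.R w → p w ≤ r
  tight : ∀ u x, D.L u → m u = x + 1 → ∀ w, D.E u w → p x ≤ p w + 1
  free : ∀ u, D.L u → m u = 0 → ∀ w, D.E u w → r ≤ p w

theorem L.ne_n {u : ℕ} (h : D.L u) : u ≠ D.n := h.1.ne

/-- All roots have been treated, so a left vertex that is still unmatched is a failed root, and
`failed` provides the bound `r + 1`. Visits turn into price increases. -/
theorem Core.prices (h : D.Core m p vis ptr prv r D.n D.n) :
    D.Prices m (fun w => p w + vis w) (r + 1) where
  matched := h.matched
  free_right w hw hm := by
    have := h.free_right w hw hm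
    omega
  matched_right w hw hm := by
    by_cases hv : vis w = 0
    · have := h.matched_right w hw hm hv
      omega
    · omega
  price_le w hw := add_le_add (h.price_le w hw) (h.vis_le w)
  tight u x hu hm w hw := by
    have := h.tight u x hu hu.ne_n hm w hw
    omega
  free u hu hm w hw := h.failed u hu hu.ne_n hm hu.1 w hw

theorem Prices.core (hD : D.Valid) (h : D.Prices m p r) (hp : ∀ w, D.R w → p' w = p w)
    (hv : ∀ w, D.R w → vis w = 0) (hv' : ∀ w, vis w ≤ 1) (hptr : ∀ u < D.n, ptr u = 0)
    (hprv : ∀ u < D.n, prv u = D.n) : D.Core m p' vis ptr prv r D.n 0 where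
  matched := h.matched
  free_right w hw hm := ⟨(hp w hw).trans (h.free_right w hw hm), hv w hw⟩
  matched_right w hw hm _ := (h.matched_right w hw hm).trans (hp w hw).ge
  vis_le := hv'
  price_le w hw := (hp w hw).le.trans (h.price_le w hw)
  tight u x hu hue hm w hw := by
    have hx := hD.right (h.matched.left hu hue hm).1
    have hw' := hD.right hw
    rw [hp x hx, hp w hw', hv x hx, hv w hw']
    exact h.tight u x hu hm w hw
  tight_start u x hu hue hm _ w hw := by
    rw [hp x (hD.right (h.matched.left hu hue hm).1), hp w (hD.right hw)]
    exact h.tight u x hu hm w hw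
  free u hu _ hm w hw := (h.free u hu hm w hw).trans (hp w (hD.right hw)).ge
  failed u hu _ hm hlt := by omega
  fresh_root u hu _ _ _ := ⟨hptr u hu.1, (hprv u hu.1).ge⟩
  fresh_mate w u hw _ hm := by
    have hu := hD.left (h.matched.right hw hm).2.1
    exact ⟨hptr u hu.1, (hprv u hu.1).ge⟩

variable (D) in
/-- The total length of all lists. -/
def size : ℕ := ∑ u ∈ Finset.range D.n, D.len u

/-- A list entry counts at most twice: for being read, and for the vertex that it names being
skipped. -/
theorem pot_rightBelow_le : D.pot ptr prv (D.rightBelow D.n) ≤ 2 * D.size + D.n := by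
  refine add_le_add ?_ ?_
  · rw [size, Finset.mul_sum]
    refine Finset.sum_le_sum fun u _ => ?_
    have := Finset.card_filter_le (Finset.range (D.len u)) fun i => D.item u i < prv u
    rw [Finset.card_range] at this
    simp only [todo]
    omega
  · classical
    exact (Finset.card_filter_le _ _).trans (Finset.card_range _).le

theorem unvisited_le : D.unvisited vis ≤ D.n :=
  (Finset.card_filter_le _ _).trans (Finset.card_range _).le

end Net

/-- One phase: update the prices and find disjoint augmenting paths. -/
def phase : Cmd :=
  build (.add (.get 10 (.var 12)) (.get 11 (.var 12))) ;; .assign 8 (.lit 0) ;;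
    .assign 7 (.lit 0) ;; searchPaths

/-- What is known between two phases. -/
structure Between (D : Net) (r q : ℕ) (s : State) : Prop where
  stored : D.Stored s
  phase : s.var 6 = r
  square : s.var 16 = q
  vis_le : ∀ w, s.arr 11 w ≤ 1
  mark : ∀ x u, D.L u → s.arr 13 x = u + 1 → ¬ D.E u x
  prices : D.Prices (s.arr 3) (fun w => s.arr 10 w + s.arr 11 w) r

theorem phase_runs {D : Net} (hD : D.Valid) {N r q : ℕ} {s : State}
    (hs : Bdd N s) (hN : 2 * D.n + 2 < N) (hr : r ≤ D.n) (h : Between D r q s) :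
    Runs N phase ((D.size + D.n + 1) * 2000) s fun s' => Between D (r + 1) q
      (s'.setVar 6 (r + 1)) ∧ s'.var 6 = r ∧ s'.var 16 = q ∧ s'.var 0 = D.n := by
  have hb := build_runs (e := .add (.get 10 (.var 12)) (.get 11 (.var 12)))
    (p := fun w => s.arr 10 w + s.arr 11 w) (by decide) hs hN h.stored
    (fun w hw => (h.prices.price_le w hw).trans hr) h.mark (fun s' h1 h2 _ => by
      simp only [Expr.val, h1, h2])
  refine (hb.seq (T' := 4 + (2 * D.size + 5 * D.n + 1) * 200) ?_).mono ?_ fun _ _ => id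
  swap
  · simp [Expr.cost]
    ring_nf
    omega
  intro s1 hs1 h1
  have h2 : Runs N (.assign 8 (.lit 0)) 2 s1 fun s' => s' = s1.setVar 8 0 :=
    (Runs.of_wp hs1 (by decide) (by simp [wp, Expr.Small, Expr.val])).mono (by decide) fun _ _ => id
  refine (h2.seq (T' := 2 + (2 * D.size + 5 * D.n + 1) * 200) ?_).mono (by omega) fun _ _ => id
  rintro s2 hs2 rfl
  have h2 : Runs N (.assign 7 (.lit 0)) 2 (s1.setVar 8 0)
      fun s' => s' = (s1.setVar 8 0).setVar 7 0 :=
    (Runs.of_wp hs2 (by decide) (by simp [wp, Expr.Small, Expr.val])).mono (by decide) fun _ _ => id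
  refine h2.seq ?_
  rintro s2 hs2 rfl
  have a3 := h1.arr 3 (by decide)
  -- `2 * size + n` for the scans, `2 * n` for the visits and `2 * n` for the roots.
  have hph : Phase D r q (D.rightBelow D.n) (2 * D.size + 5 * D.n)
      ((s1.setVar 8 0).setVar 7 0) := by
    refine ⟨⟨?_, ?_, ?_, ?_, ?_, ?_, ?_⟩, ?_, ?_, hr, ?_, .inl ⟨by simp, by simp, ?_, ?_⟩⟩ <;>
      simp [h1.stored.n, h1.stored.side, h1.stored.adj, h1.stored.ext, h1.stored.base,
        h1.stored.len, h1.stored.dense, h1.var, h.phase, h.square, h1.lists, a3]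
    · refine h.prices.core hD h1.price h1.vis (fun w => ?_) h1.ptr h1.prv
      by_cases hw : D.R w
      · simp [h1.vis w hw]
      · rw [h1.vis_of_not w hw]
        exact h.vis_le w
    · have := Net.pot_rightBelow_le (D := D) (ptr := s1.arr 8) (prv := s1.arr 9)
      have := Net.unvisited_le (D := D) (vis := s1.arr 11)
      omega
  refine (searchPaths_runs hD hs2 hN hph).mono le_rfl ?_
  rintro s' - ⟨S, k, h3, h4, h5⟩
  refine ⟨⟨⟨?_, ?_, ?_, ?_, ?_, ?_, ?_⟩, ?_, ?_, ?_, ?_, ?_⟩, h3.phase, h3.square, h3.stored.n⟩ <;>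
    simp [h3.stored.n, h3.stored.side, h3.stored.adj, h3.stored.ext, h3.stored.base,
      h3.stored.len, h3.stored.dense, h3.square]
  · exact h5.vis_le
  · exact h3.lists.mark
  · exact h5.prices

/-- Phases until their number `r` satisfies `n ≤ r ^ 2`. -/
def phases : Cmd :=
  .loop (.lt (.var 16) (.var 0))
    (phase ;; .assign 16 (.add (.add (.var 16) (.var 6)) (.add (.var 6) (.lit 1))) ;;
      .assign 6 (.add (.var 6) (.lit 1)))

/-- Without multiplication, the square `r * r` in `var 16` is updated by adding `r + r + 1`, a sum
of four words. -/
theorem phases_runs {D : Net} (hD : D.Valid) {N : ℕ} {s : State}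
    (hs : Bdd N s) (hN : 4 * D.n + 4 < N) (h : Between D 0 0 s) :
    Runs N phases ((Nat.sqrt D.n + 2) * ((D.size + D.n + 1) * 2100)) s
      fun s' => ∃ r, Between D r (r * r) s' ∧ D.n ≤ r * r ∧ r ≤ Nat.sqrt D.n + 1 := by
  have hsq : ∀ r, r * r < D.n → r ≤ Nat.sqrt D.n := fun r hr => Nat.le_sqrt.2 hr.le
  refine (Runs.loop_const (fun k s => ∃ r, Between D r (r * r) s ∧ r ≤ Nat.sqrt D.n + 1 ∧
    k = Nat.sqrt D.n + 1 - r) ((D.size + D.n + 1) * 2020) (by decide) ?_ hs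
    (k := Nat.sqrt D.n + 1) ⟨0, h, by omega, rfl⟩).mono ?_ ?_
  · rintro k s hs ⟨r, h, hr, rfl⟩ hb
    simp only [Test.Holds, Expr.val, h.stored.n, h.square] at hb
    have hrs := hsq r hb
    -- Heads of lists are set up only for the prices up to `D.n`.
    have hrn : r ≤ D.n := hrs.trans (Nat.sqrt_le_self _)
    refine ((phase_runs hD hs (by omega) hrn h).seq (T' := 20) ?_).mono (by omega)
      fun _ _ => id
    rintro s' hs' ⟨h1, h2, h3, h4⟩
    refine (Runs.of_wp hs' (by decide) ?_).mono (by decide) fun _ _ => id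
    simp [wp, Expr.Small, Expr.val, h2, h3]
    refine ⟨by omega, by omega, r + 1, ⟨⟨⟨?_, ?_, ?_, ?_, ?_, ?_, ?_⟩, ?_, ?_, ?_, ?_, ?_⟩,
      by omega⟩, by omega⟩
    all_goals simp [h4]
    · simpa using h1.stored.side
    · simpa using h1.stored.adj
    · simpa using h1.stored.ext
    · simpa using h1.stored.base
    · simpa using h1.stored.len
    · simpa using h1.stored.dense
    · ring
    · simpa using h1.vis_le
    · simpa using h1.mark
    · simpa using h1.prices
  · simp [Test.cost, Expr.cost]
    ring_nf
    nlinarith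
  · rintro s' - ⟨⟨k, r, h, hr, -⟩, hb⟩
    simp only [Test.Holds, Expr.val, h.stored.n, h.square] at hb
    exact ⟨r, h, by omega, hr⟩

end BipartiteMatching

namespace BipartiteMatching

open WordRAM

/-! ### Matchings and vertex covers -/

namespace Net

variable {D : Net} {m m' p q par vis nxt mark ptr prv : ℕ → ℕ} {S : Finset ℕ} {r l x u j : ℕ}

open Classical in
variable (D) in
/-- The matched left vertices. -/
noncomputable def matchedLeft (m : ℕ → ℕ) : Finset ℕ :=
  (Finset.range D.n).filter fun u => D.L u ∧ m u ≠ 0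

theorem mem_matchedLeft : u ∈ D.matchedLeft m ↔ D.L u ∧ m u ≠ 0 := by
  simp only [matchedLeft, Finset.mem_filter, Finset.mem_range]
  exact ⟨fun h => h.2, fun h => ⟨h.1.1, h⟩⟩

variable (D) in
/-- A set of vertices that contains an end of each edge. -/
def IsCover (C : Finset ℕ) : Prop := ∀ u w, D.E u w → u ∈ C ∨ w ∈ C

/-- Weak duality: each matching edge selects an end in the cover, and different edges select
different ends. -/
theorem Matched.card_le (hD : D.Valid) (hm : D.Matched m D.n) {C : Finset ℕ}
    (hC : D.IsCover C) : (D.matchedLeft m).card ≤ C.card := by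
  have key : ∀ u ∈ D.matchedLeft m, D.L u ∧ D.E u (m u - 1) ∧ m (m u - 1) = u + 1 :=
    fun u hu => by
      obtain ⟨h1, h2⟩ := mem_matchedLeft.1 hu
      have := hm.left (w := m u - 1) h1 h1.ne_n (by omega)
      exact ⟨h1, this.1, this.2⟩
  refine Finset.card_le_card_of_injOn (fun u => if u ∈ C then u else m u - 1) ?_ ?_
  · intro u hu
    have := hC _ _ (key u hu).2.1
    dsimp only
    split_ifs with h
    · exact h
    · exact this.resolve_left h
  · intro u hu v hv huv
    obtain ⟨h1, h2, h3⟩ := key u hu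
    obtain ⟨h4, h5, h6⟩ := key v hv
    dsimp only at huv
    split_ifs at huv
    · exact huv
    · exact absurd huv (h1.ne_R (hD.right h5))
    · exact absurd huv.symm (h4.ne_R (hD.right h2))
    · rw [huv] at h3
      omega

/-- Each matching edge has at most one end in `A ∪ B`, because partners of elements of `A` avoid
`B`. -/
theorem Matched.card_add_card_le (hD : D.Valid) (hm : D.Matched m D.n) {A B : Finset ℕ}
    (hA : ∀ w ∈ A, D.R w ∧ m w ≠ 0 ∧ m w - 1 ∉ B) (hB : B ⊆ D.matchedLeft m) :
    A.card + B.card ≤ (D.matchedLeft m).card := by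
  have key : ∀ w ∈ A, D.E (m w - 1) w ∧ m (m w - 1) = w + 1 := fun w hw => by
    obtain ⟨h1, h2, h3⟩ := hA w hw
    exact (hm.right (u := m w - 1) h1 (by omega)).2
  have hinj : Set.InjOn (fun w => m w - 1) A := fun w hw v hv hwv => by
    have h1 := (key w hw).2
    have h2 := (key v hv).2
    dsimp only at hwv
    rw [hwv] at h1
    omega
  rw [← Finset.card_image_of_injOn hinj, ← Finset.card_union_of_disjoint]
  · refine Finset.card_le_card (Finset.union_subset ?_ hB)
    rw [Finset.image_subset_iff]
    intro w hw
    obtain ⟨h1, h2⟩ := key w hw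
    exact mem_matchedLeft.2 ⟨hD.left h1, by omega⟩
  · rw [Finset.disjoint_left]
    intro u hu
    obtain ⟨w, hw, rfl⟩ := Finset.mem_image.1 hu
    exact (hA w hw).2.2

/-- Prices give a small vertex cover. -/
theorem Prices.exists_cover (hD : D.Valid) (h : D.Prices m p r) (hr : D.n ≤ r * r) :
    ∃ C, D.IsCover C ∧ C.card ≤ (D.matchedLeft m).card + r := by
  classical
  rcases Nat.eq_zero_or_pos r with rfl | hr0
  · have hn : D.n = 0 := by omega
    refine ⟨∅, fun u w hE => ?_, by simp⟩
    have := (hD.left hE).1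
    omega
  let P : ℕ → Finset ℕ := fun j => (D.rightBelow D.n).filter fun w => p w = j
  -- If each of the `r` prices occurred at least `r + 1` times, then `r * (r + 1) ≤ n ≤ r * r`.
  obtain ⟨j, hj, hjr⟩ : ∃ j ∈ Finset.Icc 1 r, (P j).card ≤ r := by
    by_contra! hcon
    have h1 : ∑ j ∈ Finset.Icc 1 r, (P j).card ≤ D.n := by
      rw [← Finset.card_biUnion]
      · refine (Finset.card_le_card (t := Finset.range D.n) ?_).trans (Finset.card_range _).le
        intro w hw
        simp only [Finset.mem_biUnion, P, Finset.mem_filter, mem_rightBelow] at hw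
        obtain ⟨-, -, ⟨h1, -⟩, -⟩ := hw
        simpa using h1
      · intro i _ k _ hik
        simp only [P, Function.onFun, Finset.disjoint_left, Finset.mem_filter]
        rintro w ⟨-, rfl⟩ ⟨-, h'⟩
        exact hik h'
    have h2 : ∑ j ∈ Finset.Icc 1 r, (r + 1) ≤ ∑ j ∈ Finset.Icc 1 r, (P j).card :=
      Finset.sum_le_sum hcon
    simp only [Finset.sum_const, Nat.card_Icc, smul_eq_mul, Nat.add_sub_cancel] at h2
    nlinarith
  rw [Finset.mem_Icc] at hj
  -- Cut at price `j`: a matching edge is represented by its right end if that is dearer than `j`,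
  -- and by its left end otherwise.
  let A := (D.rightBelow D.n).filter fun w => j + 1 ≤ p w
  let B := (D.matchedLeft m).filter fun u => p (m u - 1) ≤ j
  have hAB : A.card + B.card ≤ (D.matchedLeft m).card := by
    refine h.matched.card_add_card_le hD (fun w hw => ?_) (Finset.filter_subset _ _)
    simp only [A, Finset.mem_filter, mem_rightBelow] at hw
    obtain ⟨⟨-, hR⟩, hpw⟩ := hw
    have hmw : m w ≠ 0 := fun h0 => by
      have := h.free_right w hR h0
      omega
    refine ⟨hR, hmw, fun hB => ?_⟩
    have := (h.matched.right (u := m w - 1) hR (by omega)).2.2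
    have h2 := (Finset.mem_filter.1 hB).2
    rw [this, Nat.add_sub_cancel] at h2
    omega
  refine ⟨P j ∪ (A ∪ B), fun u w hE => ?_, ?_⟩
  · have hu := hD.left hE
    have hw := hD.right hE
    by_cases hjw : j ≤ p w
    · right
      have hmem : w ∈ D.rightBelow D.n := mem_rightBelow.2 ⟨hw.1, hw⟩
      rcases Nat.eq_or_lt_of_le hjw with hjw | hjw
      · exact Finset.mem_union_left _ (Finset.mem_filter.2 ⟨hmem, hjw.symm⟩)
      · exact Finset.mem_union_right _ (Finset.mem_union_left _ (Finset.mem_filter.2 ⟨hmem, hjw⟩))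
    · left
      have hmu : m u ≠ 0 := fun h0 => by
        have := h.free u hu h0 w hE
        omega
      refine Finset.mem_union_right _ (Finset.mem_union_right _ (Finset.mem_filter.2
        ⟨mem_matchedLeft.2 ⟨hu, hmu⟩, ?_⟩))
      -- The partner of `u` costs at most `p w + 1 ≤ j`, so `u` belongs to `B`.
      have := h.tight u (m u - 1) hu (by omega) w hE
      omega
  · have h1 := Finset.card_union_le (P j) (A ∪ B)
    have h2 := Finset.card_union_le A B
    omega

/-! ### Breadth-first search -/

variable (D) in
/-- The search from all unmatched left vertices: `q` is the queue of the left vertices reached,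
from the positions `h` to `t`, and `par w` is the vertex from which `w` has been visited. -/
structure Bfs (m p vis mark ptr prv q par : ℕ → ℕ) (S : Finset ℕ) (h t : ℕ) : Prop where
  matched : D.Matched m D.n
  price : ∀ w, D.R w → p w = 0
  le : h ≤ t
  left : ∀ i < t, D.L (q i)
  inj : ∀ i < t, ∀ j < t, q i = q j → i = j
  origin : ∀ i < t, m (q i) = 0 ∨ ∃ w, m (q i) = w + 1 ∧ vis w ≠ 0 ∧
    ∃ j < i, par w = q j ∧ D.E (q j) w
  roots : ∀ u, D.L u → m u = 0 → ∃ i < t, q i = u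
  visited : ∀ w, D.R w → vis w ≠ 0 → ∃ i < t, m w = q i + 1
  done : ∀ i < h, ∀ w, D.E (q i) w → vis w ≠ 0
  scanning : h < t → D.Scanning p vis mark ptr prv S (q h) 0
  fresh : ∀ u, D.L u → (∀ i ≤ h, i < t → q i ≠ u) → ptr u = 0 ∧ prv u = D.n

variable (D) in
/-- An alternating path from the right vertex `x` back to an unmatched left vertex. -/
structure Chain (m par q : ℕ → ℕ) (j x : ℕ) : Prop where
  left : ∀ i ≤ j, D.L (q i)
  inj : ∀ i ≤ j, ∀ k ≤ j, q i = q k → i = k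
  origin : ∀ i ≤ j, m (q i) = 0 ∨ ∃ w, m (q i) = w + 1 ∧ ∃ k < i, par w = q k ∧ D.E (q k) w
  par : par x = q j
  edge : D.E (q j) x

theorem Matched.release_free (hm : D.Matched m D.n) (h0 : m u = 0) : D.Matched m u := by
  refine ⟨fun hv _ => hm.left hv hv.ne_n, fun {v w} hw hmw => ?_⟩
  obtain ⟨-, h2, h3⟩ := hm.right hw hmw
  refine ⟨?_, h2, h3⟩
  rintro rfl
  omega

/-- Clearing the entry of `x` dissolves the pair; the stale entry of `u` is harmless because `u`
becomes the exempt vertex. -/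
theorem Matched.release (hD : D.Valid) (hm : D.Matched m D.n) (hu : D.L u) (hx : m u = x + 1) :
    D.Matched (Function.update m x 0) u := by
  obtain ⟨hE, hxu⟩ := hm.left hu hu.ne_n hx
  have hxR := hD.right hE
  constructor
  · intro v w hv hvu hmv
    rw [Function.update_of_ne (hv.ne_R hxR)] at hmv
    obtain ⟨h1, h2⟩ := hm.left hv hv.ne_n hmv
    refine ⟨h1, ?_⟩
    rwa [Function.update_of_ne]
    rintro rfl
    omega
  · intro v w hw hmw
    have hwx : w ≠ x := by
      rintro rfl
      simp at hmw
    rw [Function.update_of_ne hwx] at hmw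
    obtain ⟨-, h2, h3⟩ := hm.right hw hmw
    have hv := hD.left h2
    rw [Function.update_of_ne (hv.ne_R hxR)]
    refine ⟨?_, h2, h3⟩
    rintro rfl
    omega

theorem matchedLeft_join (hu : D.L u) (hx : D.R x) :
    D.matchedLeft (join m u x) = insert u (D.matchedLeft m) := by
  ext v
  simp only [Finset.mem_insert, mem_matchedLeft]
  by_cases hvu : v = u
  · subst hvu
    simp [hu, join_self]
  · refine ⟨fun ⟨h1, h2⟩ => .inr ⟨h1, ?_⟩, fun h => ?_⟩
    · rwa [join_of_ne hvu (h1.ne_R hx)] at h2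
    · obtain ⟨h1, h2⟩ := h.resolve_left hvu
      exact ⟨h1, by rwa [join_of_ne hvu (h1.ne_R hx)]⟩

theorem Chain.finish (hD : D.Valid) (h : D.Chain m par q j x)
    (hm : D.Matched (Function.update m x 0) D.n) (h0 : m (q j) = 0) :
    D.Matched (join m (q j) x) D.n ∧
      (D.matchedLeft (join m (q j) x)).card = (D.matchedLeft m).card + 1 := by
  have hu := h.left j le_rfl
  have hx := hD.right h.edge
  have hux := hu.ne_R hx
  constructor
  · have h1 := (hm.release_free (u := q j) (by rwa [Function.update_of_ne hux])).join
      (e' := D.n) hD h.edge (.inl ⟨by simp, not_L_n⟩)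
    simpa [join] using h1
  · rw [matchedLeft_join hu hx, Finset.card_insert_of_notMem]
    simp [mem_matchedLeft, h0]

/-- `q j` exchanges `y` for `x`, so it stays matched, and the same task arises for `y`, whose parent
stands earlier in the queue. The entry of `y` still names `q j`; the matching is therefore asserted
with this entry cleared. -/
theorem Chain.step (hD : D.Valid) (h : D.Chain m par q j x)
    (hm : D.Matched (Function.update m x 0) D.n) {y : ℕ} (hy : m (q j) = y + 1) :
    D.Matched (Function.update (join m (q j) x) y 0) D.n ∧
      (D.matchedLeft (join m (q j) x)).card = (D.matchedLeft m).card ∧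
      ∃ k < j, D.Chain (join m (q j) x) par q k y := by
  have hu := h.left j le_rfl
  have hx := hD.right h.edge
  have hux := hu.ne_R hx
  obtain ⟨w, hw, k, hk, h1, h2⟩ := (h.origin j le_rfl).resolve_left (by omega)
  obtain rfl : y = w := by omega
  have hyR := hD.right h2
  have huy := hu.ne_R hyR
  have hyx : y ≠ x := by
    rintro rfl
    have := (hm.left hu hu.ne_n (w := y) (by rw [Function.update_of_ne hux, hy])).2
    simp at this
  refine ⟨?_, ?_, k, hk, fun i hi => h.left i (by omega),
    fun i hi i' hi' => h.inj i (by omega) i' (by omega), fun i hi => ?_, h1, h2⟩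
  · have h3 := (hm.release (x := y) hD hu (by rwa [Function.update_of_ne hux])).join (e' := D.n)
      hD h.edge (.inl ⟨by simp [hyx.symm], not_L_n⟩)
    have h4 : join (Function.update (Function.update m x 0) y 0) (q j) x =
        Function.update (join m (q j) x) y 0 := by
      ext v
      simp only [join, Function.update_apply]
      split_ifs <;> omega
    rwa [h4] at h3
  · rw [matchedLeft_join hu hx, Finset.insert_eq_of_mem]
    exact mem_matchedLeft.2 ⟨hu, by omega⟩
  · have hiL := h.left i (by omega)
    -- The queue has no repetitions, so the earlier vertices of the chain keep their partners.
    have hne : q i ≠ q j := fun hij => by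
      have := h.inj i (by omega) j le_rfl hij
      omega
    rw [join_of_ne hne (hiL.ne_R hx)]
    exact h.origin i (by omega)

variable {h t v : ℕ} {mark' ptr' prv' : ℕ → ℕ} {S' : Finset ℕ}

theorem Bfs.t_le (hb : D.Bfs m p vis mark ptr prv q par S h t) : t ≤ D.n := by
  have := Finset.card_le_card_of_injOn (s := Finset.range t) (t := Finset.range D.n) q
    (fun i hi => by simpa using (hb.left i (by simpa using hi)).1)
    (fun i hi j hj => hb.inj i (by simpa using hi) j (by simpa using hj))
  simpa using this

theorem Bfs.chain (hb : D.Bfs m p vis mark ptr prv q par S h t) (hlt : h < t)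
    (hE : D.E (q h) x) (hv : vis x = 0) : D.Chain m (Function.update par x (q h)) q h x := by
  refine ⟨fun i hi => hb.left i (by omega), fun i hi k hk => hb.inj i (by omega) k (by omega),
    fun i hi => (hb.origin i (by omega)).imp_right ?_, by simp, hE⟩
  rintro ⟨w, h1, h2, k, h3, h4, h5⟩
  refine ⟨w, h1, k, h3, ?_, h5⟩
  rwa [Function.update_of_ne]
  rintro rfl
  exact h2 hv

theorem Bfs.scan (hb : D.Bfs m p vis mark ptr prv q par S h t) (hlt : h < t)
    (hs : D.Scanning p vis mark' ptr' prv' S' (q h) 0) (h1 : ∀ u, u ≠ q h → ptr' u = ptr u)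
    (h2 : ∀ u, u ≠ q h → prv' u = prv u) : D.Bfs m p vis mark' ptr' prv' q par S' h t :=
  { hb with
    scanning := fun _ => hs
    fresh := fun u hu hq => by
      have hne := (hq h le_rfl hlt).symm
      rw [h1 u hne, h2 u hne]
      exact hb.fresh u hu hq }

theorem Bfs.next (hb : D.Bfs m p vis mark ptr prv q par S h t) (hlt : h < t)
    (hex : ∀ w, D.E (q h) w → vis w ≠ 0) (hS : ∀ c ∈ S', c < D.n)
    (h1 : ∀ u, u ≠ q h → ptr' u = ptr u) (h2 : ∀ u, u ≠ q h → prv' u = prv u) :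
    D.Bfs m p vis mark' ptr' prv' q par S' (h + 1) t :=
  have hf : ∀ u, D.L u → (∀ i ≤ h, q i ≠ u) → ptr' u = 0 ∧ prv' u = D.n := fun u hu hq => by
    have hne := (hq h le_rfl).symm
    rw [h1 u hne, h2 u hne]
    exact hb.fresh u hu fun i hi _ => hq i hi
  { hb with
    le := hlt
    done := fun i hi => by
      rcases Nat.lt_succ_iff_lt_or_eq.1 hi with hi | rfl
      · exact hb.done i hi
      · exact hex
    scanning := fun hlt' => by
      have := hf _ (hb.left _ hlt') fun i hi heq => by
        have := hb.inj i (by omega) _ hlt' heq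
        omega
      exact Scanning.start hS this.1 this.2
    fresh := fun u hu hq => hf u hu fun i hi => hq i (by omega) (by omega) }

theorem Bfs.push (hD : D.Valid) (hb : D.Bfs m p vis mark ptr prv q par S h t) (hlt : h < t)
    (hE : D.E (q h) x) (hv : vis x = 0) (hx : m x = v + 1)
    (hs : D.Scanning p (Function.update vis x 1) mark' ptr' prv' S' (q h) 0)
    (h1 : ∀ u, u ≠ q h → ptr' u = ptr u) (h2 : ∀ u, u ≠ q h → prv' u = prv u) :
    D.Bfs m p (Function.update vis x 1) mark' ptr' prv' (Function.update q t v)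
      (Function.update par x (q h)) S' h (t + 1) := by
  obtain ⟨-, hEv, hmv⟩ := hb.matched.right (hD.right hE) hx
  have hvL := hD.left hEv
  have hvis : ∀ w, vis w ≠ 0 → Function.update vis x 1 w ≠ 0 := fun w hw => by
    rw [Function.update_apply]
    split_ifs
    · exact one_ne_zero
    · exact hw
  have hq : ∀ i < t, Function.update q t v i = q i := fun i hi =>
    Function.update_of_ne hi.ne _ _
  -- A matched vertex is in the queue only if its partner has been visited, but the partner `x` of
  -- `v` has not.
  have hqv : ∀ i < t, q i ≠ v := fun i hi hiv => by
    rcases hb.origin i hi with h0 | ⟨w, h3, h4, -⟩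
    · rw [hiv] at h0
      omega
    · rw [hiv, hmv] at h3
      obtain rfl : x = w := by omega
      exact h4 hv
  refine ⟨hb.matched, hb.price, by omega, ?_, ?_, ?_, ?_, ?_, ?_, ?_, ?_⟩
  · intro i hi
    rcases Nat.lt_succ_iff_lt_or_eq.1 hi with hi | rfl
    · rw [hq i hi]
      exact hb.left i hi
    · rwa [Function.update_self]
  · intro i hi k hk hik
    rcases Nat.lt_succ_iff_lt_or_eq.1 hi with hi | rfl <;>
      rcases Nat.lt_succ_iff_lt_or_eq.1 hk with hk | rfl
    · rw [hq i hi, hq k hk] at hik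
      exact hb.inj i hi k hk hik
    · rw [hq i hi, Function.update_self] at hik
      exact absurd hik (hqv i hi)
    · rw [hq k hk, Function.update_self] at hik
      exact absurd hik.symm (hqv k hk)
    · rfl
  · intro i hi
    rcases Nat.lt_succ_iff_lt_or_eq.1 hi with hi | rfl
    · rw [hq i hi]
      refine (hb.origin i hi).imp_right ?_
      rintro ⟨w, h3, h4, k, h5, h6, h7⟩
      refine ⟨w, h3, hvis w h4, k, h5, ?_, ?_⟩
      · rw [hq k (by omega), Function.update_of_ne, h6]
        rintro rfl
        exact h4 hv
      · rwa [hq k (by omega)]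
    · rw [Function.update_self]
      refine .inr ⟨x, hmv, by simp, h, hlt, ?_, ?_⟩
      · rw [Function.update_self, hq h hlt]
      · rwa [hq h hlt]
  · intro u hu hm
    obtain ⟨i, hi, hiu⟩ := hb.roots u hu hm
    exact ⟨i, by omega, by rw [hq i hi, hiu]⟩
  · intro w hw hw'
    by_cases hwx : w = x
    · subst hwx
      exact ⟨t, by omega, by rw [Function.update_self, hx]⟩
    · rw [Function.update_of_ne hwx] at hw'
      obtain ⟨i, hi, hiw⟩ := hb.visited w hw hw'
      exact ⟨i, by omega, by rw [hq i hi, hiw]⟩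
  · intro i hi w hw
    rw [hq i (by omega)] at hw
    exact hvis w (hb.done i hi w hw)
  · intro _
    rwa [hq h hlt]
  · intro u hu hqu
    have hqu' : ∀ i ≤ h, q i ≠ u := fun i hi => by
      have := hqu i hi (by omega)
      rwa [hq i (by omega)] at this
    have hne := (hqu' h le_rfl).symm
    rw [h1 u hne, h2 u hne]
    exact hb.fresh u hu fun i hi _ => hqu' i hi

/-- If the search ends without having found an unmatched right vertex, then the vertices reached
give a cover. -/
theorem Bfs.exists_cover (hD : D.Valid) (hb : D.Bfs m p vis mark ptr prv q par S t t) :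
    ∃ C, D.IsCover C ∧ C.card ≤ (D.matchedLeft m).card := by
  classical
  -- König's cover: the visited right vertices and the matched left vertices that were not reached.
  -- Partners of visited vertices were reached, so no matching edge contributes twice.
  let A := (D.rightBelow D.n).filter fun w => vis w ≠ 0
  let B := (D.matchedLeft m).filter fun u => ∀ i < t, q i ≠ u
  refine ⟨A ∪ B, fun u w hE => ?_, (Finset.card_union_le _ _).trans
    (hb.matched.card_add_card_le hD (fun w hw => ?_) (Finset.filter_subset _ _))⟩
  · have hw := hD.right hE
    by_cases hu : ∃ i < t, q i = u
    · obtain ⟨i, hi, rfl⟩ := hu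
      exact .inr (Finset.mem_union_left _ (Finset.mem_filter.2
        ⟨mem_rightBelow.2 ⟨hw.1, hw⟩, hb.done i hi w hE⟩))
    · refine .inl (Finset.mem_union_right _ (Finset.mem_filter.2 ⟨mem_matchedLeft.2
        ⟨hD.left hE, fun h0 => hu (hb.roots u (hD.left hE) h0)⟩, fun i hi hiu => hu ⟨i, hi, hiu⟩⟩))
  · simp only [A, Finset.mem_filter, mem_rightBelow] at hw
    obtain ⟨i, hi, hiw⟩ := hb.visited w hw.1.2 hw.2
    refine ⟨hw.1.2, by omega, fun hB => ?_⟩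
    exact (Finset.mem_filter.1 hB).2 i hi (by omega)

end Net

end BipartiteMatching

/-! ### Completing the matching by single augmentations -/

namespace BipartiteMatching

open WordRAM

/-- Put all unmatched left vertices into the queue. -/
def fillQueue : Cmd :=
  .assign 2 (.lit 0) ;; .assign 9 (.lit 0) ;; .assign 10 (.lit 0) ;; .assign 11 (.lit 0) ;;
  .assign 12 (.lit 0) ;;
  .loop (.lt (.var 12) (.var 0))
    (.ite (.and (.eq (.get 0 (.var 12)) (.lit 0)) (.eq (.get 3 (.var 12)) (.lit 0)))
        (.put 14 (.var 10) (.var 12) ;; .assign 10 (.add (.var 10) (.lit 1))) .skip ;;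
      .assign 12 (.add (.var 12) (.lit 1)))

/-- Treat the outcome of a scan step at the front of the queue. -/
def afterBfsScan : Cmd :=
  .ite (.not (.eq (.var 4) (.lit 0)))
    (.assign 3 (.sub (.var 4) (.lit 1)) ;; .put 11 (.var 3) (.lit 1) ;;
      .put 15 (.var 3) (.var 1) ;;
      .ite (.eq (.get 3 (.var 3)) (.lit 0)) (.assign 11 (.add (.var 3) (.lit 1)))
        (.put 14 (.var 10) (.sub (.get 3 (.var 3)) (.lit 1)) ;;
          .assign 10 (.add (.var 10) (.lit 1))))
    (.ite (.eq (.var 5) (.lit 0)) .skip (.assign 9 (.add (.var 9) (.lit 1))))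

/-- Search for an unmatched right vertex, until `var 11` is its successor. -/
def bfs : Cmd :=
  .loop (.and (.lt (.var 9) (.var 10)) (.eq (.var 11) (.lit 0)))
    (.assign 1 (.get 14 (.var 9)) ;; scan ;; afterBfsScan)

/-- Augment the matching along the path that ends at the predecessor of `var 11`. -/
def augment : Cmd :=
  .loop (.not (.eq (.var 11) (.lit 0)))
    (.assign 3 (.sub (.var 11) (.lit 1)) ;; .assign 1 (.get 15 (.var 3)) ;;
      .assign 11 (.get 3 (.var 1)) ;; .put 3 (.var 3) (.add (.var 1) (.lit 1)) ;;
      .put 3 (.var 1) (.add (.var 3) (.lit 1)))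

/-- What is known between two breadth-first searches. -/
structure Ready (D : Net) (s : State) : Prop where
  stored : D.Stored s
  mark : ∀ x u, D.L u → s.arr 13 x = u + 1 → ¬ D.E u x
  matched : D.Matched (s.arr 3) D.n

/-- Between two rounds the array is a matching except for the entry of the vertex in `var 11`, which
is overwritten next. The queue position of the parent decreases, which bounds the number of rounds.
-/
theorem augment_runs {D : Net} (hD : D.Valid) {N : ℕ} {s : State} (hs : Bdd N s)
    (hN : 2 * D.n + 2 < N) (hst : D.Stored s)
    (hmark : ∀ x u, D.L u → s.arr 13 x = u + 1 → ¬ D.E u x)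
    {j x : ℕ} (hj : j < D.n) (hx : s.var 11 = x + 1)
    (hm : D.Matched (Function.update (s.arr 3) x 0) D.n)
    (hc : D.Chain (s.arr 3) (s.arr 15) (s.arr 14) j x) :
    Runs N augment ((D.n + 1) * 40) s fun s' => Ready D s' ∧ s'.var 7 = s.var 7 ∧
      (D.matchedLeft (s'.arr 3)).card = (D.matchedLeft (s.arr 3)).card + 1 := by
  refine (Runs.loop_const (fun k s' => D.Stored s' ∧ s'.var 7 = s.var 7 ∧ s'.arr 13 = s.arr 13 ∧
    ((s'.var 11 = 0 ∧ D.Matched (s'.arr 3) D.n ∧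
      (D.matchedLeft (s'.arr 3)).card = (D.matchedLeft (s.arr 3)).card + 1) ∨
    ∃ j x, j + 1 = k ∧ s'.var 11 = x + 1 ∧ D.Matched (Function.update (s'.arr 3) x 0) D.n ∧
      D.Chain (s'.arr 3) (s'.arr 15) (s'.arr 14) j x ∧
      (D.matchedLeft (s'.arr 3)).card = (D.matchedLeft (s.arr 3)).card)) 25 (by decide) ?_ hs
      (k := j + 1) ⟨hst, rfl, rfl, .inr ⟨j, x, rfl, hx, hm, hc, rfl⟩⟩).mono ?_ ?_
  · rintro k s' hs' ⟨hst, h7, h13, hmode⟩ hb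
    simp only [Test.Holds, Expr.val] at hb
    obtain ⟨j, x, rfl, h11, hm, hc, hcard⟩ := hmode.resolve_left fun h => hb h.1
    have hu := hc.left j le_rfl
    have hun := hu.1
    have hxR := hD.right hc.edge
    have hxn := hxR.1
    have hux := hu.ne_R hxR
    refine (Runs.of_wp hs' (by decide) ?_).mono (by decide) fun _ _ => id
    simp [wp, Expr.Small, Expr.val, h11, hc.par]
    refine ⟨by omega, by omega, by omega, ?_⟩
    rcases Nat.eq_zero_or_pos (s'.arr 3 (s'.arr 14 j)) with h0 | h0
    · obtain ⟨h1, h2⟩ := hc.finish hD hm h0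
      refine ⟨0, ⟨⟨?_, ?_, ?_, ?_, ?_, ?_, ?_⟩, h7, h13, .inl ⟨h0, h1, h2.trans (by rw [hcard])⟩⟩,
        by omega⟩ <;>
      simp [hst.n, hst.side, hst.adj, hst.ext, hst.base, hst.len, hst.dense]
    · obtain ⟨y, hy⟩ := Nat.exists_eq_succ_of_ne_zero h0.ne'
      obtain ⟨h1, h2, k, hk, h3⟩ := hc.step hD hm hy
      refine ⟨k + 1, ⟨⟨?_, ?_, ?_, ?_, ?_, ?_, ?_⟩, h7, h13, .inr ⟨k, rfl, y, hy, h1, h3,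
        h2.trans hcard⟩⟩, by omega⟩ <;>
      simp [hst.n, hst.side, hst.adj, hst.ext, hst.base, hst.len, hst.dense]
  · simp [Test.cost, Expr.cost]
    omega
  · rintro s' - ⟨⟨k, hst, h7, h13, hmode⟩, hb⟩
    simp only [Test.Holds, Expr.val, not_not] at hb
    obtain ⟨-, h1, h2⟩ := hmode.resolve_right (by
      rintro ⟨j, x, -, h, -⟩
      omega)
    exact ⟨⟨hst, h13 ▸ hmark, h1⟩, h7, h2⟩

/-- The invariant of `bfs`. -/
structure Search (D : Net) (m : ℕ → ℕ) (S : Finset ℕ) (k : ℕ) (s : State) : Prop where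
  stored : D.Stored s
  mate : s.arr 3 = m
  level : s.var 2 = 0
  lists : D.Lists (s.arr 10) (s.arr 11) (s.arr 12) (s.arr 13) S
  mode :
    (s.var 11 = 0 ∧ D.Bfs m (s.arr 10) (s.arr 11) (s.arr 13) (s.arr 8) (s.arr 9) (s.arr 14)
        (s.arr 15) S (s.var 9) (s.var 10) ∧
      D.pot (s.arr 8) (s.arr 9) S + 2 * D.unvisited (s.arr 11) + (s.var 10 - s.var 9) ≤ k) ∨
    ∃ x, s.var 11 = x + 1 ∧ m x = 0 ∧ ∃ j < D.n, D.Chain m (s.arr 15) (s.arr 14) j x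

/-- An unvisited vertex again weighs two units: one for the step that visits it, one for the partner
that may join the queue. -/
theorem bfs_step_runs {D : Net} (hD : D.Valid) {N k : ℕ} {m : ℕ → ℕ} {s : State} {S : Finset ℕ}
    (hs : Bdd N s) (hN : 2 * D.n + 2 < N) (h : Search D m S k s) (h9 : s.var 9 < s.var 10)
    (h11 : s.var 11 = 0) :
    Runs N (.assign 1 (.get 14 (.var 9)) ;; scan ;; afterBfsScan) 200 s
      fun s' => ∃ k', (∃ S, Search D m S k' s') ∧ k' < k := by
  obtain ⟨-, hb, hk⟩ := h.mode.resolve_right (by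
    rintro ⟨x, hx, -⟩
    omega)
  have h1 : Runs N (.assign 1 (.get 14 (.var 9))) 3 s
      fun s' => s' = s.setVar 1 (s.arr 14 (s.var 9)) :=
    (Runs.of_wp hs (by decide) (by simp [wp, Expr.Small, Expr.val])).mono (by decide) fun _ _ => id
  refine (h1.seq (T' := 196) ?_).mono (by decide) fun _ _ => id
  rintro s1 hs1 rfl
  have hcur := hb.left _ h9
  have hscan := hb.scanning h9
  have hst1 : D.Stored (s.setVar 1 (s.arr 14 (s.var 9))) := by
    refine ⟨?_, ?_, ?_, ?_, ?_, ?_, ?_⟩ <;>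
      simp [h.stored.n, h.stored.side, h.stored.adj, h.stored.ext, h.stored.base, h.stored.len,
        h.stored.dense]
  refine ((scan_runs (S := S) hD hs1 (by omega) hst1 (by simpa using hcur) (by simp [h.level])
    (by simpa using h.lists) (by simpa [h.level] using hscan)).seq (T' := afterBfsScan.time)
      ?_).mono (by decide) fun _ _ => id
  rintro s' hs' ⟨S', hp⟩
  have arr : ∀ a, a ≠ 8 → a ≠ 9 → a ≠ 12 → a ≠ 13 → s'.arr a = s.arr a := hp.arr
  have var : ∀ x, x ≠ 1 → x ≠ 3 → x ≠ 4 → x ≠ 5 → x ≠ 13 → s'.var x = s.var x :=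
    fun x h1 h3 h4 h5 h13 => (hp.var x h3 h4 h5 h13).trans (by simp [h1])
  have a0 : s'.arr 0 = D.side := (arr 0 (by decide) (by decide) (by decide) (by decide)).trans
    h.stored.side
  have a2 : s'.arr 2 = D.adj := (arr 2 (by decide) (by decide) (by decide) (by decide)).trans
    h.stored.adj
  have a4 : s'.arr 4 = D.ext := (arr 4 (by decide) (by decide) (by decide) (by decide)).trans
    h.stored.ext
  have a5 : s'.arr 5 = D.base := (arr 5 (by decide) (by decide) (by decide) (by decide)).trans
    h.stored.base
  have a6 : s'.arr 6 = D.len := (arr 6 (by decide) (by decide) (by decide) (by decide)).trans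
    h.stored.len
  have a7 : s'.arr 7 = D.dense := (arr 7 (by decide) (by decide) (by decide)
    (by decide)).trans h.stored.dense
  have a3 := (arr 3 (by decide) (by decide) (by decide) (by decide)).trans h.mate
  have a10 := arr 10 (by decide) (by decide) (by decide) (by decide)
  have a11 := arr 11 (by decide) (by decide) (by decide) (by decide)
  have a14 := arr 14 (by decide) (by decide) (by decide) (by decide)
  have a15 := arr 15 (by decide) (by decide) (by decide) (by decide)
  have v0 := (var 0 (by decide) (by decide) (by decide) (by decide) (by decide)).trans h.stored.n
  have v1 : s'.var 1 = s.arr 14 (s.var 9) :=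
    (hp.var 1 (by decide) (by decide) (by decide) (by decide)).trans (by simp)
  have v2 := (var 2 (by decide) (by decide) (by decide) (by decide) (by decide)).trans h.level
  have v9 := var 9 (by decide) (by decide) (by decide) (by decide) (by decide)
  have v10 := var 10 (by decide) (by decide) (by decide) (by decide) (by decide)
  have v11 := (var 11 (by decide) (by decide) (by decide) (by decide) (by decide)).trans h11
  have hout := hp.outcome
  have hl := hp.lists
  have hptr := hp.ptr
  have hprv := hp.prv
  simp only [State.setVar_var, State.setVar_arr, if_true, h.level,
    show (2 : ℕ) ≠ 1 by decide, if_false] at hout hl hptr hprv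
  have hS' : ∀ c ∈ S', c < D.n := fun c hc => (hl.right c hc).1
  have htn := hb.t_le
  generalize s.var 9 = qh at *
  generalize s.var 10 = qt at *
  refine Runs.of_wp hs' (by decide) ?_
  rcases hout with ⟨c4, c5, hpot, hsc⟩ | ⟨x, c4, hE, hpx, hvx, hpot, hsc⟩ | ⟨c4, c5, hpot, hex⟩
  · simp [afterBfsScan, wp, Test.Holds, Expr.val, c4, c5]
    refine ⟨k - 1, ⟨S', ⟨v0, a0, a2, a4, a5, a6, a7⟩, a3, v2, by rwa [a10, a11],
      .inl ⟨v11, ?_, ?_⟩⟩, by omega⟩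
    · rw [a10, a11, a14, a15, v9, v10]
      exact hb.scan h9 hsc hptr hprv
    · rw [a11, v9, v10]
      omega
  · have hxR := hD.right hE
    have hxn := hxR.1
    have hunv := Net.unvisited_visit hxn hvx
    simp [afterBfsScan, wp, Expr.Small, Expr.val, Test.Holds, a3, v1, v10, c4]
    refine ⟨by omega, fun hm => ⟨by omega, k - 1, ⟨S', ?_⟩, by omega⟩,
      fun hm => ⟨by have := hs'.arr 3 x; rw [a3] at this; omega, by omega, k - 1,
        ⟨S', ?_⟩, by omega⟩⟩
    · refine ⟨⟨?_, ?_, ?_, ?_, ?_, ?_, ?_⟩, ?_, ?_, ?_, .inr ⟨x, ?_, hm, qh, by omega, ?_⟩⟩ <;>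
        simp [v0, a0, a2, a4, a5, a6, a7, v2, a10, a11, a3, a14, a15]
      · exact hl.visit x
      · exact hb.chain h9 hE hvx
    · obtain ⟨v, hv⟩ := Nat.exists_eq_succ_of_ne_zero hm
      have hpush := hb.push hD h9 hE hvx hv hsc hptr hprv
      refine ⟨⟨?_, ?_, ?_, ?_, ?_, ?_, ?_⟩, ?_, ?_, ?_, .inl ⟨?_, ?_, ?_⟩⟩ <;>
        simp [v0, a0, a2, a4, a5, a6, a7, v2, v9, v11, a10, a11, a3, a14, a15, hv]
      · exact hl.visit x
      · exact hpush
      · omega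
  · simp [afterBfsScan, wp, Expr.Small, Expr.val, Test.Holds, v9, c4, c5]
    refine ⟨by omega, k - 1, ⟨S', ?_⟩, by omega⟩
    refine ⟨⟨?_, ?_, ?_, ?_, ?_, ?_, ?_⟩, ?_, ?_, ?_, .inl ⟨?_, ?_, ?_⟩⟩ <;>
      simp [v0, a0, a2, a4, a5, a6, a7, v2, v10, v11, a10, a11, a3, a14, a15]
    · exact hl
    · exact hb.next h9 (fun w hw => hex w hw (hb.price w (hD.right hw))) hS' hptr hprv
    · omega

theorem bfs_runs {D : Net} (hD : D.Valid) {N k : ℕ} {m : ℕ → ℕ} {s : State} {S : Finset ℕ}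
    (hs : Bdd N s) (hN : 2 * D.n + 2 < N) (h : Search D m S k s) :
    Runs N bfs ((k + 1) * 220) s fun s' => ∃ S, ∃ k, Search D m S k s' ∧
      (s'.var 11 = 0 → ∃ C, D.IsCover C ∧ C.card ≤ (D.matchedLeft m).card) := by
  refine (Runs.loop_const (fun k s => ∃ S, Search D m S k s) 200 (by decide) ?_ hs
    (k := k) ⟨S, h⟩).mono ?_ ?_
  · rintro k s hs ⟨S, h⟩ hb
    simp only [Test.Holds, Expr.val] at hb
    exact bfs_step_runs hD hs hN h hb.1 hb.2
  · simp [Test.cost, Expr.cost]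
    omega
  · rintro s' - ⟨⟨k, S, h⟩, hb⟩
    refine ⟨S, k, h, fun h11 => ?_⟩
    obtain ⟨-, h1, -⟩ := h.mode.resolve_right (by
      rintro ⟨x, hx, -⟩
      omega)
    simp only [Test.Holds, Expr.val] at hb
    have hle := h1.le
    obtain he : s'.var 9 = s'.var 10 := by
      by_contra hne
      exact hb ⟨by omega, h11⟩
    rw [he] at h1
    exact h1.exists_cover hD

/-- The invariant of `fillQueue`. -/
structure Filling (D : Net) (s : State) (i : ℕ) (s' : State) : Prop where
  stored : D.Stored s'
  index : s'.var 12 = i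
  le : i ≤ D.n
  level : s'.var 2 = 0
  head : s'.var 9 = 0
  found : s'.var 11 = 0
  seven : s'.var 7 = s.var 7
  arr : ∀ a, a ≠ 14 → s'.arr a = s.arr a
  tail : s'.var 10 ≤ i
  lt : ∀ j < s'.var 10, s'.arr 14 j < i
  left : ∀ j < s'.var 10, D.L (s'.arr 14 j)
  free : ∀ j < s'.var 10, s.arr 3 (s'.arr 14 j) = 0
  inj : ∀ j < s'.var 10, ∀ k < s'.var 10, s'.arr 14 j = s'.arr 14 k → j = k
  roots : ∀ u < i, D.L u → s.arr 3 u = 0 → ∃ j < s'.var 10, s'.arr 14 j = u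

theorem fillQueue_runs {D : Net} {N : ℕ} {s : State} (hs : Bdd N s) (hN : 2 * D.n + 2 < N)
    (hst : D.Stored s) :
    Runs N fillQueue ((D.n + 1) * 50) s (Filling D s D.n) := by
  have h1 : ∀ {s : State} (_ : Bdd N s) (x : ℕ), Runs N (.assign x (.lit 0)) 2 s
      fun s' => s' = s.setVar x 0 := fun hs x =>
    (Runs.of_wp hs (by simp [Cmd.ok, Expr.ok]) (by simp [wp, Expr.Small, Expr.val])).mono
      (by simp [Cmd.time, Expr.cost]) fun _ _ => id
  refine ((h1 hs 2).seq (T' := 8 + (D.n * 40 + 10)) ?_).mono (by omega) fun _ _ => id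
  rintro s1 hs1 rfl
  refine ((h1 hs1 9).seq (T' := 6 + (D.n * 40 + 10)) ?_).mono (by omega) fun _ _ => id
  rintro s1 hs1 rfl
  refine ((h1 hs1 10).seq (T' := 4 + (D.n * 40 + 10)) ?_).mono (by omega) fun _ _ => id
  rintro s1 hs1 rfl
  refine ((h1 hs1 11).seq (T' := 2 + (D.n * 40 + 10)) ?_).mono (by omega) fun _ _ => id
  rintro s1 hs1 rfl
  refine ((h1 hs1 12).seq (T' := (D.n * 40 + 10)) ?_).mono (by omega) fun _ _ => id
  rintro s1 hs1 rfl
  refine (Runs.loop_const (fun k s' => Filling D s (s'.var 12) s' ∧ k = D.n - s'.var 12) 30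
    (by decide) ?_ hs1 (k := D.n) ⟨?_, by simp⟩).mono ?_ ?_
  · rintro k s' hs' ⟨h, rfl⟩ hb
    simp only [Test.Holds, Expr.val, h.stored.n] at hb
    have htail := h.tail
    refine (Runs.of_wp hs' (by decide) ?_).mono (by decide) fun _ _ => id
    simp [wp, Expr.Small, Expr.val, Test.Holds, h.stored.side, h.arr]
    refine ⟨fun h1 h2 => ⟨by omega, by omega, ?_, by omega⟩,
      fun h1 => ⟨by omega, ?_, by omega⟩⟩
    · refine ⟨⟨?_, ?_, ?_, ?_, ?_, ?_, ?_⟩, ?_, hb, ?_, ?_, ?_, ?_, ?_, ?_, ?_, ?_, ?_, ?_, ?_⟩ <;>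
        simp [h.stored.n, h.stored.side, h.stored.adj, h.stored.ext, h.stored.base, h.stored.len,
          h.stored.dense, h.level, h.head, h.found, h.seven]
      · intro a ha
        simp [ha, h.arr]
      · exact htail
      · intro j hj
        rw [Function.update_apply]
        split_ifs with hjt
        · omega
        · have := h.lt j (by omega)
          omega
      · intro j hj
        rw [Function.update_apply]
        split_ifs with hjt
        · exact ⟨hb, h1⟩
        · exact h.left j (by omega)
      · intro j hj
        rw [Function.update_apply]
        split_ifs with hjt
        · exact h2
        · exact h.free j (by omega)
      · intro j hj k hk
        simp only [Function.update_apply]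
        split_ifs with h3 h4 h4
        · omega
        · have := h.lt k (by omega)
          omega
        · have := h.lt j (by omega)
          omega
        · exact h.inj j (by omega) k (by omega)
      · intro u hu huL hu0
        by_cases hui : u = s'.var 12
        · exact ⟨s'.var 10, by omega, by simp [hui]⟩
        · obtain ⟨j, hj, hju⟩ := h.roots u (by omega) huL hu0
          refine ⟨j, by omega, ?_⟩
          rw [Function.update_of_ne hj.ne, hju]
    · refine ⟨⟨?_, ?_, ?_, ?_, ?_, ?_, ?_⟩, ?_, hb, ?_, ?_, ?_, ?_, ?_, ?_, ?_, ?_, ?_, ?_, ?_⟩ <;>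
        simp [h.stored.n, h.stored.side, h.stored.adj, h.stored.ext, h.stored.base, h.stored.len,
          h.stored.dense, h.level, h.head, h.found, h.seven]
      · intro a ha
        simp [ha, h.arr]
      · omega
      · intro j hj
        have := h.lt j hj
        omega
      · exact h.left
      · exact h.free
      · exact h.inj
      · intro u hu huL hu0
        have hui : u ≠ s'.var 12 := by
          rintro rfl
          exact h1 huL.2 hu0
        exact h.roots u (by omega) huL hu0
  · refine ⟨⟨?_, ?_, ?_, ?_, ?_, ?_, ?_⟩, ?_, ?_, ?_, ?_, ?_, ?_, ?_, ?_, ?_, ?_, ?_, ?_, ?_⟩ <;>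
      simp [hst.n, hst.side, hst.adj, hst.ext, hst.base, hst.len, hst.dense]
  · simp [Test.cost, Expr.cost]
    omega
  · rintro s' - ⟨⟨k, h, -⟩, hb⟩
    simp only [Test.Holds, Expr.val, h.stored.n] at hb
    have hle := h.le
    have hi : s'.var 12 = D.n := by omega
    exact hi ▸ h

/-- One breadth-first search with its augmentation; `var 7` tells whether there was one. -/
def round : Cmd :=
  build (.lit 0) ;; fillQueue ;; bfs ;; .assign 7 (.var 11) ;; augment

/-- With all prices reset to `0`, scans at the single price `0` explore the whole graph, so `scan`
serves both kinds of search. -/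
theorem round_runs {D : Net} (hD : D.Valid) {N : ℕ} {s : State} (hs : Bdd N s)
    (hN : 2 * D.n + 2 < N) (h : Ready D s) :
    Runs N round ((D.size + D.n + 1) * 2000) s fun s' => Ready D s' ∧
      (s'.var 7 ≠ 0 ∧
        (D.matchedLeft (s'.arr 3)).card = (D.matchedLeft (s.arr 3)).card + 1 ∨
      s'.var 7 = 0 ∧ ∃ C, D.IsCover C ∧ C.card ≤ (D.matchedLeft (s'.arr 3)).card) := by
  have hb := build_runs (e := .lit 0) (p := fun _ => 0) (by decide) hs hN h.stored
    (fun w hw => by omega) h.mark (fun s' h1 h2 _ => rfl)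
  refine (hb.seq (T' := (D.n + 1) * 50 + ((2 * D.size + 4 * D.n + 1) * 220 +
    (2 + (D.n + 1) * 40 + 2))) ?_).mono ?_ fun _ _ => id
  swap
  · simp [Expr.cost]
    ring_nf
    omega
  intro s1 hs1 h1
  have a3 := h1.arr 3 (by decide)
  refine (fillQueue_runs hs1 hN h1.stored).seq ?_
  intro s2 hs2 h2
  have hse : Search D (s.arr 3) (D.rightBelow D.n) (2 * D.size + 4 * D.n) s2 := by
    refine ⟨h2.stored, (h2.arr 3 (by decide)).trans a3, h2.level, ?_, .inl ⟨h2.found, ?_, ?_⟩⟩ <;>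
      simp only [h2.arr 10 (by decide), h2.arr 11 (by decide), h2.arr 12 (by decide),
        h2.arr 13 (by decide), h2.arr 8 (by decide), h2.arr 9 (by decide), h2.head]
    · exact h1.lists
    · refine ⟨h.matched, h1.price, Nat.zero_le _, h2.left, h2.inj, fun i hi => .inl ?_, ?_, ?_,
        fun i hi => absurd hi (Nat.not_lt_zero i), fun hlt => ?_, fun u hu _ =>
          ⟨h1.ptr u hu.1, h1.prv u hu.1⟩⟩
      · rw [← a3]
        exact h2.free i hi
      · intro u hu hm
        exact h2.roots u hu.1 hu (by rw [a3, hm])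
      · intro w hw hv
        exact absurd (h1.vis w hw) hv
      · have hu := h2.left _ hlt
        exact Net.Scanning.start (fun c hc => (Net.mem_rightBelow.1 hc).1) (h1.ptr _ hu.1)
          (h1.prv _ hu.1)
    · have := Net.pot_rightBelow_le (D := D) (ptr := s1.arr 8) (prv := s1.arr 9)
      have := Net.unvisited_le (D := D) (vis := s1.arr 11)
      have := h2.tail
      omega
  refine ((bfs_runs hD hs2 hN hse).seq (T' := (2 + (D.n + 1) * 40 + 2)) ?_)
  rintro s3 hs3 ⟨S, k, h3, h3'⟩
  have hflag : Runs N (.assign 7 (.var 11)) 2 s3 fun s' => s' = s3.setVar 7 (s3.var 11) :=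
    (Runs.of_wp hs3 (by decide) (by simp [wp, Expr.Small, Expr.val])).mono (by decide) fun _ _ => id
  refine (hflag.seq (T' := (D.n + 1) * 40) ?_).mono (by omega) fun _ _ => id
  rintro s4 hs4 rfl
  have hst : D.Stored (s3.setVar 7 (s3.var 11)) := by
    refine ⟨?_, ?_, ?_, ?_, ?_, ?_, ?_⟩ <;>
      simp [h3.stored.n, h3.stored.side, h3.stored.adj, h3.stored.ext, h3.stored.base,
        h3.stored.len, h3.stored.dense]
  rcases Nat.eq_zero_or_pos (s3.var 11) with h0 | h0
  -- After a failed search the loop of `augment` is not entered, so the memory itself serves as the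
  -- invariant.
  · have := Runs.loop_const (N := N) (fun k s' => s' = s3.setVar 7 (s3.var 11)) 0
      (b := .not (.eq (.var 11) (.lit 0)))
      (p := .assign 3 (.sub (.var 11) (.lit 1)) ;; .assign 1 (.get 15 (.var 3)) ;;
        .assign 11 (.get 3 (.var 1)) ;; .put 3 (.var 3) (.add (.var 1) (.lit 1)) ;;
        .put 3 (.var 1) (.add (.var 3) (.lit 1))) (by decide) (by
          rintro k s' - rfl hb
          simp [Test.Holds, Expr.val, h0] at hb) hs4 (k := 0) rfl
    refine this.mono ?_ ?_
    · simp [Test.cost, Expr.cost]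
      omega
    · rintro s' - ⟨⟨-, rfl⟩, -⟩
      refine ⟨⟨hst, h3.lists.mark, ?_⟩, .inr ⟨by simp [h0], ?_⟩⟩
      · simpa [h3.mate] using h.matched
      · simpa [h3.mate] using h3' h0
  · obtain ⟨x, h4, h5, j, hj, h6⟩ := h3.mode.resolve_left fun h' => by omega
    refine (augment_runs hD hs4 hN hst h3.lists.mark (j := j) (x := x) hj (by simpa using h4)
      ?_ ?_).mono le_rfl ?_
    · simpa [h3.mate, ← h5] using h.matched
    · simpa [h3.mate] using h6
    · rintro s' - ⟨h7, h8, h9⟩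
      refine ⟨h7, .inl ⟨?_, ?_⟩⟩
      · rw [h8]
        simp
        omega
      · rw [h9]
        simp [h3.mate]

/-- Breadth-first searches until there is no augmenting path. -/
def rounds : Cmd := .assign 7 (.lit 1) ;; .loop (.not (.eq (.var 7) (.lit 0))) round

/-- Every successful search enlarges the matching, which never outgrows the cover `C`; so there are
at most `d` of them, and one that fails. -/
theorem rounds_runs {D : Net} (hD : D.Valid) {N d : ℕ} {s : State} (hs : Bdd N s)
    (hN : 2 * D.n + 2 < N) (h : Ready D s) {C : Finset ℕ} (hC : D.IsCover C)
    (hd : C.card ≤ (D.matchedLeft (s.arr 3)).card + d) :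
    Runs N rounds ((d + 2) * ((D.size + D.n + 1) * 2010)) s fun s' => Ready D s' ∧
      ∃ C, D.IsCover C ∧ C.card ≤ (D.matchedLeft (s'.arr 3)).card := by
  have h1 : Runs N (.assign 7 (.lit 1)) 2 s fun s' => s' = s.setVar 7 1 :=
    (Runs.of_wp hs (by decide) (by simp [wp, Expr.Small, Expr.val])).mono (by decide) fun _ _ => id
  refine (h1.seq (T' := (d + 1) * ((D.size + D.n + 1) * 2010) + 10) ?_).mono ?_ fun _ _ => id
  swap
  · nlinarith
  rintro s1 hs1 rfl
  refine (Runs.loop_const (fun k s' => Ready D s' ∧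
    (s'.var 7 ≠ 0 ∧ C.card + 1 - (D.matchedLeft (s'.arr 3)).card ≤ k ∨
      s'.var 7 = 0 ∧ ∃ C, D.IsCover C ∧ C.card ≤ (D.matchedLeft (s'.arr 3)).card))
    ((D.size + D.n + 1) * 2000) (by decide) ?_ hs1 (k := d + 1) ⟨⟨?_, ?_, ?_⟩, .inl ?_⟩).mono ?_ ?_
  · rintro k s' hs' ⟨h, hmode⟩ hb
    simp only [Test.Holds, Expr.val] at hb
    obtain ⟨-, hk⟩ := hmode.resolve_right fun h' => hb h'.1
    have hle := h.matched.card_le hD hC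
    refine (round_runs hD hs' hN h).mono le_rfl ?_
    rintro s'' - ⟨h2, ⟨h3, h4⟩ | ⟨h3, h4⟩⟩
    · exact ⟨k - 1, ⟨h2, .inl ⟨h3, by omega⟩⟩, by omega⟩
    · exact ⟨k - 1, ⟨h2, .inr ⟨h3, h4⟩⟩, by omega⟩
  · refine ⟨?_, ?_, ?_, ?_, ?_, ?_, ?_⟩ <;>
      simp [h.stored.n, h.stored.side, h.stored.adj, h.stored.ext, h.stored.base, h.stored.len,
        h.stored.dense]
  · exact h.mark
  · exact h.matched
  · simp
    omega
  · simp [Test.cost, Expr.cost]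
    nlinarith
  · rintro s' - ⟨⟨k, h2, hmode⟩, hb⟩
    simp only [Test.Holds, Expr.val, not_not] at hb
    exact ⟨h2, (hmode.resolve_left fun h' => h'.1 hb).2⟩

end BipartiteMatching

namespace BipartiteMatching

open WordRAM

/-! ### Preparing the lists -/

namespace Net

variable {D : Net} {u : ℕ}

open Classical in
variable (D) in
/-- The number of neighbours of a left vertex. -/
noncomputable def deg (u : ℕ) : ℕ := ((D.rightBelow D.n).filter (D.E u)).card

open Classical in
variable (D) in
/-- The number of right vertices that are not neighbours of a left vertex. -/
noncomputable def codeg (u : ℕ) : ℕ := ((D.rightBelow D.n).filter fun w => ¬ D.E u w).card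

theorem deg_add_codeg : D.deg u + D.codeg u = (D.rightBelow D.n).card := by
  classical
  exact Finset.card_filter_add_card_filter_not _

variable (D) in
/-- The neighbours of each left vertex `u` are listed in `D.adj` from `off u` to `off (u + 1)`. -/
structure AdjacencyLists (off : ℕ → ℕ) : Prop where
  left : ∀ {u w}, D.E u w → D.L u
  right : ∀ {u w}, D.E u w → D.R w
  mono : ∀ u v, u ≤ v → v ≤ D.n → off u ≤ off v
  mem : ∀ u, D.L u → ∀ w, D.E u w ↔ ∃ i, off u ≤ i ∧ i < off (u + 1) ∧ D.adj i = w
  inj : ∀ u, D.L u → ∀ i j, off u ≤ i → i < off (u + 1) → off u ≤ j → j < off (u + 1) →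
    D.adj i = D.adj j → i = j

theorem AdjacencyLists.deg {off : ℕ → ℕ} (h : D.AdjacencyLists off) (hu : D.L u) :
    off (u + 1) - off u = D.deg u := by
  classical
  rw [← Nat.card_Ico, Net.deg]
  refine Finset.card_bij (fun i _ => D.adj i) ?_ ?_ ?_
  · intro i hi
    rw [Finset.mem_Ico] at hi
    have hE := (h.mem u hu _).2 ⟨i, hi.1, hi.2, rfl⟩
    exact Finset.mem_filter.2 ⟨mem_rightBelow.2 ⟨(h.right hE).1, h.right hE⟩, hE⟩
  · intro i hi j hj hij
    rw [Finset.mem_Ico] at hi hj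
    exact h.inj u hu i j hi.1 hi.2 hj.1 hj.2 hij
  · intro w hw
    obtain ⟨i, h1, h2, h3⟩ := (h.mem u hu w).1 (Finset.mem_filter.1 hw).2
    exact ⟨i, Finset.mem_Ico.2 ⟨h1, h2⟩, h3⟩

/-- The list of the vertex `u` is correct. -/
structure Prepared (D : Net) (pos u : ℕ) : Prop where
  sparse : D.dense u = 0 → ∀ w, D.E u w ↔ ∃ i < D.len u, D.adj (D.base u + i) = w
  right : D.dense u ≠ 0 → ∀ i < D.len u, D.R (D.ext (D.base u + i))
  not_adj : D.dense u ≠ 0 → ∀ i < D.len u, ¬ D.E u (D.ext (D.base u + i))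
  cover : D.dense u ≠ 0 → ∀ w, D.R w → ¬ D.E u w → ∃ i < D.len u, D.ext (D.base u + i) = w
  lt : D.dense u ≠ 0 → D.base u + D.len u ≤ pos
  len_le_deg : D.len u ≤ D.deg u
  len_le_codeg : D.len u ≤ D.codeg u

end Net

/-- Collect the right vertices in the array `16`. -/
def listRight : Cmd :=
  .loop (.lt (.var 12) (.var 0))
    (.ite (.eq (.get 0 (.var 12)) (.lit 1))
        (.put 16 (.var 14) (.var 12) ;; .assign 14 (.add (.var 14) (.lit 1))) .skip ;;
      .assign 12 (.add (.var 12) (.lit 1)))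

/-- The array `rl` lists the right vertices below `i`. -/
structure Listed (D : Net) (rl : ℕ → ℕ) (i b : ℕ) : Prop where
  mem : ∀ j < b, D.R (rl j) ∧ rl j < i
  inj : ∀ j < b, ∀ k < b, rl j = rl k → j = k
  surj : ∀ w < i, D.R w → ∃ j < b, rl j = w

theorem Listed.card {D : Net} {rl : ℕ → ℕ} {i b : ℕ} (h : Listed D rl i b) :
    b = (D.rightBelow i).card := by
  rw [← Finset.card_range b]
  refine Finset.card_bij (fun j _ => rl j) ?_ ?_ ?_
  · intro j hj
    obtain ⟨h1, h2⟩ := h.mem j (Finset.mem_range.1 hj)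
    exact Net.mem_rightBelow.2 ⟨h2, h1⟩
  · intro j hj k hk
    exact h.inj j (Finset.mem_range.1 hj) k (Finset.mem_range.1 hk)
  · intro w hw
    obtain ⟨h1, h2⟩ := Net.mem_rightBelow.1 hw
    obtain ⟨j, hj, hjw⟩ := h.surj w h1 h2
    exact ⟨j, Finset.mem_range.2 hj, hjw⟩

theorem listRight_runs {D : Net} {N : ℕ} {s : State} (hs : Bdd N s) (hN : D.n + 2 < N)
    (h0 : s.var 0 = D.n) (hside : s.arr 0 = D.side) (h12 : s.var 12 = 0) (h14 : s.var 14 = 0) :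
    Runs N listRight ((D.n + 1) * 40) s fun s' => Listed D (s'.arr 16) D.n (s'.var 14) ∧
      (∀ x, x ≠ 12 → x ≠ 14 → s'.var x = s.var x) ∧ ∀ a, a ≠ 16 → s'.arr a = s.arr a := by
  refine (Runs.loop_const (fun k s' => Listed D (s'.arr 16) (s'.var 12) (s'.var 14) ∧
    (∀ x, x ≠ 12 → x ≠ 14 → s'.var x = s.var x) ∧ (∀ a, a ≠ 16 → s'.arr a = s.arr a) ∧
    s'.var 12 ≤ D.n ∧ s'.var 14 ≤ s'.var 12 ∧ k = D.n - s'.var 12) 30 (by decide) ?_ hs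
    (k := D.n) ⟨⟨?_, ?_, ?_⟩, fun _ _ _ => rfl, fun _ _ => rfl, by omega, by omega,
      by omega⟩).mono ?_ ?_
  · rintro k s' hs' ⟨h, hvar, harr, hle, hle', rfl⟩ hb
    simp only [Test.Holds, Expr.val, hvar 0 (by decide) (by decide), h0] at hb
    refine (Runs.of_wp hs' (by decide) ?_).mono (by decide) fun _ _ => id
    simp [wp, Expr.Small, Expr.val, Test.Holds, harr, hside]
    refine ⟨fun h1 => ⟨by omega, by omega, ⟨?_, ?_, ?_, by omega, by omega⟩, by omega⟩,
      fun h1 => ⟨by omega, ⟨?_, ?_, ?_, by omega, by omega⟩, by omega⟩⟩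
    · constructor
      · intro j hj
        rw [Function.update_apply]
        split_ifs with hjt
        · exact ⟨⟨hb, h1⟩, by omega⟩
        · have := h.mem j (by omega)
          exact ⟨this.1, by omega⟩
      · intro j hj k hk
        simp only [Function.update_apply]
        split_ifs with h3 h4 h4
        · omega
        · have := (h.mem k (by omega)).2
          omega
        · have := (h.mem j (by omega)).2
          omega
        · exact h.inj j (by omega) k (by omega)
      · intro w hw hwR
        by_cases hwi : w = s'.var 12
        · exact ⟨s'.var 14, by omega, by simp [hwi]⟩
        · obtain ⟨j, hj, hjw⟩ := h.surj w (by omega) hwR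
          refine ⟨j, by omega, ?_⟩
          rw [Function.update_of_ne hj.ne, hjw]
    · intro x h3 h4
      simp [h3, h4, hvar]
    · intro a ha
      simp [ha, harr]
    · refine ⟨fun j hj => ⟨(h.mem j hj).1, by have := (h.mem j hj).2; omega⟩, h.inj,
        fun w hw hwR => ?_⟩
      have : w ≠ s'.var 12 := by
        rintro rfl
        exact h1 hwR.2
      exact h.surj w (by omega) hwR
    · intro x h3 h4
      simp [h3, hvar, h4]
    · intro a ha
      simp [ha, harr]
  · intro j hj
    omega
  · intro j hj
    omega
  · intro w hw
    omega
  · simp [Test.cost, Expr.cost]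
    omega
  · rintro s' - ⟨⟨k, h, hvar, harr, hle, -, -⟩, hb⟩
    simp only [Test.Holds, Expr.val, hvar 0 (by decide) (by decide), h0] at hb
    have hi : s'.var 12 = D.n := by omega
    exact ⟨hi ▸ h, hvar, harr⟩

/-- Mark the neighbours of `var 1` in the array `17`. -/
def tagNeighbours : Cmd :=
  .assign 17 (.get 1 (.var 1)) ;;
  .loop (.lt (.var 17) (.get 1 (.add (.var 1) (.lit 1))))
    (.put 17 (.get 2 (.var 17)) (.add (.var 1) (.lit 1)) ;; .assign 17 (.add (.var 17) (.lit 1)))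

/-- Vertices are treated in increasing order: the tag `u + 1` exceeds all older ones, and the array
need not be cleared. -/
theorem tagNeighbours_runs {D : Net} {N u : ℕ} {s : State} (hs : Bdd N s)
    (hD : D.AdjacencyLists (s.arr 1)) (hN : D.n + 2 < N) (hadj : s.arr 2 = D.adj)
    (h1 : s.var 1 = u) (hu : D.L u) (htag : ∀ x, s.arr 17 x ≤ u) :
    Runs N tagNeighbours ((D.deg u + 1) * 40) s fun s' =>
      (∀ x, x ≠ 17 → s'.var x = s.var x) ∧ (∀ a, a ≠ 17 → s'.arr a = s.arr a) ∧
      (∀ x, s'.arr 17 x ≤ u + 1) ∧ ∀ x, s'.arr 17 x = u + 1 ↔ D.E u x := by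
  have hun := hu.1
  have hmono := hD.mono u (u + 1) (by omega) hun
  have hdeg := hD.deg hu
  have hbound := hs.arr 1 (u + 1)
  have h2 : Runs N (.assign 17 (.get 1 (.var 1))) 3 s fun s' => s' = s.setVar 17 (s.arr 1 u) :=
    (Runs.of_wp hs (by decide) (by simp [wp, Expr.Small, Expr.val, h1])).mono (by decide)
      fun _ _ => id
  refine (h2.seq (T' := D.deg u * 30 + 10) ?_).mono (by omega) fun _ _ => id
  rintro s1 hs1 rfl
  refine (Runs.loop_const (fun k s' => (∀ x, x ≠ 17 → s'.var x = s.var x) ∧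
    (∀ a, a ≠ 17 → s'.arr a = s.arr a) ∧ s.arr 1 u ≤ s'.var 17 ∧ s'.var 17 ≤ s.arr 1 (u + 1) ∧
    k = s.arr 1 (u + 1) - s'.var 17 ∧
    (∀ x, s'.arr 17 x ≤ u + 1) ∧ ∀ x, s'.arr 17 x = u + 1 ↔
      ∃ i, s.arr 1 u ≤ i ∧ i < s'.var 17 ∧ D.adj i = x) 15 (by decide) ?_ hs1
    (k := D.deg u) ⟨?_, ?_, ?_, ?_, ?_, ?_, ?_⟩).mono ?_ ?_
  · rintro k s' hs' ⟨hvar, harr, hle, hle', rfl, htag1, htag2⟩ hb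
    simp only [Test.Holds, Expr.val, hvar 1 (by decide), h1, harr 1 (by decide)] at hb
    refine (Runs.of_wp hs' (by decide) ?_).mono (by decide) fun _ _ => id
    simp [wp, Expr.Small, Expr.val, harr, hvar, h1, hadj]
    refine ⟨by omega, by omega, ⟨?_, ?_, by omega, by omega, ?_, ?_⟩, by omega⟩
    · intro x hx
      simp [hx, hvar]
    · intro a ha
      simp [ha, harr]
    · intro x
      rw [Function.update_apply]
      split_ifs
      · exact le_rfl
      · exact htag1 x
    · intro x
      rw [Function.update_apply]
      split_ifs with hx
      · simp only [true_iff]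
        exact ⟨s'.var 17, hle, by omega, hx.symm⟩
      · rw [htag2]
        constructor
        · rintro ⟨i, h3, h4, h5⟩
          exact ⟨i, h3, by omega, h5⟩
        · rintro ⟨i, h3, h4, h5⟩
          refine ⟨i, h3, ?_, h5⟩
          rcases Nat.lt_or_ge i (s'.var 17) with h6 | h6
          · exact h6
          · obtain rfl : i = s'.var 17 := by omega
            exact absurd h5.symm hx
  · intro x hx
    simp [hx]
  · intro a ha
    simp
  · simp
  · simpa using hmono
  · simpa using hdeg.symm
  · intro x
    have := htag x
    simp
    omega
  · intro x
    have := htag x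
    simp
    constructor
    · intro h
      omega
    · rintro ⟨i, h3, h4, -⟩
      omega
  · simp [Test.cost, Expr.cost]
    omega
  · rintro s' - ⟨⟨k, hvar, harr, hle, hle', -, htag1, htag2⟩, hb⟩
    simp only [Test.Holds, Expr.val, hvar 1 (by decide), h1, harr 1 (by decide)] at hb
    refine ⟨hvar, harr, htag1, fun x => ?_⟩
    rw [htag2, hD.mem u hu, show s'.var 17 = s.arr 1 (u + 1) by omega]

/-- Append the right vertices without mark to the array `4`. -/
def collect : Cmd :=
  .assign 17 (.lit 0) ;;
  .loop (.lt (.var 17) (.var 14))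
    (.assign 3 (.get 16 (.var 17)) ;;
      .ite (.eq (.get 17 (.var 3)) (.add (.var 1) (.lit 1))) .skip
        (.put 4 (.var 15) (.var 3) ;; .assign 15 (.add (.var 15) (.lit 1))) ;;
      .assign 17 (.add (.var 17) (.lit 1)))

open Classical in
theorem collect_runs {D : Net} {N u : ℕ} {s : State} (hs : Bdd N s)
    (hN : s.var 15 + D.codeg u < N) (h1 : s.var 1 = u)
    (hrl : Listed D (s.arr 16) D.n (s.var 14)) (htag : ∀ x, s.arr 17 x = u + 1 ↔ D.E u x) :
    Runs N collect ((s.var 14 + 1) * 50) s fun s' =>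
      (∀ x, x ≠ 3 → x ≠ 15 → x ≠ 17 → s'.var x = s.var x) ∧
      (∀ a, a ≠ 4 → s'.arr a = s.arr a) ∧ (∀ x < s.var 15, s'.arr 4 x = s.arr 4 x) ∧
      s'.var 15 = s.var 15 + D.codeg u ∧
      (∀ i < D.codeg u, D.R (s'.arr 4 (s.var 15 + i)) ∧ ¬ D.E u (s'.arr 4 (s.var 15 + i))) ∧
      ∀ w, D.R w → ¬ D.E u w → ∃ i < D.codeg u, s'.arr 4 (s.var 15 + i) = w := by
  -- Bounds for the intermediate counts keep the write position within a word.
  have hcount : ∀ j ≤ s.var 14,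
      ((Finset.range j).filter fun j => ¬ D.E u (s.arr 16 j)).card ≤ D.codeg u := fun j hj => by
    refine Finset.card_le_card_of_injOn (s.arr 16) (fun i hi => ?_) (fun i hi k hk => ?_)
    · simp only [Finset.coe_filter, Finset.mem_range, Set.mem_ofPred_eq] at hi
      obtain ⟨h2, h3⟩ := hrl.mem i (by omega)
      simp only [Finset.coe_filter, Set.mem_ofPred_eq, Net.mem_rightBelow]
      exact ⟨⟨h3, h2⟩, hi.2⟩
    · simp only [Finset.coe_filter, Finset.mem_range, Set.mem_ofPred_eq] at hi hk
      exact hrl.inj i (by omega) k (by omega)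
  have hcount' : ((Finset.range (s.var 14)).filter fun j => ¬ D.E u (s.arr 16 j)).card =
      D.codeg u := by
    refine (hcount _ le_rfl).antisymm (Finset.card_le_card_of_surjOn (s.arr 16) fun w hw => ?_)
    simp only [Finset.coe_filter, Set.mem_ofPred_eq, Net.mem_rightBelow] at hw
    obtain ⟨j, hj, rfl⟩ := hrl.surj w hw.1.1 hw.1.2
    exact ⟨j, by simpa using ⟨hj, hw.2⟩, rfl⟩
  have h2 : Runs N (.assign 17 (.lit 0)) 2 s fun s' => s' = s.setVar 17 0 :=
    (Runs.of_wp hs (by decide) (by simp [wp, Expr.Small, Expr.val])).mono (by decide)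
      fun _ _ => id
  refine (h2.seq (T' := s.var 14 * 50 + 10) ?_).mono (by omega) fun _ _ => id
  rintro s1 hs1 rfl
  refine (Runs.loop_const (fun k s' => (∀ x, x ≠ 3 → x ≠ 15 → x ≠ 17 → s'.var x = s.var x) ∧
    (∀ a, a ≠ 4 → s'.arr a = s.arr a) ∧ (∀ x < s.var 15, s'.arr 4 x = s.arr 4 x) ∧
    s'.var 17 ≤ s.var 14 ∧ k = s.var 14 - s'.var 17 ∧
    s'.var 15 = s.var 15 + ((Finset.range (s'.var 17)).filter fun j =>
      ¬ D.E u (s.arr 16 j)).card ∧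
    (∀ x, s.var 15 ≤ x → x < s'.var 15 → D.R (s'.arr 4 x) ∧ ¬ D.E u (s'.arr 4 x)) ∧
    ∀ j < s'.var 17, ¬ D.E u (s.arr 16 j) → ∃ x, s.var 15 ≤ x ∧ x < s'.var 15 ∧
      s'.arr 4 x = s.arr 16 j) 40 (by decide) ?_ hs1 (k := s.var 14)
      ⟨?_, ?_, ?_, ?_, ?_, ?_, ?_, ?_⟩).mono ?_ ?_
  · rintro k s' hs' ⟨hvar, harr, hext, hle, rfl, hpos, hR, hsurj⟩ hb
    simp only [Test.Holds, Expr.val, hvar 14 (by decide) (by decide) (by decide)] at hb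
    have hc1 := hcount (s'.var 17) hle
    have hc2 := hcount (s'.var 17 + 1) hb
    have hbd := hs.var 14
    refine (Runs.of_wp hs' (by decide) ?_).mono (by decide) fun _ _ => id
    simp [wp, Expr.Small, Expr.val, Test.Holds, harr, hvar, h1, htag]
    refine ⟨fun hE => ⟨by omega, ⟨?_, ?_, hext, by omega, ?_, hR, ?_⟩, by omega⟩,
      fun hE => ?_⟩
    · intro x h3 h4 h5
      simp [h3, h4, h5, hvar]
    · intro a ha
      simp [ha, harr]
    · rw [hpos, Finset.range_add_one, Finset.filter_insert, if_neg (by simpa using hE)]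
    · intro j hj hjE
      have : j ≠ s'.var 17 := by
        rintro rfl
        exact hjE hE
      exact hsurj j (by omega) hjE
    · have hins : ((Finset.range (s'.var 17 + 1)).filter fun j => ¬ D.E u (s.arr 16 j)).card =
          ((Finset.range (s'.var 17)).filter fun j => ¬ D.E u (s.arr 16 j)).card + 1 := by
        rw [Finset.range_add_one, Finset.filter_insert, if_pos (by simpa using hE),
          Finset.card_insert_of_notMem (by simp)]
      refine ⟨by omega, by omega, ⟨?_, ?_, ?_, by omega, by omega, ?_, ?_⟩, by omega⟩
      · intro x h3 h4 h5
        simp [h3, h4, h5, hvar]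
      · intro a ha
        simp [ha, harr]
      · intro x hx
        rw [Function.update_of_ne (by omega)]
        exact hext x hx
      · intro x hx hx'
        rw [Function.update_apply]
        split_ifs with hxp
        · exact ⟨(hrl.mem _ hb).1, hE⟩
        · exact hR x hx (by omega)
      · intro j hj hjE
        by_cases hji : j = s'.var 17
        · exact ⟨s'.var 15, by omega, by omega, by simp [hji]⟩
        · obtain ⟨x, h3, h4, h5⟩ := hsurj j (by omega) hjE
          refine ⟨x, h3, by omega, ?_⟩
          rw [Function.update_of_ne h4.ne, h5]
  · intro x h3 h4 h5
    simp [h5]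
  · intro a ha
    simp
  · intro x hx
    simp
  · simp
  · simp
  · simp
  · intro x hx hx'
    simp at hx'
    omega
  · simp
  · simp [Test.cost, Expr.cost]
    omega
  · rintro s' - ⟨⟨k, hvar, harr, hext, hle, -, hpos, hR, hsurj⟩, hb⟩
    simp only [Test.Holds, Expr.val, hvar 14 (by decide) (by decide) (by decide)] at hb
    rw [show s'.var 17 = s.var 14 by omega, hcount'] at hpos
    refine ⟨hvar, harr, hext, hpos, fun i hi => hR _ (by omega) (by omega), fun w hw hE => ?_⟩
    obtain ⟨j, hj, rfl⟩ := hrl.surj w hw.1 hw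
    obtain ⟨x, h3, h4, h5⟩ := hsurj j (by omega) hE
    exact ⟨x - s.var 15, by omega, by rw [Nat.add_sub_cancel' h3, h5]⟩

end BipartiteMatching

/-! ### Choosing the shorter list for every left vertex -/

namespace BipartiteMatching

open WordRAM

/-- The graph `D` with the lists found in the memory. -/
def Net.ofState (D : Net) (s : State) : Net :=
  { D with ext := s.arr 4, base := s.arr 5, len := s.arr 6, dense := s.arr 7 }

/-- The lists of later vertices are written from `pos` on, so the list of `u` persists. -/
theorem Net.Prepared.congr {D D' : Net} {pos pos' u : ℕ} (h : Net.Prepared D pos u)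
    (hn : D'.n = D.n) (hside : D'.side = D.side) (hadj : D'.adj = D.adj) (hE : D'.E = D.E)
    (hbase : D'.base u = D.base u) (hlen : D'.len u = D.len u) (hdense : D'.dense u = D.dense u)
    (hext : ∀ i < pos, D'.ext i = D.ext i) (hpos : pos ≤ pos') : Net.Prepared D' pos' u := by
  have hx : D.dense u ≠ 0 → ∀ i < D.len u, D'.ext (D.base u + i) = D.ext (D.base u + i) :=
    fun hd i hi => hext _ (by have := h.lt hd; omega)
  have hR : ∀ w, D'.R w ↔ D.R w := fun w => by simp only [Net.R, hn, hside]
  have hrb : ∀ i, D'.rightBelow i = D.rightBelow i := fun i => by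
    ext w
    simp only [Net.mem_rightBelow, hR]
  refine ⟨?_, ?_, ?_, ?_, ?_, ?_, ?_⟩
  · rw [hE, hadj, hbase, hlen, hdense]
    exact h.sparse
  · rw [hbase, hlen, hdense]
    intro hd i hi
    rw [hx hd i hi, hR]
    exact h.right hd i hi
  · rw [hbase, hlen, hdense, hE]
    intro hd i hi
    rw [hx hd i hi]
    exact h.not_adj hd i hi
  · rw [hbase, hlen, hdense, hE]
    intro hd w hw hwE
    obtain ⟨i, hi, hiw⟩ := h.cover hd w ((hR w).1 hw) hwE
    exact ⟨i, hi, by rw [hx hd i hi, hiw]⟩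
  · rw [hbase, hlen, hdense]
    intro hd
    exact (h.lt hd).trans hpos
  · have := h.len_le_deg
    rwa [hlen, Net.deg, hE, hn, hrb]
  · have := h.len_le_codeg
    rwa [hlen, Net.codeg, hE, hn, hrb]

/-- Prepare the list of the left vertex `var 1`. -/
def prepareVertex : Cmd :=
  .assign 13 (.sub (.get 1 (.add (.var 1) (.lit 1))) (.get 1 (.var 1))) ;;
  .ite (.lt (.var 14) (.add (.var 13) (.var 13)))
    (tagNeighbours ;; (.put 5 (.var 1) (.var 15) ;; .put 7 (.var 1) (.lit 1)) ;; collect ;;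
      .put 6 (.var 1) (.sub (.var 15) (.get 5 (.var 1))))
    (.put 5 (.var 1) (.get 1 (.var 1)) ;; .put 6 (.var 1) (.var 13))

/-- Prepare all lists. -/
def prepare : Cmd :=
  .loop (.lt (.var 1) (.var 0))
    (.ite (.eq (.get 0 (.var 1)) (.lit 0)) prepareVertex .skip ;;
      .assign 1 (.add (.var 1) (.lit 1)))

/-- The lists of the vertices below `u` have been prepared, starting from the memory `s`. -/
structure Preparing (D : Net) (s : State) (u v : ℕ) (s' : State) : Prop where
  var : ∀ x, x ≠ 1 → x ≠ 3 → x ≠ 13 → x ≠ 15 → x ≠ 17 → s'.var x = s.var x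
  index : s'.var 1 = v
  arr : ∀ a, a < 4 ∨ 7 < a → a ≠ 17 → s'.arr a = s.arr a
  prepared : ∀ u' < u, D.L u' → Net.Prepared (D.ofState s') (s'.var 15) u'
  rest : ∀ u', ¬ (u' < u ∧ D.L u') → s'.arr 6 u' = 0 ∧ s'.arr 7 u' = 0
  pos : s'.var 15 ≤ s.arr 1 u
  tag : ∀ x, s'.arr 17 x ≤ u

/-- Non-neighbours are listed exactly if there are fewer than `2 * deg u` right vertices, that is,
if `codeg u < deg u`. Running through all right vertices then takes time `O(deg u)`. Moreover the
new list is shorter than the old one, so the write position never overtakes the offsets of the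
input. -/
theorem prepareVertex_runs {D : Net} {N u : ℕ} {s s' : State} (hs : Bdd N s')
    (hD : D.AdjacencyLists (s.arr 1)) (hN : D.n + 2 < N) (hadj : s.arr 2 = D.adj)
    (hrl : Listed D (s.arr 16) D.n (s.var 14)) (hu : D.L u) (h : Preparing D s u u s') :
    Runs N prepareVertex ((D.deg u + 1) * 300) s' (Preparing D s (u + 1) u) := by
  have hun := hu.1
  have hmono := hD.mono u (u + 1) (by omega) hun
  have hdeg := hD.deg hu
  have hcard := hrl.card
  rw [← D.deg_add_codeg (u := u)] at hcard
  have hpos := h.pos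
  have hoff := hs.arr 1 (u + 1)
  rw [h.arr 1 (by decide) (by decide)] at hoff
  have h1 : Runs N (.assign 13 (.sub (.get 1 (.add (.var 1) (.lit 1))) (.get 1 (.var 1)))) 8 s'
      fun s'' => s'' = s'.setVar 13 (D.deg u) :=
    (Runs.of_wp hs (by decide) (by
      simp [wp, Expr.Small, Expr.val, h.index, h.arr 1 (by decide) (by decide), hdeg]
      omega)).mono (by decide) fun _ _ => id
  refine (h1.seq (T' := D.deg u * 300 + 200) ?_).mono (by omega) fun _ _ => id
  rintro s1 hs1 rfl
  have a1 : (s'.setVar 13 (D.deg u)).arr 1 = s.arr 1 := h.arr 1 (by decide) (by decide)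
  refine (Runs.ite (T := D.deg u * 300 + 190) hs1 (by decide) (fun hb => ?_) (fun hb => ?_)).mono
    (by simp [Test.cost, Expr.cost]; omega) fun _ _ => id
  · simp [Test.Holds, Expr.val, h.var] at hb
    refine ((tagNeighbours_runs (D := D) (u := u) hs1 (by rwa [a1]) hN
      ((h.arr 2 (by decide) (by decide)).trans hadj) (by simp [h.index]) hu (by simpa using h.tag)).seq
        (T' := D.deg u * 200 + 100) ?_).mono (by omega) fun _ _ => id
    rintro s2 hs2 ⟨hvar2, harr2, htag2, htagE⟩
    simp only [State.setVar_var, State.setVar_arr] at hvar2 harr2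
    have h3 : Runs N (.put 5 (.var 1) (.var 15) ;; .put 7 (.var 1) (.lit 1)) 6 s2
        fun s'' => s'' = (s2.setArr 5 u (s'.var 15)).setArr 7 u 1 :=
      (Runs.of_wp hs2 (by decide) (by
        simp [wp, Expr.Small, Expr.val, hvar2, h.index])).mono (by decide) fun _ _ => id
    refine (h3.seq (T' := D.deg u * 200 + 90) ?_).mono (by omega) fun _ _ => id
    rintro s3 hs3 rfl
    refine ((collect_runs (D := D) (u := u) hs3 ?_ ?_ ?_ ?_).seq (T' := 10) ?_).mono ?_
      fun _ _ => id
    · simp [hvar2]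
      omega
    · simp [hvar2, h.index]
    · simpa [hvar2, harr2, h.var, h.arr] using hrl
    · simpa using htagE
    swap
    · simp [hvar2, h.var]
      omega
    rintro s4 hs4 ⟨hvar4, harr4, hext4, hpos4, hR4, hcov4⟩
    simp [hvar2] at hvar4 harr4 hext4 hpos4 hR4 hcov4
    have hlt := hs4.var 15
    refine (Runs.of_wp hs4 (by decide) ?_).mono (by decide) fun _ _ => id
    simp [wp, Expr.Small, Expr.val, hvar4, hvar2, h.index, harr4, hpos4]
    refine ⟨by omega, ?_, ?_, ?_, ?_, ?_, ?_, ?_⟩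
    · intro x x1 x3 x13 x15 x17
      simp [hvar4, hvar2, h.var, x1, x3, x13, x15, x17]
    · simp [hvar4, hvar2, h.index]
    · intro a ha ha'
      have : a ≠ 4 ∧ a ≠ 5 ∧ a ≠ 6 ∧ a ≠ 7 := by omega
      simp [harr4, harr2, this, ha', h.arr a ha ha']
    · intro u' hu' hL'
      rcases Nat.lt_succ_iff_lt_or_eq.1 hu' with hu' | rfl
      · refine (h.prepared u' hu' hL').congr rfl rfl rfl rfl ?_ ?_ ?_ ?_ ?_ <;>
          simp [Net.ofState, harr4, harr2, hu'.ne, hpos4]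
        intro i hi
        simp [hext4 i hi, harr2]
      · refine ⟨?_, ?_, ?_, ?_, ?_, ?_, ?_⟩ <;> simp [Net.ofState, harr4, hpos4]
        · exact fun i hi => (hR4 i hi).1
        · exact fun i hi => (hR4 i hi).2
        · exact hcov4
        · change D.codeg u' ≤ D.deg u'
          omega
        · exact le_rfl
    · intro u' hu'
      have hne : u' ≠ u := by
        rintro rfl
        exact hu' ⟨by omega, hu⟩
      have := h.rest u' fun h' => hu' ⟨by omega, h'.2⟩
      simpa [harr4, harr2, hne] using this
    · simp [hpos4]
      omega
    · intro x
      simpa [harr4] using htag2 x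
  · simp [Test.Holds, Expr.val, h.var] at hb
    have hoff' := hs.arr 1 u
    refine (Runs.of_wp hs1 (by decide) ?_).mono (by simp [Cmd.time, Expr.cost]) fun _ _ => id
    simp [wp, Expr.Small, Expr.val, h.index]
    have hdu : s'.arr 7 u = 0 := (h.rest u (by omega)).2
    refine ⟨?_, ?_, ?_, ?_, ?_, ?_, ?_⟩
    · intro x x1 x3 x13 x15 x17
      simp [h.var, x1, x3, x13, x15, x17]
    · simp [h.index]
    · intro a ha ha'
      have : a ≠ 4 ∧ a ≠ 5 ∧ a ≠ 6 ∧ a ≠ 7 := by omega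
      simp [this, h.arr a ha ha']
    · intro u' hu' hL'
      rcases Nat.lt_succ_iff_lt_or_eq.1 hu' with hu' | rfl
      · refine (h.prepared u' hu' hL').congr rfl rfl rfl rfl ?_ ?_ ?_ ?_ ?_ <;>
          simp [Net.ofState, hu'.ne]
      · refine ⟨?_, ?_, ?_, ?_, ?_, ?_, ?_⟩ <;>
          simp [Net.ofState, hdu, h.arr 1 (by decide) (by decide)]
        · intro w
          rw [hD.mem u' hu w]
          constructor
          · rintro ⟨i, h2, h3, h4⟩
            exact ⟨i - s.arr 1 u', by omega, by rw [Nat.add_sub_cancel' h2, h4]⟩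
          · rintro ⟨i, h2, h3⟩
            exact ⟨s.arr 1 u' + i, by omega, by omega, h3⟩
        · exact le_rfl
        · change D.deg u' ≤ D.codeg u'
          omega
    · intro u' hu'
      have hne : u' ≠ u := by
        rintro rfl
        exact hu' ⟨by omega, hu⟩
      have := h.rest u' fun h' => hu' ⟨by omega, h'.2⟩
      simpa [hne] using this
    · simp
      omega
    · intro x
      have := h.tag x
      simp
      omega

/-- The time for a vertex is governed by its degree, a difference of offsets; the budget therefore
telescopes. -/
theorem prepare_runs {D : Net} {N : ℕ} {s : State} (hs : Bdd N s)
    (hD : D.AdjacencyLists (s.arr 1)) (hN : D.n + 2 < N) (h0 : s.var 0 = D.n)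
    (hside : s.arr 0 = D.side) (hadj : s.arr 2 = D.adj)
    (hrl : Listed D (s.arr 16) D.n (s.var 14)) (h1 : s.var 1 = 0) (h15 : s.var 15 = 0)
    (h6 : ∀ u, s.arr 6 u = 0) (h7 : ∀ u, s.arr 7 u = 0) (h17 : ∀ x, s.arr 17 x = 0) :
    Runs N prepare ((D.n + s.arr 1 D.n + 1) * 400) s fun s' => ∃ D' : Net, D'.Valid ∧
      D'.Stored s' ∧ D'.n = D.n ∧ D'.E = D.E ∧ D'.side = D.side ∧
      (∀ u, ¬ D.L u → D'.len u = 0) ∧ (∀ u, D.L u → D'.len u ≤ D.deg u ∧ D'.len u ≤ D.codeg u) ∧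
      (∀ x, x ≠ 1 → x ≠ 3 → x ≠ 13 → x ≠ 15 → x ≠ 17 → s'.var x = s.var x) ∧
      ∀ a, a < 4 ∨ 7 < a → a ≠ 17 → s'.arr a = s.arr a := by
  refine (Runs.loop (fun k s' => Preparing D s (s'.var 1) (s'.var 1) s' ∧ s'.var 1 ≤ D.n ∧
    k = ((D.n - s'.var 1) + (s.arr 1 D.n - s.arr 1 (s'.var 1))) * 350) (by decide) ?_ hs
    (k := (D.n + (s.arr 1 D.n - s.arr 1 0)) * 350) ⟨⟨fun _ _ _ _ _ _ => rfl, rfl,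
      fun _ _ _ => rfl, ?_, fun u _ => ⟨h6 u, h7 u⟩, ?_, ?_⟩, ?_, ?_⟩).mono ?_ ?_
  · rintro k s' hs' ⟨h, hle, rfl⟩ hb
    have v0 := (h.var 0 (by decide) (by decide) (by decide) (by decide) (by decide)).trans h0
    have a0 := (h.arr 0 (by decide) (by decide)).trans hside
    simp only [Test.Holds, Expr.val, v0] at hb
    have hmono := hD.mono (s'.var 1) (s'.var 1 + 1) (by omega) hb
    have hmono' := hD.mono (s'.var 1 + 1) D.n hb le_rfl
    have hfin : ∀ s'', Bdd N s'' → Preparing D s (s'.var 1 + 1) (s'.var 1) s'' →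
        Runs N (.assign 1 (.add (.var 1) (.lit 1))) 4 s'' fun s''' =>
          Preparing D s (s'''.var 1) (s'''.var 1) s''' ∧ s'''.var 1 = s'.var 1 + 1 := by
      intro s'' hs'' h
      refine (Runs.of_wp hs'' (by decide) ?_).mono (by decide) fun _ _ => id
      simp [wp, Expr.Small, Expr.val, h.index]
      exact ⟨by omega, fun x x1 x3 x13 x15 x17 => by simp [x1, h.var, x3, x13, x15, x17],
        by simp, h.arr, h.prepared, h.rest, h.pos, h.tag⟩
    by_cases hL : D.L (s'.var 1)
    · have hdeg := hD.deg hL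
      refine ⟨(4 + (D.deg (s'.var 1) + 1) * 300) + 4, ((Runs.ite hs' (by decide) (fun _ =>
        prepareVertex_runs hs' hD hN hadj hrl hL h) (fun hb' => absurd ?_ hb')).seq
        hfin).mono ?_ ?_⟩
      · simpa [Test.Holds, Expr.val, a0] using hL.2
      · simp [Test.cost, Expr.cost]
      · rintro s'' - ⟨h2, h3⟩
        refine ⟨_, ⟨h2, by omega, rfl⟩, ?_⟩
        rw [h3]
        simp [Test.cost, Expr.cost]
        omega
    · have hside0 : D.side (s'.var 1) ≠ 0 := fun h' => hL ⟨hb, h'⟩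
      have hskip : Preparing D s (s'.var 1 + 1) (s'.var 1) s' := by
        refine ⟨h.var, h.index, h.arr, fun u hu huL => ?_, fun u hu => ?_,
          h.pos.trans hmono, fun x => (h.tag x).trans (Nat.le_succ _)⟩
        · have : u ≠ s'.var 1 := by
            rintro rfl
            exact hL huL
          exact h.prepared u (by omega) huL
        · exact h.rest u fun h' => hu ⟨by omega, h'.2⟩
      refine ⟨(4 + 1) + 4, ((Runs.ite (T := 1) hs' (by decide) (fun hb' => absurd ?_ hside0)
        (fun _ => (Runs.of_wp (p := .skip) (Q := Preparing D s (s'.var 1 + 1) (s'.var 1)) hs' (by decide)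
          hskip).mono (by decide) fun _ _ => id)).seq hfin).mono ?_ ?_⟩
      · simpa [Test.Holds, Expr.val, a0] using hb'
      · simp [Test.cost, Expr.cost]
      · rintro s'' - ⟨h2, h3⟩
        refine ⟨_, ⟨h2, by omega, rfl⟩, ?_⟩
        rw [h3]
        simp [Test.cost, Expr.cost]
        omega
  · intro u' hu'
    omega
  · omega
  · intro x
    rw [h17]
    exact Nat.zero_le _
  · omega
  · simp [h1]
  · simp [Test.cost, Expr.cost]
    have := Nat.sub_le (s.arr 1 D.n) (s.arr 1 0)
    omega
  · rintro s' - ⟨⟨k, h, hle, -⟩, hb⟩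
    have v0 := (h.var 0 (by decide) (by decide) (by decide) (by decide) (by decide)).trans h0
    simp only [Test.Holds, Expr.val, v0] at hb
    have hi : s'.var 1 = D.n := by omega
    have hprep : ∀ u, D.L u → Net.Prepared (D.ofState s') (s'.var 15) u := fun u hu =>
      h.prepared u (by have := hu.1; omega) hu
    refine ⟨D.ofState s', ⟨hD.left, hD.right, ?_, ?_, ?_, ?_⟩, ⟨v0, ?_, ?_, rfl, rfl, rfl, rfl⟩,
      rfl, rfl, rfl, fun u hu => (h.rest u fun h' => hu h'.2).1,
      fun u hu => ⟨(hprep u hu).len_le_deg, (hprep u hu).len_le_codeg⟩, h.var, h.arr⟩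
    · intro u hu hd w
      simp only [Net.item, hd, if_true]
      exact (hprep u hu).sparse hd w
    · intro u hu hd i hi
      simp only [Net.item, hd, if_false]
      exact (hprep u hu).right hd i hi
    · intro u hu hd i hi
      simp only [Net.item, hd, if_false]
      exact (hprep u hu).not_adj hd i hi
    · intro u hu hd w hw hE
      simp only [Net.item, hd, if_false]
      exact (hprep u hu).cover hd w hw hE
    · exact (h.arr 0 (by decide) (by decide)).trans hside
    · exact (h.arr 2 (by decide) (by decide)).trans hadj

end BipartiteMatching

namespace BipartiteMatching

open WordRAM

/-! ### The program -/

/-- The maximum matching program: it prepares for each left vertex the shorter one of the list of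
its neighbours and the list of its non-neighbours, runs the phases, and completes the matching by
single augmenting paths. -/
def maximumMatching : Cmd := listRight ;; prepare ;; phases ;; rounds

/-- The switching class enters through `hT` only: `T` bounds the total length of any lists that are
no longer than either choice. -/
theorem maximumMatching_runs {D : Net} {N T : ℕ} {s : State} (hs : Bdd N s)
    (hD : D.AdjacencyLists (s.arr 1)) (hN : 4 * D.n + 4 < N) (h0 : s.var 0 = D.n)
    (hside : s.arr 0 = D.side) (hadj : s.arr 2 = D.adj) (hvar : ∀ x, x ≠ 0 → s.var x = 0)
    (harr : ∀ a, 2 < a → ∀ i, s.arr a i = 0)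
    (hT : ∀ len : ℕ → ℕ, (∀ u, ¬ D.L u → len u = 0) →
      (∀ u, D.L u → len u ≤ D.deg u ∧ len u ≤ D.codeg u) → ∑ u ∈ Finset.range D.n, len u ≤ T) :
    Runs N maximumMatching ((D.n + 1) * 40 + ((D.n + s.arr 1 D.n + 1) * 400 +
      ((Nat.sqrt D.n + 2) * ((T + D.n + 1) * 2100) +
        (Nat.sqrt D.n + 3) * ((T + D.n + 1) * 2010)))) s fun s' =>
      D.Matched (s'.arr 3) D.n ∧
        ∃ C, D.IsCover C ∧ C.card ≤ (D.matchedLeft (s'.arr 3)).card := by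
  refine (listRight_runs hs (by omega) h0 hside (hvar 12 (by decide)) (hvar 14 (by decide))).seq ?_
  rintro s1 hs1 ⟨hrl, hvar1, harr1⟩
  have hz1 : ∀ a, 2 < a → a ≠ 16 → ∀ i, s1.arr a i = 0 := fun a ha ha' i => by
    rw [harr1 a ha', harr a ha]
  refine ((prepare_runs hs1 (by rwa [harr1 1 (by decide)]) (by omega)
    ((hvar1 0 (by decide) (by decide)).trans h0) ((harr1 0 (by decide)).trans hside)
    ((harr1 2 (by decide)).trans hadj) hrl
    ((hvar1 1 (by decide) (by decide)).trans (hvar 1 (by decide)))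
    ((hvar1 15 (by decide) (by decide)).trans (hvar 15 (by decide)))
    (hz1 6 (by decide) (by decide)) (hz1 7 (by decide) (by decide))
    (hz1 17 (by decide) (by decide))).mono (T' := (D.n + s.arr 1 D.n + 1) * 400)
      (by rw [harr1 1 (by decide)]) fun _ _ => id).seq ?_
  rintro s2 hs2 ⟨D', hV, hst, hn, hE, hsd, hlen0, hlen, hvar2, harr2⟩
  have hsize : D'.size ≤ T := by
    have := hT D'.len hlen0 hlen
    rwa [← hn] at this
  have hz2 : ∀ a, 7 < a → a ≠ 16 → a ≠ 17 → ∀ i, s2.arr a i = 0 := fun a h1 h2 h3 i => by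
    rw [harr2 a (.inr h1) h3, hz1 a (by omega) h2]
  have hv2 : ∀ x, x = 6 ∨ x = 16 → s2.var x = 0 := fun x hx => by
    rw [hvar2 x (by omega) (by omega) (by omega) (by omega) (by omega),
      hvar1 x (by omega) (by omega), hvar x (by omega)]
  have hm : ∀ v, s2.arr 3 v = 0 := fun v => by
    rw [harr2 3 (by decide) (by decide), hz1 3 (by decide) (by decide)]
  have h10 := hz2 10 (by decide) (by decide) (by decide)
  have h11 := hz2 11 (by decide) (by decide) (by decide)
  have hB : Between D' 0 0 s2 := by
    refine ⟨hst, hv2 6 (.inl rfl), hv2 16 (.inr rfl), fun w => by rw [h11]; exact Nat.zero_le _,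
      fun x u _ h => ?_, ⟨⟨fun {u w} _ _ h => ?_, fun {u w} _ h => ?_⟩,
      fun w _ _ => by rw [h10, h11], fun w _ h => absurd (hm w) h,
      fun w _ => by rw [h10, h11], fun u x _ h => ?_, fun _ _ _ _ _ => Nat.zero_le _⟩⟩
    · rw [hz2 13 (by decide) (by decide) (by decide)] at h
      omega
    · rw [hm] at h
      omega
    · rw [hm] at h
      omega
    · rw [hm] at h
      omega
  refine ((phases_runs hV hs2 (by omega) hB).mono
    (T' := (Nat.sqrt D.n + 2) * ((T + D.n + 1) * 2100)) ?_ fun _ _ => id).seq ?_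
  · rw [hn]
    gcongr
  rintro s3 hs3 ⟨r, hB3, hr, hr'⟩
  obtain ⟨C, hC, hd⟩ := hB3.prices.exists_cover hV hr
  refine (rounds_runs hV hs3 (by omega) ⟨hB3.stored, hB3.mark, hB3.prices.matched⟩ hC hd).mono ?_ ?_
  · rw [hn] at hr' ⊢
    exact Nat.mul_le_mul (by omega) (by gcongr)
  · rintro s4 - ⟨hR, C', hC', hcard⟩
    -- `D'` and `D` agree in their vertices, sides and edges, and the conclusion refers to nothing
    -- else.
    obtain ⟨n', side', adj', ext', base', len', dense', E'⟩ := D'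
    simp only at hn hE hsd
    subst hn hE hsd
    exact ⟨⟨hR.matched.left, hR.matched.right⟩, C', hC', hcard⟩

end BipartiteMatching

namespace BipartiteMatching

open WordRAM

section Graph

variable {n : ℕ} {G : SimpleGraph (Fin n)} {c : G.Coloring Bool} {adj : Fin n → List (Fin n)}

/-! ### The graph of the input -/

/-- The position at which the list of `u` begins. -/
def listStart (adj : Fin n → List (Fin n)) (u : ℕ) : ℕ :=
  (((List.ofFn adj).map List.length).take u).sum

theorem listStart_succ (u : Fin n) :
    listStart adj (u + 1) = listStart adj u + (adj u).length := by
  rw [listStart, List.sum_take_succ _ _ (by simp)]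
  simp [listStart]

theorem listStart_mono {u v : ℕ} (h : u ≤ v) : listStart adj u ≤ listStart adj v :=
  List.monotone_sum_take _ h

theorem input_arr_one {u : ℕ} (hu : u ≤ n) :
    (MatchingProblem.input c adj).arr 1 u = listStart adj u :=
  if_pos hu

theorem input_arr_two (u : Fin n) {i : ℕ} (hi : i < (adj u).length) :
    (MatchingProblem.input c adj).arr 2 (listStart adj u + i) = (adj u)[i] := by
  have h := List.drop_take_succ_flatten_eq_getElem (List.ofFn adj) u (by simp)
  have h' : (List.ofFn adj).flatten[listStart adj u + i]? = some (adj u)[i] := by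
    have h2 := congrArg (fun l => l[i]?) h
    have h3 := listStart_succ (adj := adj) u
    simp only [List.getElem?_drop, List.getElem_ofFn] at h2
    rw [← List.getElem?_take_of_lt (i := listStart adj u + i) (j := listStart adj (u + 1))
      (by omega)]
    exact h2.trans (List.getElem?_eq_getElem hi)
  change ((List.ofFn adj).flatten.map Fin.val).getD _ 0 = _
  rw [List.getD_eq_getElem?_getD, List.getElem?_map, h']
  rfl

theorem input_arr_zero (u : Fin n) : (MatchingProblem.input c adj).arr 0 u = (c u).toNat := by
  simp [MatchingProblem.input]

/-- The bipartite graph given by the input. -/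
def inputNet (c : G.Coloring Bool) (adj : Fin n → List (Fin n)) : Net where
  n := n
  side := (MatchingProblem.input c adj).arr 0
  adj := (MatchingProblem.input c adj).arr 2
  ext _ := 0
  base _ := 0
  len _ := 0
  dense _ := 0
  E u w := ∃ (hu : u < n) (hw : w < n), G.Adj ⟨u, hu⟩ ⟨w, hw⟩ ∧ c ⟨u, hu⟩ = false

theorem inputNet_L (u : Fin n) : (inputNet c adj).L u ↔ c u = false := by
  have h : (inputNet c adj).side u = (c u).toNat := input_arr_zero (adj := adj) u
  rw [Net.L, h]
  cases c u <;> simp [inputNet]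

theorem inputNet_R (u : Fin n) : (inputNet c adj).R u ↔ c u = true := by
  have h : (inputNet c adj).side u = (c u).toNat := input_arr_zero (adj := adj) u
  rw [Net.R, h]
  cases c u <;> simp [inputNet]

theorem inputNet_E (u w : Fin n) : (inputNet c adj).E u w ↔ G.Adj u w ∧ c u = false :=
  ⟨fun ⟨_, _, h⟩ => h, fun h => ⟨u.2, w.2, h⟩⟩

theorem color_right {u w : Fin n} (h : G.Adj u w) (hu : c u = false) : c w = true := by
  have := c.valid h
  rw [hu] at this
  cases hw : c w
  · exact absurd hw.symm this
  · rfl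

theorem adjacencyLists_input (hadj : MatchingProblem.IsAdjacencyList G adj) :
    (inputNet c adj).AdjacencyLists ((MatchingProblem.input c adj).arr 1) := by
  have hget : ∀ u : Fin n, ∀ i, listStart adj u ≤ i → i < listStart adj (u + 1) →
      ∃ h : i - listStart adj u < (adj u).length,
        (inputNet c adj).adj i = (adj u)[i - listStart adj u] := fun u i h1 h2 => by
    have h3 := listStart_succ (adj := adj) u
    have h4 : i - listStart adj u < (adj u).length := by omega
    have h5 := input_arr_two (c := c) u h4
    rw [Nat.add_sub_cancel' h1] at h5
    exact ⟨h4, h5⟩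
  refine ⟨?_, ?_, ?_, ?_, ?_⟩
  · rintro u w ⟨hu, hw, h⟩
    exact (inputNet_L ⟨u, hu⟩).2 h.2
  · rintro u w ⟨hu, hw, h⟩
    exact (inputNet_R ⟨w, hw⟩).2 (color_right h.1 h.2)
  · intro u v huv hv
    have hv : v ≤ n := hv
    rw [input_arr_one hv, input_arr_one (huv.trans hv)]
    exact listStart_mono huv
  · intro u hu w
    have hun : u < n := hu.1
    lift u to Fin n using hun
    rw [input_arr_one (u := u + 1) u.2, input_arr_one u.2.le]
    constructor
    · rintro ⟨_, hw, h, _⟩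
      obtain ⟨i, hi, hiw⟩ := List.getElem_of_mem (((hadj u).2 _).2 h)
      have h3 := listStart_succ (adj := adj) u
      refine ⟨listStart adj u + i, by omega, by omega, ?_⟩
      exact (input_arr_two (c := c) u hi).trans (by rw [hiw])
    · rintro ⟨i, h1, h2, rfl⟩
      obtain ⟨h3, h4⟩ := hget u i h1 h2
      rw [h4, inputNet_E]
      exact ⟨((hadj u).2 _).1 (List.getElem_mem h3), (inputNet_L u).1 hu⟩
  · intro u hu i j hi hi' hj hj' hij
    have hun : u < n := hu.1
    lift u to Fin n using hun
    rw [input_arr_one (u := u + 1) u.2] at hi' hj'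
    rw [input_arr_one u.2.le] at hi hj
    obtain ⟨h1, h2⟩ := hget u i hi hi'
    obtain ⟨h3, h4⟩ := hget u j hj hj'
    rw [h2, h4] at hij
    have := (List.Nodup.getElem_inj_iff (hadj u).1).1 (Fin.val_injective hij)
    omega

/-- The handshake lemma; it turns the preparation time into `O(n + m)`. -/
theorem listStart_last (hadj : MatchingProblem.IsAdjacencyList G adj) :
    listStart adj n = 2 * G.edgeSet.ncard := by
  classical
  have h : ∀ v, (adj v).length = G.degree v := fun v => by
    rw [← List.toFinset_card_of_nodup (hadj v).1, ← G.card_neighborFinset_eq_degree]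
    congr 1
    ext w
    simp [(hadj v).2]
  rw [Set.ncard_eq_toFinset_card', Set.toFinset_card, ← SimpleGraph.edgeFinset_card,
    ← G.sum_degrees_eq_twice_card_edges, listStart, List.take_of_length_le (by simp),
    List.map_ofFn, List.sum_ofFn]
  exact Finset.sum_congr rfl fun v _ => h v

/-- The factor `8` makes room for the offsets, which reach `2 * m`, and for the requirement `4 * n +
4 < N` of the program. -/
theorem bdd_input (hn : 0 < n) (hadj : MatchingProblem.IsAdjacencyList G adj) :
    Bdd (8 * (n + G.edgeSet.ncard + 1)) (MatchingProblem.input c adj) := by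
  have hle : ∀ u ≤ n, listStart adj u ≤ 2 * G.edgeSet.ncard := fun u hu =>
    (listStart_mono hu).trans (listStart_last hadj).le
  refine ⟨by omega, fun x => ?_, fun a i => ?_⟩
  · simp only [MatchingProblem.input]
    split_ifs <;> omega
  · match a with
    | 0 =>
      simp only [MatchingProblem.input]
      split_ifs with h
      · have := Bool.toNat_le (c ⟨i, h⟩)
        omega
      · omega
    | 1 =>
      by_cases h : i ≤ n
      · rw [input_arr_one h]
        have := hle i h
        omega
      · simp [MatchingProblem.input, h]
    | 2 =>
      simp only [MatchingProblem.input, List.getD_eq_getElem?_getD, List.getElem?_map]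
      cases (List.ofFn adj).flatten[i]? with
      | none => simp
      | some v =>
        have := v.2
        simp
        omega
    | a + 3 =>
      simp [MatchingProblem.input]

/-! ### Minimum representatives -/

theorem numArcs_congr {V : Type*} {D H : Digraph V} (e : D.Adj ≃r H.Adj) :
    Switching.numArcs D = Switching.numArcs H := by
  have h : {p : V × V | D.Adj p.1 p.2} =
      (e.toEquiv.prodCongr e.toEquiv) ⁻¹' {p : V × V | H.Adj p.1 p.2} := by
    ext p
    exact e.map_rel_iff.symm
  rw [Switching.numArcs, Switching.numArcs, h]
  exact Set.ncard_preimage_of_injective_subset_range (Equiv.injective _) (by simp)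

theorem sum_outdegree_eq_numArcs {D : Digraph (Fin n)} [DecidableRel D.Adj] :
    ∑ v, (Finset.univ.filter (D.Adj v)).card = Switching.numArcs D := by
  rw [Switching.numArcs, Set.ncard_eq_toFinset_card']
  rw [Set.toFinset_ofPred, Finset.card_filter, Fintype.sum_prod_type]
  exact Finset.sum_congr rfl fun v _ => Finset.card_filter _ _

/-- The minimum is attained, up to isomorphism, by the out-switch at some `U`. Compare the sum with
its out-degrees vertex by vertex: a left vertex in `U` has its non-neighbours on the right as
out-neighbours, any other left vertex its neighbours; right vertices contribute nothing on the left
side of the inequality. -/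
theorem sum_le_minArcs {len : ℕ → ℕ} (hlen : ∀ u, ¬ (inputNet c adj).L u → len u = 0)
    (hlen' : ∀ u, (inputNet c adj).L u →
      len u ≤ (inputNet c adj).deg u ∧ len u ≤ (inputNet c adj).codeg u) :
    ∑ u ∈ Finset.range n, len u ≤ Switching.minArcs G c := by
  classical
  have hne : (Switching.numArcs '' Switching.switchingClass c (Switching.ofGraph G)).Nonempty :=
    ⟨_, _, ⟨∅, ⟨RelIso.refl _⟩⟩, rfl⟩
  obtain ⟨H, ⟨U, ⟨e⟩⟩, hH⟩ := Nat.sInf_mem hne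
  rw [Switching.minArcs, ← hH, ← numArcs_congr e, ← sum_outdegree_eq_numArcs, Finset.sum_range]
  refine Finset.sum_le_sum fun u _ => ?_
  by_cases hL : (inputNet c adj).L u
  swap
  · rw [hlen u hL]
    exact Nat.zero_le _
  have hu := (inputNet_L u).1 hL
  by_cases hU : u ∈ U
  · refine (hlen' u hL).2.trans (Finset.card_le_card_of_surjOn Fin.val ?_)
    intro w hw
    simp only [Finset.coe_filter, Net.mem_rightBelow, Set.mem_ofPred_eq] at hw
    obtain ⟨⟨hwn, hwR⟩, hwE⟩ := hw
    have hwn : w < n := hwn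
    lift w to Fin n using hwn
    have hw := (inputNet_R w).1 hwR
    refine ⟨w, ?_, rfl⟩
    simp only [Finset.coe_filter, Finset.mem_univ, true_and, Set.mem_ofPred_eq]
    exact .inl ⟨hU, by simp [hu, hw], fun h => hwE ((inputNet_E u w).2 ⟨h, hu⟩)⟩
  · refine (hlen' u hL).1.trans (Finset.card_le_card_of_surjOn Fin.val ?_)
    intro w hw
    simp only [Finset.coe_filter, Net.mem_rightBelow, Set.mem_ofPred_eq] at hw
    obtain ⟨⟨hwn, hwR⟩, hwE⟩ := hw
    have hwn : w < n := hwn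
    lift w to Fin n using hwn
    refine ⟨w, ?_, rfl⟩
    simp only [Finset.coe_filter, Finset.mem_univ, true_and, Set.mem_ofPred_eq]
    exact .inr ⟨hU, ((inputNet_E u w).1 hwE).1⟩

/-! ### The matching that is found -/

/-- Each edge chooses an end in the cover; as the edges of a matching share no ends, the choice is
injective. -/
theorem matching_ncard_le_cover {C : Finset ℕ} (hC : (inputNet c adj).IsCover C)
    {M : G.Subgraph} (hM : M.IsMatching) : M.edgeSet.ncard ≤ C.card := by
  have key : ∀ e ∈ M.edgeSet, ∃ v : Fin n, v ∈ e ∧ (v : ℕ) ∈ C := by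
    intro e
    induction e with | _ u w
    intro h
    have hadj : G.Adj u w := M.adj_sub h
    cases hu : c u with
    | false =>
      rcases hC u w ((inputNet_E u w).2 ⟨hadj, hu⟩) with h' | h'
      · exact ⟨u, by simp, h'⟩
      · exact ⟨w, by simp, h'⟩
    | true =>
      have hw : c w = false := by
        have := c.valid hadj
        rw [hu] at this
        cases hw : c w
        · rfl
        · exact absurd hw.symm this
      rcases hC w u ((inputNet_E w u).2 ⟨hadj.symm, hw⟩) with h' | h'
      · exact ⟨w, by simp, h'⟩
      · exact ⟨u, by simp, h'⟩
  have huniq : ∀ e ∈ M.edgeSet, ∀ e' ∈ M.edgeSet, ∀ v : Fin n, v ∈ e → v ∈ e' → e = e' := by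
    intro e he e' he' v hv hv'
    obtain ⟨w, rfl⟩ := Sym2.mem_iff_exists.1 hv
    obtain ⟨w', rfl⟩ := Sym2.mem_iff_exists.1 hv'
    have h1 : M.Adj v w := he
    rw [(hM (M.edge_vert h1)).unique h1 he']
  rcases M.edgeSet.eq_empty_or_nonempty with h0 | ⟨e0, h0⟩
  · simp [h0]
  have : Nonempty (Fin n) := ⟨(key e0 h0).choose⟩
  choose! f hf using key
  rw [← Set.ncard_coe_finset C]
  refine Set.ncard_le_ncard_of_injOn (fun e => (f e : ℕ)) (fun e he => (hf e he).2) ?_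
  intro e he e' he' h
  have h : f e = f e' := Fin.val_injective h
  exact huniq e he e' he' (f e) (hf e he).1 (h ▸ (hf e' he').1)

theorem matched_symm {m : ℕ → ℕ} (hm : (inputNet c adj).Matched m n) {u w : Fin n}
    (h : m u = w + 1) : G.Adj u w ∧ m w = u + 1 := by
  cases hu : c u with
  | false =>
    obtain ⟨h1, h2⟩ := hm.left ((inputNet_L u).2 hu) u.2.ne h
    exact ⟨((inputNet_E u w).1 h1).1, h2⟩
  | true =>
    obtain ⟨-, h1, h2⟩ := hm.right ((inputNet_R u).2 hu) h
    exact ⟨((inputNet_E w u).1 h1).1.symm, h2⟩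

theorem matched_lt {m : ℕ → ℕ} (hm : (inputNet c adj).Matched m n) {u : Fin n} {w : ℕ}
    (h : m u = w + 1) : w < n := by
  cases hu : c u with
  | false =>
    obtain ⟨⟨_, hw, _⟩, _⟩ := hm.left ((inputNet_L u).2 hu) u.2.ne h
    exact hw
  | true =>
    obtain ⟨-, ⟨hw, _, _⟩, _⟩ := hm.right ((inputNet_R u).2 hu) h
    exact hw

/-- The matching described by an array of partners. -/
def matchingOf {m : ℕ → ℕ} (hm : (inputNet c adj).Matched m n) : G.Subgraph where
  verts := {v | m v ≠ 0}
  Adj u w := m u = w + 1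
  adj_sub h := (matched_symm hm h).1
  edge_vert h := by
    rw [Set.mem_ofPred_eq, h]
    exact Nat.succ_ne_zero _
  symm := ⟨fun _ _ h => (matched_symm hm h).2⟩

theorem isMatching_matchingOf {m : ℕ → ℕ} (hm : (inputNet c adj).Matched m n) :
    (matchingOf hm).IsMatching := by
  intro v hv
  obtain ⟨w, hw⟩ := Nat.exists_eq_succ_of_ne_zero hv
  refine ⟨⟨w, matched_lt hm hw⟩, hw, fun w' h => ?_⟩
  have h : m v = w' + 1 := h
  exact Fin.ext (by simp; omega)

theorem describes_matchingOf {m : ℕ → ℕ} (hm : (inputNet c adj).Matched m n) :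
    MatchingProblem.Describes m (matchingOf hm) := by
  refine fun v => ⟨fun u h => h, fun h => ?_⟩
  by_contra h0
  obtain ⟨w, hw⟩ := Nat.exists_eq_succ_of_ne_zero h0
  exact h ⟨w, matched_lt hm hw⟩ hw

/-- A matched left vertex is recovered from its matching edge as the only left end. -/
theorem card_matchedLeft_le {m : ℕ → ℕ} (hm : (inputNet c adj).Matched m n) :
    ((inputNet c adj).matchedLeft m).card ≤ (matchingOf hm).edgeSet.ncard := by
  have key : ∀ u ∈ (inputNet c adj).matchedLeft m, ∃ e ∈ (matchingOf hm).edgeSet,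
      (∃ v ∈ e, (v : ℕ) = u) ∧ ∀ v ∈ e, c v = false → (v : ℕ) = u := by
    intro u hu
    obtain ⟨hL, h0⟩ := Net.mem_matchedLeft.1 hu
    have hun : u < n := hL.1
    lift u to Fin n using hun
    have hu := (inputNet_L u).1 hL
    obtain ⟨w, hw⟩ := Nat.exists_eq_succ_of_ne_zero h0
    have hwn := matched_lt hm hw
    lift w to Fin n using hwn
    refine ⟨s(u, w), hw, ⟨u, by simp, rfl⟩, fun v hv hvc => ?_⟩
    rcases Sym2.mem_iff.1 hv with rfl | rfl
    · rfl
    · have := color_right (matched_symm hm hw).1 hu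
      simp [hvc] at this
  rcases ((inputNet c adj).matchedLeft m).eq_empty_or_nonempty with h0 | ⟨u0, h0⟩
  · simp [h0]
  have : Nonempty (Sym2 (Fin n)) := ⟨(key u0 h0).choose⟩
  choose! f hf using key
  rw [← Set.ncard_coe_finset]
  refine Set.ncard_le_ncard_of_injOn f (fun u hu => (hf u hu).1) ?_
  intro u hu u' hu' h
  obtain ⟨⟨v, hv, rfl⟩, -⟩ := (hf u hu).2
  exact (hf u' hu').2.2 v (h ▸ hv) ((inputNet_L v).1 (Net.mem_matchedLeft.1 hu).1)

theorem isMaximumMatching_matchingOf {m : ℕ → ℕ} (hm : (inputNet c adj).Matched m n)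
    {C : Finset ℕ} (hC : (inputNet c adj).IsCover C)
    (hcard : C.card ≤ ((inputNet c adj).matchedLeft m).card) :
    IsMaximumMatching (matchingOf hm) :=
  ⟨isMatching_matchingOf hm, fun _ hM =>
    (matching_ncard_le_cover hC hM).trans (hcard.trans (card_matchedLeft_le hm))⟩

end Graph

/-! ### The running time and the main theorem -/

theorem time_le {n m T : ℕ} (hn : 0 < n) :
    (((n + 1) * 40 + ((n + 2 * m + 1) * 400 + ((Nat.sqrt n + 2) * ((T + n + 1) * 2100) +
      (Nat.sqrt n + 3) * ((T + n + 1) * 2010))) : ℕ) : ℝ) ≤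
      40000 * ((n : ℝ) ^ (3 / 2 : ℝ) + √(n : ℝ) * (T : ℝ) + (m : ℝ)) := by
  have h1 : (1 : ℝ) ≤ n := by exact_mod_cast hn
  have hq : (1 : ℝ) ≤ √(n : ℝ) := by
    rw [Real.one_le_sqrt]
    exact h1
  have hs : (Nat.sqrt n : ℝ) ≤ √(n : ℝ) := Real.nat_sqrt_le_real_sqrt
  have hpow : (n : ℝ) ^ (3 / 2 : ℝ) = n * √(n : ℝ) := by
    rw [Real.sqrt_eq_rpow, ← Real.rpow_one_add' (by positivity) (by norm_num)]
    norm_num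
  have hT : (0 : ℝ) ≤ T := Nat.cast_nonneg _
  have hm : (0 : ℝ) ≤ m := Nat.cast_nonneg _
  rw [hpow]
  push_cast
  generalize √(n : ℝ) = q at *
  generalize (Nat.sqrt n : ℝ) = k at *
  generalize (n : ℝ) = x at *
  generalize (T : ℝ) = y at *
  generalize (m : ℝ) = z at *
  have e1 : x ≤ x * q := by nlinarith
  -- The additive constants are absorbed by `1 ≤ q` and `1 ≤ x`, that is, by `n ≥ 1`.
  have e2 : (k + 2) * ((y + x + 1) * 2100) ≤ (3 * q) * ((y + 2 * x) * 2100) :=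
    mul_le_mul (by linarith) (by linarith) (by positivity) (by positivity)
  have e3 : (k + 3) * ((y + x + 1) * 2010) ≤ (4 * q) * ((y + 2 * x) * 2010) :=
    mul_le_mul (by linarith) (by linarith) (by positivity) (by positivity)
  have e4 : 0 ≤ q * y := by positivity
  nlinarith

end BipartiteMatching

open BipartiteMatching

/-- There is one program that, given a bipartite graph with `n ≥ 1` vertices and `m` edges by its
two partition classes and its adjacency lists, leaves a maximum matching in array `3` within
`O(n ^ 1.5 + √n * m' + m)` steps, where `m'` is the number of arcs of a minimum representative of
the bipartite out-switching class; words of capacity `O(n + m)` suffice. -/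
theorem mainTheorem3 :
    ∃ (P : WordRAM.Cmd) (C : ℝ) (κ : ℕ),
      ∀ (n : ℕ), 0 < n →
      ∀ (G : SimpleGraph (Fin n)) (c : G.Coloring Bool) (adj : Fin n → List (Fin n)),
        MatchingProblem.IsAdjacencyList G adj →
      ∀ (W : ℕ), κ * (n + G.edgeSet.ncard + 1) ≤ W →
        ∃ (t : ℕ) (s : WordRAM.State),
          WordRAM.Exec W P (MatchingProblem.input c adj) t s ∧
          (∃ M : G.Subgraph, IsMaximumMatching M ∧
            MatchingProblem.Describes (s.arr 3) M) ∧
          (t : ℝ) ≤ C * ((n : ℝ) ^ (3 / 2 : ℝ) + √(n : ℝ) * (Switching.minArcs G c : ℝ)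
            + (G.edgeSet.ncard : ℝ)) := by
  -- `32 = 4 * 8`: stored words stay below `8 * (n + m + 1)`, and expressions add up at most four of
  -- them.
  refine ⟨maximumMatching, 40000, 32, fun n hn G c adj hadj W hW => ?_⟩
  have hN : ∀ len : ℕ → ℕ, (∀ u, ¬ (inputNet c adj).L u → len u = 0) → (∀ u,
      (inputNet c adj).L u → len u ≤ (inputNet c adj).deg u ∧ len u ≤ (inputNet c adj).codeg u) →
      ∑ u ∈ Finset.range (inputNet c adj).n, len u ≤ Switching.minArcs G c :=
    fun _ h1 h2 => sum_le_minArcs h1 h2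
  obtain ⟨t, s, hexec, ht, -, hm, C, hC, hcard⟩ :=
    maximumMatching_runs (D := inputNet c adj) (bdd_input hn hadj) (adjacencyLists_input hadj)
      (by change 4 * n + 4 < _; omega) (by simp [MatchingProblem.input, inputNet]) rfl rfl
      (fun x hx => by simp [MatchingProblem.input, hx])
      (fun a ha i => by
        obtain ⟨b, rfl⟩ := Nat.exists_eq_add_of_lt ha
        rw [show 2 + b + 1 = b + 3 by omega]
        simp [MatchingProblem.input]) hN W (by omega)
  refine ⟨t, s, hexec, ⟨matchingOf hm, isMaximumMatching_matchingOf hm hC hcard,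
    describes_matchingOf hm⟩, ?_⟩
  refine le_trans ?_ (time_le hn)
  have h : (MatchingProblem.input c adj).arr 1 (inputNet c adj).n = 2 * G.edgeSet.ncard :=
    (input_arr_one le_rfl).trans (listStart_last hadj)
  rw [h] at ht
  exact_mod_cast ht
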